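/- **Problem.** Let $m,p\ge 1$, $n\ge 0$. For nodes $i=1,\dots,m$ let $f_i,g_i:\mathbb R^n\times\mathbb R^p\to\mathbb R$, $\theta_i^*(x)=\arg\min_\theta g_i(x,\theta)$, $\Phi_i(x)=f_i(x,\theta_i^*(x))$, $\Phi=\frac1m\sum_i\Phi_i$, $v_i^*(x)=[\nabla^2_{\theta\theta}g_i(x,\theta_i^*(x))]^{-1}\nabla_\theta f_i(x,\theta_i^*(x))$. Here $\nabla^2_{x\theta}g_i$ is the ($n\times p$) Jacobian in $\theta$ of $\nabla_xg_i$; vectors have the Euclidean norm and matrices the operator norm. **Assumptions.** Fix constants $L_{f,x},L_{f,\theta},L_{g,\theta},L_{g,x\theta},L_{g,\theta\theta},C_{f,\theta},C_{g,x\theta}>0$ (the *class constants*) and let $\mu_g,b_f,b_g>0$, $\sigma_{g,\theta},\sigma_{f,\theta},\sigma_{f,x}\ge0$, $\sigma_{g,\theta\theta},\sigma_{g,x\theta}>0$. 1. *(Network)* $W\in\mathbb R^{m\times m}$ is symmetric and doubly stochastic; for $i\ne j$, $w_{ij}>0$ exactly on the edges of a connected graph, and $w_{ij}=0$ otherwise;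 $\rho=\|W-\frac1m\mathbf 1\mathbf 1^{\top}\|^2<1$. 2. *(Outer functions)* $f_i$ is $C^1$; $\nabla_xf_i$ and $\nabla_\theta f_i$ are Lipschitz in $(x,\theta)$ with constants $L_{f,x}$, $L_{f,\theta}$; $\|\nabla_\theta f_i(x,\theta_i^*(x))\|\le C_{f,\theta}$ for all $x$. 3. *(Inner functions)* $g_i$ is $C^2$, $\mu_g$-strongly convex in $\theta$; $\nabla_\theta g_i$ is $L_{g,\theta}$-Lipschitz in $\theta$; $\nabla^2_{x\theta}g_i$ and $\nabla^2_{\theta\theta}g_i$ are Lipschitz in $(x,\theta)$ with constants $L_{g,x\theta}$, $L_{g,\theta\theta}$; $\|\nabla^2_{x\theta}g_i\|\le C_{g,x\theta}$. 4. *(Heterogeneity)* For all $x,\theta$: $\sum_i\|\nabla_xf_i(x,\theta)-\frac1m\sum_j\nabla_xf_j(x,\theta)\|^2\le b_f^2$, and likewise for $\nabla_\theta f_i$; and $\frac1m\sum_{i,j}\|D_i(x,\theta_j^*(x))-D_j(x,\theta_j^*(x))\|^2\le b_g^2$ for each of $D_i=\nabla_\theta g_i,\ \nabla^2_{x\theta}g_i,\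 \nabla^2_{\theta\theta}g_i$. 5. *(Oracles)* For each node there are five jointly measurable stochastic estimators, of $\nabla_\theta g_i,\nabla^2_{\theta\theta}g_i,\nabla^2_{x\theta}g_i,\nabla_\theta f_i,\nabla_xf_i$. At every $(x,\theta)$ they are square integrable, unbiased, and have variance at most $\sigma_{g,\theta}^2,\sigma_{g,\theta\theta}^2,\sigma_{g,x\theta}^2,\sigma_{f,\theta}^2,\sigma_{f,x}^2$. All samples (over nodes, estimators and iterations) are independent. 6. $\Phi\ge\Phi_{\rm low}$ on $\mathbb R^n$ for some $\Phi_{\rm low}\in\mathbb R$. **Algorithm (LoPA-LG)** with steps $\alpha,\beta,\lambda,\gamma$ and relaxation $\tau$. Initially $x_i^0=x^0$ for all $i$, $y_i^0=z_i^0$, and all the initial variables are deterministic. For $k\ge0$, with the estimators (written with hats) evaluated at $(x_i^k,\theta_i^k)$ and the samples of iteration $k$, let $$d_i^k=\hat\nabla_\theta g_i,\quad h_i^k=\hat\nabla^2_{\theta\theta}g_i\,v_i^k-\hat\nabla_\theta f_i,\quad s_i^k=\hat\nabla_xf_i-\hat\nabla^2_{x\theta}g_i\,v_i^k,$$ $$x_i^{k+1}=(1-\tau)x_i^k+\tau\Big(\sum_jw_{ij}x_j^k-\alpha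 y_i^k\Big),\quad \theta_i^{k+1}=\theta_i^k-\beta d_i^k,\quad v_i^{k+1}=v_i^k-\lambda h_i^k,\quad y_i^{k+1}=z_i^{k+1}=s_i^k+(1-\gamma)(z_i^k-s_i^k).$$ Let $\bar x^k=\frac1m\sum_ix_i^k$. **Constants.** Write $\mu=\mu_g$ and $\kappa=\max\{L_{f,x},L_{f,\theta},L_{g,\theta},L_{g,x\theta},L_{g,\theta\theta}\}/\mu$, $L_{\theta^*}=\frac{C_{g,x\theta}}{\mu}$, $L_v=\frac{L_{f,\theta}}{\mu}+\frac{C_{f,\theta}L_{g,\theta\theta}}{\mu^2}$, $L_{v^*}=L_v(1+L_{\theta^*})$, $L=(L_{f,x}+C_{g,x\theta}L_v+\frac{C_{f,\theta}L_{g,x\theta}}{\mu})(1+L_{\theta^*})$, $M=\frac{C_{f,\theta}}{\mu}$, $L_{fg,x}=2L_{f,x}^2+4M^2L_{g,x\theta}^2$, $L_{fg,\theta}=2L_{f,\theta}^2+4M^2L_{g,\theta\theta}^2$, $\omega=\frac{\mu L_{g,\theta}}{2(\mu+L_{g,\theta})}$, $Q=L_{fg,x}+\frac{32C_{g,x\theta}^2L_{fg,\theta}}{\mu^2}$,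 $\varphi=Q\big(1+\frac{4\max\{L_{g,\theta},C_{g,x\theta}\}^2}{\omega^2}\big)$, $$b^2=\Big(4+\tfrac{4C_{g,x\theta}^2}{\mu^2}\Big)b_f^2+4\Big(\tfrac{4C_{f,\theta}^2C_{g,x\theta}^2}{\mu^4}+\tfrac{4C_{f,\theta}^2}{\mu^2}+\tfrac{L_{f,x}^2}{\mu^2}+\tfrac{L_{f,\theta}^2C_{g,x\theta}^2}{\mu^4}+\tfrac{4C_{f,\theta}^2C_{g,x\theta}^2L_{g,\theta\theta}^2}{\mu^6}+\tfrac{4C_{f,\theta}^2L_{g,x\theta}^2}{\mu^4}\Big)b_g^2,\qquad b\ge0.$$ The step sizes are $\gamma=c_\gamma\alpha$, $\lambda=c_\lambda\alpha$, $\beta=c_\beta\alpha$. For $0<c_{\rm lo}\le c_{\rm hi}$, call $(\tau,c_\gamma,c_\lambda,c_\beta)$ *$(c_{\rm lo},c_{\rm hi})$-admissible* if $0<\tau<1$, $c_\lambda\ge\frac{48L_{v^*}C_{g,x\theta}}{\mu}\tau$, $c_\beta\ge\frac{6L_{\theta^*}}{\omega}\sqrt Q\,\tau$, $c_\gamma\ge4L\tau$,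 $c_\gamma,c_\lambda,c_\beta\in[c_{\rm lo},c_{\rm hi}]$ and $\tau\ge c_{\rm lo}\kappa^{-4}$. Put $\lambda_{\max}=\min\{\frac1{L_{g,\theta}},\frac{\mu}{32\sigma_{g,\theta\theta}^2}\}$, $\beta_{\max}=\min\{\frac2{\mu+L_{g,\theta}},\frac{\mu+L_{g,\theta}}{2\mu L_{g,\theta}}\}$, $\gamma_{\max}=\min\{1,\frac{C_{g,x\theta}^2}{\sigma_{g,x\theta}^2}\}$, $u=\min\{u_1,u_2,u_3\}$ with $u_1=\frac1{2\tau L}$, $$u_2=\min\Big\{\tfrac{1-\rho}{12\varphi^{1/2}},\tfrac{(1-\rho)^{2/3}}{4\varphi^{1/3}},\tfrac{Q^{1/3}(1-\rho)^{2/3}}{4\varphi^{1/3}},\tfrac{(1-\rho)^{1/2}}{3L_{fg,x}^{1/4}},\tfrac{C_{g,x\theta}^{2/3}(1-\rho)^{2/3}}{4\varphi^{1/3}\sigma_{g,x\theta}^{2/3}}\Big\},\quad u_3=\min\Big\{\tfrac{\mu\lambda_{\max}}{96\tau L_{v^*}C_{g,x\theta}},\tfrac{\beta_{\max}\omega}{12\tau\sqrt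 Q L_{\theta^*}},\tfrac{\gamma_{\max}}{8L\tau}\Big\}.$$ Let $d_1=\frac{8C_{g,x\theta}^2\tau}{\mu c_\lambda}$, $d_2=\frac{Q\tau}{\omega c_\beta}$, $d_3=\frac{\tau}{2c_\gamma}$, $d_4(\alpha)=\frac{24\varphi\tau\alpha^2}{(1-\rho)^2c_\gamma}$, $\vartheta=\frac{24\varphi}{(1-\rho)^2c_\gamma}$, $$\sigma_p=\sqrt{\tfrac{d_1}{\tau}}\,(\sigma_{f,\theta}+2M\sigma_{g,\theta\theta})c_\lambda+\sqrt{\tfrac{d_2}{\tau}}\,\sigma_{g,\theta}c_\beta,\qquad\sigma_c=\sqrt{\tfrac{d_3}{\tau}}\,(\sigma_{f,x}+2M\sigma_{g,x\theta})c_\gamma,$$ $$\hat V=\tfrac{\Phi(x^0)-\Phi_{\rm low}}{\tau}+\tfrac{d_1}{\tau m}\sum_i\|v_i^0-v_i^*(x^0)\|^2+\tfrac{d_2}{\tau m}\sum_i\|\theta_i^0-\theta_i^*(x^0)\|^2+\tfrac{d_3}{\tau}\Big\|\nabla\Phi(x^0)-\tfrac1m\sum_iz_i^0\Big\|^2+\tfrac{d_4(u)}{\tau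 m}\sum_i\|\nabla\Phi_i(x^0)-z_i^0\|^2,$$ $a_0=4\hat V$, $a_1=4(\sqrt2\,\sigma_p+\sqrt2\,\sigma_c/\sqrt m)^2$, $a_2=4\vartheta b^2/m$. **Statement.** For all positive class constants the following holds. (A) There are $0<c_{\rm lo}\le c_{\rm hi}$ such that for every $\mu_g\in(0,L_{g,\theta}]$ a $(c_{\rm lo},c_{\rm hi})$-admissible $(\tau,c_\gamma,c_\lambda,c_\beta)$ exists. (B) For all $0<c_{\rm lo}\le c_{\rm hi}$ and $S,B>0$ there is a constant $C>0$, depending only on these and on the class constants, such that the following holds for all $m$, $n$, $p$, all data as above with $\sigma_{g,\theta\theta},\sigma_{g,x\theta}\le S$, all $(c_{\rm lo},c_{\rm hi})$-admissible $(\tau,c_\gamma,c_\lambda,c_\beta)$, and all initial points with $\Phi(x^0)-\Phi_{\rm low}\le B\kappa$, $\frac1m\sum_i\|\theta_i^0-\theta_i^*(x^0)\|^2\le B$, $\frac1m\sum_i\|v_i^0-v_i^*(x^0)\|^2\le B\kappa^4$, $\frac1m\sum_i\|\nabla\Phi_i(x^0)-z_i^0\|^2\le B\kappa^5$. For each $K$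 run LoPA-LG with $$\alpha=\alpha_K=\min\Big\{u,\Big(\frac{a_0}{a_1(K+1)}\Big)^{1/2},\Big(\frac{a_0}{a_2(K+1)}\Big)^{1/3}\Big\},\qquad\gamma=c_\gamma\alpha,\ \lambda=c_\lambda\alpha,\ \beta=c_\beta\alpha.$$ Then $b^2\le C(\kappa^2b_f^2+\kappa^6b_g^2)$, $\sigma_p\le C(\kappa^{1/2}\sigma_{f,\theta}+\kappa^{3/2}\sigma_{g,\theta\theta}+\kappa^{5/2}\sigma_{g,\theta})$ and $\sigma_c\le C(\sigma_{f,x}+\kappa\sigma_{g,x\theta})$. Moreover, the conditions $$\alpha_K\le\tfrac1m,\qquad d_4(\alpha_K)\le\tfrac{d_3}m,\qquad c_\lambda\alpha_K<\lambda_{\max},\qquad c_\beta\alpha_K<\beta_{\max},\qquad c_\gamma\alpha_K<\gamma_{\max}\tag{$*$}$$ hold for all sufficiently large $K$. Finally, for every $K\ge1$ that satisfies $(*)$, every $\|\nabla\Phi(\bar x^k)\|^2$ is integrable and $$\frac1{K+1}\sum_{k=0}^K\mathbb E\|\nabla\Phi(\bar x^k)\|^2\le C\left(\frac{\kappa^8}{(1-\rho)K}+\frac{\kappa^{16/3}(b/\sqrt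 m)^{2/3}}{(1-\rho)^{2/3}K^{2/3}}+\frac{\kappa^{5/2}}{\sqrt K}\Big(\sigma_p+\frac{\sigma_c}{\sqrt m}\Big)\right).$$ In particular the heterogeneity $b$ enters only through a transient term of order $K^{-2/3}$. -/

import Mathlib

open MeasureTheory ProbabilityTheory

noncomputable section

namespace LoPA

/-- The Euclidean space of dimension `n`. -/
abbrev Vec (n : ℕ) : Type := EuclideanSpace ℝ (Fin n)

/-! ### The bilevel problem -/

section Problem

variable {m n p : ℕ}

/-- Partial gradient in the outer variable. -/
def gradX (f : Vec n → Vec p → ℝ) (x : Vec n) (θ : Vec p) : Vec n :=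
  gradient (fun x' => f x' θ) x

/-- Partial gradient in the inner variable. -/
def gradT (f : Vec n → Vec p → ℝ) (x : Vec n) (θ : Vec p) : Vec p :=
  gradient (fun θ' => f x θ') θ

/-- The Hessian in the inner variable. -/
def hessTT (g : Vec n → Vec p → ℝ) (x : Vec n) (θ : Vec p) : Vec p →L[ℝ] Vec p :=
  fderiv ℝ (fun θ' => gradT g x θ') θ

/-- The mixed second derivative, an `n × p` matrix: the Jacobian in `θ` of the gradient in `x`. -/
def jacXT (g : Vec n → Vec p → ℝ) (x : Vec n) (θ : Vec p) : Vec p →L[ℝ] Vec n :=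
  fderiv ℝ (fun θ' => gradX g x θ') θ

/-- The inner solution: a minimizer of `g x ·` (unique when `g x ·` is strongly convex). -/
def innerSol (g : Vec n → Vec p → ℝ) (x : Vec n) : Vec p :=
  Classical.epsilon fun θ => ∀ θ', g x θ ≤ g x θ'

/-- The local objective `x ↦ f (x, θ⋆(x))`. -/
def localObj (f g : Vec n → Vec p → ℝ) (x : Vec n) : ℝ := f x (innerSol g x)

/-- The overall objective, the average of the local ones. -/
def objective (f g : Fin m → Vec n → Vec p → ℝ) (x : Vec n) : ℝ :=
  (1 / (m : ℝ)) * ∑ i, localObj (f i) (g i) x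

/-- The Hessian-inverse-vector product at the inner solution. -/
def vStar (f g : Vec n → Vec p → ℝ) (x : Vec n) : Vec p :=
  (hessTT g x (innerSol g x)).inverse (gradT f x (innerSol g x))

/-- Lipschitz continuity with constant `K` in the pair `(x, θ)`, for the Euclidean norm of the
product. -/
def JointLip {E : Type*} [NormedAddCommGroup E] (K : ℝ) (F : Vec n → Vec p → E) : Prop :=
  ∀ x x' θ θ', ‖F x θ - F x' θ'‖ ≤ K * √(‖x - x'‖ ^ 2 + ‖θ - θ'‖ ^ 2)

end Problem

/-! ### Assumptions on the functions and on the network -/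

/-- The smoothness constants of the outer (`f`) and inner (`g`) functions;
`t` stands for the inner variable `θ`. -/
structure ClassConst where
  Lfx : ℝ
  Lft : ℝ
  Lgt : ℝ
  Lgxt : ℝ
  Lgtt : ℝ
  Cft : ℝ
  Cgxt : ℝ

/-- All the constants are positive. -/
structure ClassConst.Pos (c : ClassConst) : Prop where
  Lfx : 0 < c.Lfx
  Lft : 0 < c.Lft
  Lgt : 0 < c.Lgt
  Lgxt : 0 < c.Lgxt
  Lgtt : 0 < c.Lgtt
  Cft : 0 < c.Cft
  Cgxt : 0 < c.Cgxt

section Assumptions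

variable {m n p : ℕ}

/-- The assumption on an outer function `f` (with inner function `g`). -/
structure OuterAssumption (c : ClassConst) (f g : Vec n → Vec p → ℝ) : Prop where
  contDiff : ContDiff ℝ 1 fun q : Vec n × Vec p => f q.1 q.2
  lip_gradX : JointLip c.Lfx (gradX f)
  lip_gradT : JointLip c.Lft (gradT f)
  bound_gradT : ∀ x, ‖gradT f x (innerSol g x)‖ ≤ c.Cft

/-- The assumption on an inner function `g`. -/
structure InnerAssumption (c : ClassConst) (μ : ℝ) (g : Vec n → Vec p → ℝ) : Prop where
  contDiff : ContDiff ℝ 2 fun q : Vec n × Vec p => g q.1 q.2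
  strongConvex : ∀ x, StrongConvexOn Set.univ μ (g x)
  lip_gradT : ∀ x θ θ', ‖gradT g x θ - gradT g x θ'‖ ≤ c.Lgt * ‖θ - θ'‖
  lip_jacXT : JointLip c.Lgxt (jacXT g)
  lip_hessTT : JointLip c.Lgtt (hessTT g)
  bound_jacXT : ∀ x θ, ‖jacXT g x θ‖ ≤ c.Cgxt

/-- Bounded heterogeneity across the nodes; the inner functions are only compared at the
inner solutions. -/
structure Heterogeneity (bf bg : ℝ) (f g : Fin m → Vec n → Vec p → ℝ) : Prop where
  gradX_f : ∀ x θ, ∑ i, ‖gradX (f i) x θ - (1 / (m : ℝ)) • ∑ j, gradX (f j) x θ‖ ^ 2 ≤ bf ^ 2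
  gradT_f : ∀ x θ, ∑ i, ‖gradT (f i) x θ - (1 / (m : ℝ)) • ∑ j, gradT (f j) x θ‖ ^ 2 ≤ bf ^ 2
  gradT_g : ∀ x, (1 / (m : ℝ)) * ∑ i, ∑ j,
    ‖gradT (g i) x (innerSol (g j) x) - gradT (g j) x (innerSol (g j) x)‖ ^ 2 ≤ bg ^ 2
  jacXT_g : ∀ x, (1 / (m : ℝ)) * ∑ i, ∑ j,
    ‖jacXT (g i) x (innerSol (g j) x) - jacXT (g j) x (innerSol (g j) x)‖ ^ 2 ≤ bg ^ 2
  hessTT_g : ∀ x, (1 / (m : ℝ)) * ∑ i, ∑ j,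
    ‖hessTT (g i) x (innerSol (g j) x) - hessTT (g j) x (innerSol (g j) x)‖ ^ 2 ≤ bg ^ 2

/-- The network constant `ρ = ‖W - 11ᵀ/m‖²` (spectral norm). -/
def netRho (W : Matrix (Fin m) (Fin m) ℝ) : ℝ :=
  ‖Matrix.toEuclideanCLM (n := Fin m) (𝕜 := ℝ) (W - Matrix.of fun _ _ => 1 / (m : ℝ))‖ ^ 2

/-- A connected graph `G` with a symmetric doubly stochastic weight matrix `W` supported on the
edges of `G` (nodes may also weight themselves), with `ρ < 1`. -/
structure NetworkAssumption (G : SimpleGraph (Fin m)) (W : Matrix (Fin m) (Fin m) ℝ) : Prop where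
  connected : G.Connected
  symm : W.IsSymm
  doublyStochastic : W ∈ doublyStochastic ℝ (Fin m)
  support : ∀ i j, i ≠ j → (0 < W i j ↔ G.Adj i j)
  rho_lt_one : netRho W < 1

end Assumptions

/-! ### The stochastic oracles -/

/-- Bounds on the standard deviations of the five stochastic estimators. -/
structure Noise where
  gt : ℝ
  gtt : ℝ
  gxt : ℝ
  ft : ℝ
  fx : ℝ

/-- The five samples drawn by each node at each iteration. -/
inductive Channel where
  | gt
  | gtt
  | gxt
  | ft
  | fx

/-- The stochastic estimators of the first and second derivatives, as functions of the point
and of a sample in `S`. -/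
structure Oracle (m n p : ℕ) (S : Type*) where
  gt : Fin m → Vec n → Vec p → S → Vec p
  gtt : Fin m → Vec n → Vec p → S → (Vec p →L[ℝ] Vec p)
  gxt : Fin m → Vec n → Vec p → S → (Vec p →L[ℝ] Vec n)
  ft : Fin m → Vec n → Vec p → S → Vec p
  fx : Fin m → Vec n → Vec p → S → Vec n

/-- `Y` is square integrable with mean `y` and `𝔼‖Y - y‖² ≤ σ²`. -/
structure UnbiasedVar {Ω E : Type*} [MeasurableSpace Ω] [NormedAddCommGroup E] [NormedSpace ℝ E]
    (P : Measure Ω) (Y : Ω → E) (y : E) (σ : ℝ) : Prop where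
  memLp : MemLp Y 2 P
  mean : ∫ ω, Y ω ∂P = y
  var : ∫ ω, ‖Y ω - y‖ ^ 2 ∂P ≤ σ ^ 2

/-- The assumption on the stochastic estimators: all the samples `ζ a i k` (channel `a`, node `i`,
iteration `k`) are independent, and the estimators are unbiased with bounded variance. -/
structure StochasticAssumption {m n p : ℕ} {Ω S : Type*} [MeasurableSpace Ω] [MeasurableSpace S]
    (P : Measure Ω) (f g : Fin m → Vec n → Vec p → ℝ) (O : Oracle m n p S) (σ : Noise)
    (ζ : Channel → Fin m → ℕ → Ω → S) : Prop where
  meas_sample : ∀ a i k, Measurable (ζ a i k)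
  meas_gt : ∀ i, Measurable fun q : Vec n × Vec p × S => O.gt i q.1 q.2.1 q.2.2
  meas_gtt : ∀ i, Measurable fun q : Vec n × Vec p × S => O.gtt i q.1 q.2.1 q.2.2
  meas_gxt : ∀ i, Measurable fun q : Vec n × Vec p × S => O.gxt i q.1 q.2.1 q.2.2
  meas_ft : ∀ i, Measurable fun q : Vec n × Vec p × S => O.ft i q.1 q.2.1 q.2.2
  meas_fx : ∀ i, Measurable fun q : Vec n × Vec p × S => O.fx i q.1 q.2.1 q.2.2
  indep : iIndepFun (fun (q : Channel × Fin m × ℕ) => ζ q.1 q.2.1 q.2.2) P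
  gt : ∀ i k x θ,
    UnbiasedVar P (fun ω => O.gt i x θ (ζ .gt i k ω)) (gradT (g i) x θ) σ.gt
  gtt : ∀ i k x θ,
    UnbiasedVar P (fun ω => O.gtt i x θ (ζ .gtt i k ω)) (hessTT (g i) x θ) σ.gtt
  gxt : ∀ i k x θ,
    UnbiasedVar P (fun ω => O.gxt i x θ (ζ .gxt i k ω)) (jacXT (g i) x θ) σ.gxt
  ft : ∀ i k x θ,
    UnbiasedVar P (fun ω => O.ft i x θ (ζ .ft i k ω)) (gradT (f i) x θ) σ.ft
  fx : ∀ i k x θ,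
    UnbiasedVar P (fun ω => O.fx i x θ (ζ .fx i k ω)) (gradX (f i) x θ) σ.fx

/-! ### The algorithm -/

/-- The variables of all the nodes. -/
structure State (m n p : ℕ) where
  x : Fin m → Vec n
  θ : Fin m → Vec p
  v : Fin m → Vec p
  z : Fin m → Vec n
  y : Fin m → Vec n

/-- The step sizes. -/
structure StepSizes where
  α : ℝ
  β : ℝ
  lam : ℝ
  γ : ℝ
  τ : ℝ

section Algorithm

variable {m n p : ℕ} {S : Type*}

/-- The stochastic direction of the inner variable. -/
def dirD (O : Oracle m n p S) (ζ : Channel → Fin m → S) (s : State m n p) (i : Fin m) : Vec p :=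
  O.gt i (s.x i) (s.θ i) (ζ .gt i)

/-- The stochastic direction of the Hessian-inverse-vector variable. -/
def dirH (O : Oracle m n p S) (ζ : Channel → Fin m → S) (s : State m n p) (i : Fin m) : Vec p :=
  O.gtt i (s.x i) (s.θ i) (ζ .gtt i) (s.v i) - O.ft i (s.x i) (s.θ i) (ζ .ft i)

/-- The stochastic local hypergradient. -/
def dirS (O : Oracle m n p S) (ζ : Channel → Fin m → S) (s : State m n p) (i : Fin m) : Vec n :=
  O.fx i (s.x i) (s.θ i) (ζ .fx i) - O.gxt i (s.x i) (s.θ i) (ζ .gxt i) (s.v i)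

/-- The gradient momentum step. -/
def nextZ (O : Oracle m n p S) (t : StepSizes) (ζ : Channel → Fin m → S) (s : State m n p)
    (i : Fin m) : Vec n :=
  dirS O ζ s i + (1 - t.γ) • (s.z i - dirS O ζ s i)

/-- One iteration of LoPA with the local gradient scheme. -/
def step (W : Matrix (Fin m) (Fin m) ℝ) (O : Oracle m n p S) (t : StepSizes)
    (ζ : Channel → Fin m → S) (s : State m n p) : State m n p where
  x i := (1 - t.τ) • s.x i + t.τ • (∑ j, W i j • s.x j - t.α • s.y i)
  θ i := s.θ i - t.β • dirD O ζ s i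
  v i := s.v i - t.lam • dirH O ζ s i
  z i := nextZ O t ζ s i
  y i := nextZ O t ζ s i

/-- The iterates of LoPA-LG from the initial state `s₀`: the directions at iteration `k` are
evaluated at the `k`-th iterate with the `k`-th samples. -/
def iterate {Ω : Type*} (W : Matrix (Fin m) (Fin m) ℝ) (O : Oracle m n p S) (t : StepSizes)
    (ζ : Channel → Fin m → ℕ → Ω → S) (s₀ : State m n p) (ω : Ω) : ℕ → State m n p
  | 0 => s₀
  | k + 1 => step W O t (fun a i => ζ a i k ω) (iterate W O t ζ s₀ ω k)

/-- The average of the outer variables. -/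
def xBar (s : State m n p) : Vec n := (1 / (m : ℝ)) • ∑ i, s.x i

/-- The initial state: a common outer variable, and `y = z`. -/
def initState (x₀ : Vec n) (θ₀ v₀ : Fin m → Vec p) (z₀ : Fin m → Vec n) : State m n p where
  x _ := x₀
  θ := θ₀
  v := v₀
  z := z₀
  y := z₀

end Algorithm

/-! ### The constants of the analysis -/

section Constants

variable (c : ClassConst) (μ : ℝ)

/-- The condition number. -/
def kappa : ℝ := max c.Lfx (max c.Lft (max c.Lgt (max c.Lgxt c.Lgtt))) / μ

/-- Lipschitz constant of the inner solution. -/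
def LthetaStar : ℝ := c.Cgxt / μ

def Lv : ℝ := c.Lft / μ + c.Cft * c.Lgtt / μ ^ 2

/-- Lipschitz constant of `vStar`. -/
def LvStar : ℝ := Lv c μ * (1 + LthetaStar c μ)

/-- Lipschitz constant of the hypergradient. -/
def Lhyper : ℝ :=
  (c.Lfx + c.Cgxt * Lv c μ + c.Cft * c.Lgxt / μ) * (1 + LthetaStar c μ)

/-- Bound on `vStar`. -/
def Mv : ℝ := c.Cft / μ

def Lfgx : ℝ := 2 * c.Lfx ^ 2 + 4 * Mv c μ ^ 2 * c.Lgxt ^ 2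

def Lfgt : ℝ := 2 * c.Lft ^ 2 + 4 * Mv c μ ^ 2 * c.Lgtt ^ 2

def omegaT : ℝ := μ * c.Lgt / (2 * (μ + c.Lgt))

def Qc : ℝ := Lfgx c μ + 32 * c.Cgxt ^ 2 * Lfgt c μ / μ ^ 2

/-- `max c.Lgt c.Cgxt` bounds both partial Lipschitz constants of the inner gradient. -/
def phi : ℝ := Qc c μ * (1 + 4 * max c.Lgt c.Cgxt ^ 2 / omegaT c μ ^ 2)

/-- The heterogeneity `b²` of the hypergradients. -/
def bSq (bf bg : ℝ) : ℝ :=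
  (4 + 4 * c.Cgxt ^ 2 / μ ^ 2) * bf ^ 2 +
  4 * (4 * (c.Cft ^ 2 * c.Cgxt ^ 2 / μ ^ 4) + 4 * (c.Cft ^ 2 / μ ^ 2) + c.Lfx ^ 2 / μ ^ 2
    + c.Lft ^ 2 * c.Cgxt ^ 2 / μ ^ 4 + 4 * (c.Cft ^ 2 * c.Cgxt ^ 2 * c.Lgtt ^ 2 / μ ^ 6)
    + 4 * (c.Cft ^ 2 * c.Lgxt ^ 2 / μ ^ 4)) * bg ^ 2

/-- The ratios of the step sizes: `γ = cgam α`, `λ = clam α`, `β = cbet α`; and the relaxation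
parameter `τ`. -/
structure Coeffs where
  τ : ℝ
  cgam : ℝ
  clam : ℝ
  cbet : ℝ

/-- The admissible ratios: `0 < τ < 1`, the lower bounds of the analysis, and the orders
`cgam, clam, cbet ≍ 1`, `τ ≍ κ⁻⁴` (the upper bound on `τ` follows from the others). -/
structure Coeffs.Admissible (clo chi : ℝ) (r : Coeffs) : Prop where
  tau_pos : 0 < r.τ
  tau_lt_one : r.τ < 1
  clam_ge : 48 * LvStar c μ * c.Cgxt / μ * r.τ ≤ r.clam
  cbet_ge : 6 * LthetaStar c μ / omegaT c μ * √(Qc c μ) * r.τ ≤ r.cbet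
  cgam_ge : 4 * Lhyper c μ * r.τ ≤ r.cgam
  tau_order : clo / kappa c μ ^ 4 ≤ r.τ
  clam_order : r.clam ∈ Set.Icc clo chi
  cbet_order : r.cbet ∈ Set.Icc clo chi
  cgam_order : r.cgam ∈ Set.Icc clo chi

/-- The step sizes with the ratios `r` and the outer step size `α`. -/
def Coeffs.toSteps (r : Coeffs) (α : ℝ) : StepSizes where
  α := α
  β := r.cbet * α
  lam := r.clam * α
  γ := r.cgam * α
  τ := r.τ

variable (ρ : ℝ) (σ : Noise) (r : Coeffs)

/-- The upper bound for `λ`. -/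
def lamMax : ℝ := min (1 / c.Lgt) (μ / (32 * σ.gtt ^ 2))

/-- The upper bound for `β`. -/
def betMax : ℝ := min (2 / (μ + c.Lgt)) ((μ + c.Lgt) / (2 * μ * c.Lgt))

/-- The upper bound for `γ`. -/
def gamMax : ℝ := min 1 (c.Cgxt ^ 2 / σ.gxt ^ 2)

def u1 : ℝ := 1 / (2 * r.τ * Lhyper c μ)

def u2 : ℝ :=
  min ((1 - ρ) / (12 * phi c μ ^ (1 / 2 : ℝ)))
  (min ((1 - ρ) ^ (2 / 3 : ℝ) / (4 * phi c μ ^ (1 / 3 : ℝ)))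
  (min (Qc c μ ^ (1 / 3 : ℝ) * (1 - ρ) ^ (2 / 3 : ℝ) / (4 * phi c μ ^ (1 / 3 : ℝ)))
  (min ((1 - ρ) ^ (1 / 2 : ℝ) / (3 * Lfgx c μ ^ (1 / 4 : ℝ)))
    (c.Cgxt ^ (2 / 3 : ℝ) * (1 - ρ) ^ (2 / 3 : ℝ) /
      (4 * phi c μ ^ (1 / 3 : ℝ) * σ.gxt ^ (2 / 3 : ℝ))))))

/-- Half of the largest `α` for which the ranges of `λ`, `β`, `γ` are non-empty. -/
def u3 : ℝ :=
  min (μ * lamMax c μ σ / (96 * r.τ * LvStar c μ * c.Cgxt))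
  (min (betMax c μ * omegaT c μ / (12 * r.τ * √(Qc c μ) * LthetaStar c μ))
    (gamMax c σ / (8 * Lhyper c μ * r.τ)))

/-- The largest outer step size. -/
def uMax : ℝ := min (u1 c μ r) (min (u2 c μ ρ σ) (u3 c μ σ r))

/-! The coefficients of the Lyapunov function. -/

def d1 : ℝ := 8 * c.Cgxt ^ 2 * r.τ / (μ * r.clam)

def d2 : ℝ := Qc c μ * r.τ / (omegaT c μ * r.cbet)

def d3 : ℝ := r.τ / (2 * r.cgam)

def d4 (α : ℝ) : ℝ := 24 * phi c μ * r.τ * α ^ 2 / ((1 - ρ) ^ 2 * r.cgam)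

/-- The sampling deviation of the inner-level variables. -/
def sigmaP : ℝ :=
  √(d1 c μ r / r.τ) * (σ.ft + 2 * Mv c μ * σ.gtt) * r.clam + √(d2 c μ r / r.τ) * σ.gt * r.cbet

/-- The sampling deviation of the outer-level variable. -/
def sigmaC : ℝ := √(d3 r / r.τ) * (σ.fx + 2 * Mv c μ * σ.gxt) * r.cgam

/-- The heterogeneity coefficient. -/
def vartheta : ℝ := 24 * phi c μ / ((1 - ρ) ^ 2 * r.cgam)

/-- The requirement that `α` be small, met as soon as the number of iterations is large. -/
structure SmallStep (m : ℕ) (α : ℝ) : Prop where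
  le_inv : α ≤ 1 / (m : ℝ)
  d4_le : d4 c μ ρ r α ≤ d3 r / (m : ℝ)
  lam_lt : r.clam * α < lamMax c μ σ
  bet_lt : r.cbet * α < betMax c μ
  gam_lt : r.cgam * α < gamMax c σ

/-- The bound for the initial value of the Lyapunov function divided by `τ`, for a common initial
outer variable `x₀` and a lower bound `Φlow` of the objective. -/
def V0 {m n p : ℕ} (f g : Fin m → Vec n → Vec p → ℝ) (Φlow : ℝ) (x₀ : Vec n)
    (θ₀ v₀ : Fin m → Vec p) (z₀ : Fin m → Vec n) : ℝ :=
  1 / r.τ * (objective f g x₀ - Φlow)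
  + d1 c μ r / r.τ * ((1 / (m : ℝ)) * ∑ i, ‖v₀ i - vStar (f i) (g i) x₀‖ ^ 2)
  + d2 c μ r / r.τ * ((1 / (m : ℝ)) * ∑ i, ‖θ₀ i - innerSol (g i) x₀‖ ^ 2)
  + d3 r / r.τ * ‖gradient (objective f g) x₀ - (1 / (m : ℝ)) • ∑ i, z₀ i‖ ^ 2
  + d4 c μ ρ r (uMax c μ ρ σ r) / r.τ *
      ((1 / (m : ℝ)) * ∑ i, ‖gradient (localObj (f i) (g i)) x₀ - z₀ i‖ ^ 2)

/-- `4 σ̂²` with `σ̂ = √2 σ_p + √2 σ_c / √m`. -/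
def a1 (m : ℕ) : ℝ :=
  4 * (√2 * sigmaP c μ σ r + √2 / √(m : ℝ) * sigmaC c μ σ r) ^ 2

def a2 (m : ℕ) (bf bg : ℝ) : ℝ := 4 * vartheta c μ ρ r / (m : ℝ) * bSq c μ bf bg

/-- The outer step size for `K` iterations; `V` is the value of `V0`, so that `a₀ = 4 V`. -/
def alphaK (m : ℕ) (bf bg V : ℝ) (K : ℕ) : ℝ :=
  min (uMax c μ ρ σ r)
  (min ((4 * V / (a1 c μ σ r m * ((K : ℝ) + 1))) ^ (1 / 2 : ℝ))
    ((4 * V / (a2 c μ ρ r m bf bg * ((K : ℝ) + 1))) ^ (1 / 3 : ℝ)))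

end Constants

end LoPA

end

noncomputable section

namespace LoPA

/-! ### Strongly convex functions and symmetric operators -/

section Abstract

open Filter Topology
open scoped RealInnerProductSpace

variable {E : Type*} [NormedAddCommGroup E] [InnerProductSpace ℝ E]

/-! The proof is a Lyapunov argument. The vectors `y` used in an iteration were formed in the
previous one, so the mean `xBar` moves by `-τ α z̄`, where `z̄` is the mean of the `z i`, and this
displacement does not depend on the fresh samples (`xBar_step`). Implicit differentiation of the
inner solution (`hasFDerivAt_innerSol`, `hasGradientAt_localObj`) shows that the objective has a
Lipschitz gradient. The descent lemma in the form `objective_step_le` then yields a decrease of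
`τα/2 ‖∇Φ‖² + τα/4 ‖z̄‖²`, up to the tracking error `τα/2 ‖∇Φ - z̄‖²`.

The errors of `v`, `θ`, `z` and `z̄` relative to their targets at `xBar` contract at rates
proportional to `α`. They are perturbed by one another, by the drift of the targets (a multiple of
`‖z̄‖²`), and by sampling noise of size `α²`. The noise in `z̄` carries an extra factor `1/m`
because the nodes sample independently (`MeanVar.vmean_of_indep`). The consensus error contracts at
rate `τ (1 - ρ) / 2` and is fed by `α²` times the spread of the `z i`. This spread is the only place
where the heterogeneity of the hypergradients enters (`hyperGrad_heterogeneity`,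
`avg_tracking_spread_le`).

The weights of `lyap` are chosen so that each contraction pays for the couplings it causes, while
the lower bounds on the step ratios make all the drifts fit into the `‖z̄‖²` decrease. The result is
`lyap_step`: given the current state, the expected Lyapunov function drops by `τα/2 ‖∇Φ‖²` up to
`stepError`. The weight of the consensus error is itself of order `α`, so heterogeneity contributes
at order `α³`, one order below the noise.

Independence of the `k`-th samples from the `k`-th iterate allows the state to be frozen, and the
decrease telescopes (`sum_integral_grad_le`). After division, with `N = K + 1`, there remains
`2V/(αN) + (3/2) chi a₂ α² + a₁ α`. The prescribed `α` balances these terms (`balance_le`) into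
`V/(uN)`, `(a₁V/N)^(1/2)` and `(a₂V²/N²)^(1/3)`, up to constants. The orders `V = O(κ⁵)`, `φ =
O(κ⁶)` and `u ≳ (1-ρ)/κ³` turn them into the powers `κ⁸`, `κ^(5/2)` and `κ^(16/3)`. -/

theorem add_inner_le_of_strongConvexOn [CompleteSpace E] {h : E → ℝ} {μ : ℝ}
    (hh : StrongConvexOn Set.univ μ h)
    {a h' : E} (hd : HasGradientAt h h' a) (b : E) :
    h a + ⟪h', b - a⟫ + μ / 2 * ‖b - a‖ ^ 2 ≤ h b := by
  have hline : HasDerivAt (fun t : ℝ => a + t • (b - a)) (b - a) 0 := by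
    simpa using ((hasDerivAt_id (0 : ℝ)).smul_const (b - a)).const_add a
  have hd0 : HasFDerivAt h (InnerProductSpace.toDual ℝ E h') (a + (0 : ℝ) • (b - a)) := by
    simpa using hd.hasFDerivAt
  have hder : HasDerivAt (fun t : ℝ => h (a + t • (b - a))) ⟪h', b - a⟫ 0 := by
    simpa using! hd0.comp_hasDerivAt 0 hline
  -- Strong convexity at `a + t (b - a)`, divided by `t`, bounds the slope; as `t ↓ 0` the slope
  -- tends to the inner product and the factor `1 - t` of the quadratic term to one.
  have hlim := hder.tendsto_slope_zero_right
  have hlim2 : Tendsto (fun t : ℝ => h b - h a - (1 - t) * (μ / 2 * ‖b - a‖ ^ 2)) (𝓝[>] 0)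
      (𝓝 (h b - h a - (1 - 0) * (μ / 2 * ‖b - a‖ ^ 2))) := by
    apply Tendsto.mono_left _ nhdsWithin_le_nhds
    exact Continuous.tendsto (by fun_prop) 0
  have := le_of_tendsto_of_tendsto hlim hlim2 (by
    have h1 : ∀ᶠ t : ℝ in 𝓝[>] 0, t < 1 :=
      nhdsWithin_le_nhds (eventually_lt_nhds one_pos)
    filter_upwards [h1, self_mem_nhdsWithin] with t ht1 ht0
    have ht0 : 0 < t := ht0
    have := hh.2 (Set.mem_univ a) (Set.mem_univ b) (by linarith : 0 ≤ 1 - t) ht0.le (by ring)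
    have he : (1 - t) • a + t • b = a + t • (b - a) := by
      rw [smul_sub, sub_smul, one_smul]; abel
    rw [he, norm_sub_rev] at this
    simp only [smul_eq_mul] at this ⊢
    rw [inv_mul_le_iff₀ ht0]
    simp only [zero_add, zero_smul, add_zero]
    nlinarith)
  linarith

theorem inner_sub_ge_of_strongConvexOn [CompleteSpace E] {h : E → ℝ} {μ : ℝ}
    (hh : StrongConvexOn Set.univ μ h)
    {a b a' b' : E} (ha : HasGradientAt h a' a) (hb : HasGradientAt h b' b) :
    μ * ‖a - b‖ ^ 2 ≤ ⟪a' - b', a - b⟫ := by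
  have h1 := add_inner_le_of_strongConvexOn hh ha b
  have h2 := add_inner_le_of_strongConvexOn hh hb a
  rw [norm_sub_rev] at h1
  have h3 : ⟪a', b - a⟫ = - ⟪a', a - b⟫ := by rw [← inner_neg_right, neg_sub]
  rw [inner_sub_left]
  linarith

/-- Coercivity: the quadratic minorant at `0` exceeds `h 0` once `‖b‖ ≥ 2‖∇h(0)‖/μ`, and closed
balls are compact in finite dimension. -/
theorem exists_forall_le_of_strongConvexOn [FiniteDimensional ℝ E] {h : E → ℝ} {μ : ℝ}
    (hμ : 0 < μ) (hh : StrongConvexOn Set.univ μ h) (hd : Differentiable ℝ h) :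
    ∃ a, ∀ b, h a ≤ h b := by
  have := FiniteDimensional.complete ℝ E
  refine hd.continuous.exists_forall_le' 0 ?_
  have := (hd 0).hasGradientAt
  have h1 : ∀ᶠ b : E in cocompact E, 2 * ‖gradient h 0‖ / μ ≤ ‖b‖ :=
    (tendsto_norm_cocompact_atTop (E := E)).eventually (eventually_ge_atTop _)
  filter_upwards [h1] with b hb
  have h2 := add_inner_le_of_strongConvexOn hh this b
  rw [sub_zero] at h2
  have h3 := abs_le.1 (abs_real_inner_le_norm (gradient h 0) b)
  rw [div_le_iff₀ hμ] at hb
  nlinarith [norm_nonneg b]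

theorem norm_le_of_symmetric_of_abs_inner_le {A : E →L[ℝ] E}
    (hA : (A : E →ₗ[ℝ] E).IsSymmetric)
    {c : ℝ} (hc : 0 ≤ c) (h : ∀ x, |⟪A x, x⟫| ≤ c * ‖x‖ ^ 2) : ‖A‖ ≤ c := by
  rw [ContinuousLinearMap.norm_eq_iSup_rayleighQuotient A hA]
  refine ciSup_le fun x => ?_
  rw [ContinuousLinearMap.rayleighQuotient, ContinuousLinearMap.reApplyInnerSelf_apply]
  rcases eq_or_ne x 0 with rfl | hx
  · simpa using hc
  · have : 0 < ‖x‖ ^ 2 := by positivity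
    rw [abs_div, abs_of_pos this, div_le_iff₀ this]
    exact h x

/-- The Rayleigh quotients of `1 - t • H` lie in `[1 - t L, 1 - t μ]`. This provides the contraction
of both the inner gradient step and the Hessian-inverse-vector step. -/
theorem norm_one_sub_smul_le {H : E →L[ℝ] E} (hH : (H : E →ₗ[ℝ] E).IsSymmetric)
    {μ L t c : ℝ} (hl : ∀ x, μ * ‖x‖ ^ 2 ≤ ⟪H x, x⟫) (hu : ‖H‖ ≤ L) (ht : 0 ≤ t) (hc : 0 ≤ c)
    (h1 : 1 - t * μ ≤ c) (h2 : t * L - 1 ≤ c) :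
    ‖(1 : E →L[ℝ] E) - t • H‖ ≤ c := by
  refine norm_le_of_symmetric_of_abs_inner_le (fun x y => ?_) hc fun x => ?_
  · simp only [ContinuousLinearMap.coe_coe, sub_apply,
      one_apply_eq_self, smul_apply, inner_sub_left,
      inner_sub_right, inner_smul_left, inner_smul_right]
    have := hH x y
    simp only [ContinuousLinearMap.coe_coe] at this
    simp [this]
  · have e : ⟪((1 : E →L[ℝ] E) - t • H) x, x⟫ = ‖x‖ ^ 2 - t * ⟪H x, x⟫ := by
      simp [inner_sub_left, inner_smul_left]
    have hu' : ⟪H x, x⟫ ≤ L * ‖x‖ ^ 2 := by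
      calc ⟪H x, x⟫ ≤ ‖H x‖ * ‖x‖ := real_inner_le_norm _ _
        _ ≤ (L * ‖x‖) * ‖x‖ := by gcongr; exact H.le_of_opNorm_le hu x
        _ = _ := by ring
    rw [e, abs_le]
    have := sq_nonneg ‖x‖
    constructor <;> nlinarith [hl x, mul_le_mul_of_nonneg_left hu' ht,
      mul_le_mul_of_nonneg_left (hl x) ht, mul_le_mul_of_nonneg_right h1 this,
      mul_le_mul_of_nonneg_right h2 this]

/-- The upper bound of the descent lemma. -/
theorem le_add_inner_of_lipschitz_gradient [CompleteSpace E] {Φ : E → ℝ} {G : E → E} {L : ℝ}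
    (hd : ∀ x, HasGradientAt Φ (G x) x) (hL : ∀ x y, ‖G x - G y‖ ≤ L * ‖x - y‖) (x y : E) :
    Φ y ≤ Φ x + ⟪G x, y - x⟫ + L / 2 * ‖y - x‖ ^ 2 := by
  set d := y - x with hdef
  -- The gap along the segment between the function and its quadratic model (up to a constant); its
  -- derivative `⟪G (x + t d) - G x, d⟫ - L t ‖d‖²` is nonpositive, so `F 1 ≤ F 0`.
  let F : ℝ → ℝ := fun t => Φ (x + t • d) - t * ⟪G x, d⟫ - L / 2 * t ^ 2 * ‖d‖ ^ 2
  have hF : ∀ t, HasDerivAt F (⟪G (x + t • d), d⟫ - ⟪G x, d⟫ - L * t * ‖d‖ ^ 2) t := by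
    intro t
    have hline : HasDerivAt (fun t : ℝ => x + t • d) d t := by
      simpa using ((hasDerivAt_id t).smul_const d).const_add x
    have h1 : HasDerivAt (fun t : ℝ => Φ (x + t • d)) ⟪G (x + t • d), d⟫ t := by
      simpa using! (hd (x + t • d)).hasFDerivAt.comp_hasDerivAt t hline
    have h2 : HasDerivAt (fun t : ℝ => t * ⟪G x, d⟫) ⟪G x, d⟫ t := by
      simpa using (hasDerivAt_id t).mul_const ⟪G x, d⟫
    have h3 : HasDerivAt (fun t : ℝ => L / 2 * t ^ 2 * ‖d‖ ^ 2) (L * t * ‖d‖ ^ 2) t := by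
      have := ((hasDerivAt_pow 2 t).const_mul (L / 2)).mul_const (‖d‖ ^ 2)
      refine this.congr_deriv ?_
      change L / 2 * (((2 : ℕ) : ℝ) * t ^ 1) * ‖d‖ ^ 2 = _
      push_cast
      ring
    exact (h1.sub h2).sub h3
  have hanti : AntitoneOn F (Set.Icc 0 1) := by
    refine antitoneOn_of_deriv_nonpos (convex_Icc 0 1)
      (fun t _ => (hF t).continuousAt.continuousWithinAt)
      (fun t _ => (hF t).differentiableAt.differentiableWithinAt) fun t ht => ?_
    rw [interior_Icc] at ht
    rw [(hF t).deriv, ← inner_sub_left]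
    have h1 : ⟪G (x + t • d) - G x, d⟫ ≤ ‖G (x + t • d) - G x‖ * ‖d‖ := real_inner_le_norm _ _
    have h2 := hL (x + t • d) x
    rw [add_sub_cancel_left, norm_smul, Real.norm_of_nonneg ht.1.le] at h2
    nlinarith [norm_nonneg d]
  have := hanti (Set.left_mem_Icc.2 zero_le_one) (Set.right_mem_Icc.2 zero_le_one) zero_le_one
  simp only [F, one_smul, zero_smul, add_zero] at this
  rw [show x + d = y by rw [hdef]; abel] at this
  linarith

end Abstract

/-! ### Partial derivatives -/

section Partial

open Filter Topology
open scoped RealInnerProductSpace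

variable {n p : ℕ}

theorem hasGradientAt_gradT {g : Vec n → Vec p → ℝ}
    (hg : Differentiable ℝ fun q : Vec n × Vec p => g q.1 q.2) (x : Vec n) (θ : Vec p) :
    HasGradientAt (g x) (gradT g x θ) θ := by
  have : DifferentiableAt ℝ (g x) θ :=
    (hg (x, θ)).comp θ (f := fun θ' => (x, θ')) (by fun_prop)
  exact this.hasGradientAt

theorem hasGradientAt_gradX {g : Vec n → Vec p → ℝ}
    (hg : Differentiable ℝ fun q : Vec n × Vec p => g q.1 q.2) (x : Vec n) (θ : Vec p) :
    HasGradientAt (fun x' => g x' θ) (gradX g x θ) x := by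
  have : DifferentiableAt ℝ (fun x' => g x' θ) x :=
    (hg (x, θ)).comp x (f := fun x' => (x', θ)) (by fun_prop)
  exact this.hasGradientAt

theorem inner_gradT {g : Vec n → Vec p → ℝ}
    (hg : Differentiable ℝ fun q : Vec n × Vec p => g q.1 q.2) (x : Vec n) (θ w : Vec p) :
    ⟪gradT g x θ, w⟫ = fderiv ℝ (fun q : Vec n × Vec p => g q.1 q.2) (x, θ) (0, w) := by
  have h1 := (hasGradientAt_gradT hg x θ).hasFDerivAt
  have h2 := (hg (x, θ)).hasFDerivAt.comp θ (f := fun θ' => (x, θ'))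
    ((hasFDerivAt_const x θ).prodMk (hasFDerivAt_id θ))
  have := congrArg (fun T => T w) (h1.unique h2)
  simpa using! this

theorem inner_gradX {g : Vec n → Vec p → ℝ}
    (hg : Differentiable ℝ fun q : Vec n × Vec p => g q.1 q.2) (x u : Vec n) (θ : Vec p) :
    ⟪gradX g x θ, u⟫ = fderiv ℝ (fun q : Vec n × Vec p => g q.1 q.2) (x, θ) (u, 0) := by
  have h1 := (hasGradientAt_gradX hg x θ).hasFDerivAt
  have h2 := (hg (x, θ)).hasFDerivAt.comp x (f := fun x' => (x', θ))
    ((hasFDerivAt_id x).prodMk (hasFDerivAt_const θ x))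
  have := congrArg (fun T => T u) (h1.unique h2)
  simpa using! this

theorem fderiv_apply_eq_inner {g : Vec n → Vec p → ℝ}
    (hg : Differentiable ℝ fun q : Vec n × Vec p => g q.1 q.2) (x u : Vec n) (θ w : Vec p) :
    fderiv ℝ (fun q : Vec n × Vec p => g q.1 q.2) (x, θ) (u, w)
      = ⟪gradX g x θ, u⟫ + ⟪gradT g x θ, w⟫ := by
  rw [inner_gradX hg, inner_gradT hg, ← map_add]
  simp

/-- The Riesz representation, as a continuous linear map. -/
def rieszInv (d : ℕ) : StrongDual ℝ (Vec d) →L[ℝ] Vec d :=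
  LinearMap.toContinuousLinearMap
    { toFun := (InnerProductSpace.toDual ℝ (Vec d)).symm
      map_add' := fun a b => map_add _ a b
      map_smul' := fun a b => by simp }

theorem inner_rieszInv {d : ℕ} (l : StrongDual ℝ (Vec d)) (w : Vec d) :
    ⟪rieszInv d l, w⟫ = l w := by
  simp [rieszInv]

/-- The partial gradient is a fixed continuous linear image of the full derivative, so it inherits
differentiability; testing against `w` expresses its derivative through the second derivative. -/
theorem exists_hasFDerivAt_gradT {g : Vec n → Vec p → ℝ}
    (hg : ContDiff ℝ 2 fun q : Vec n × Vec p => g q.1 q.2) (q : Vec n × Vec p) :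
    ∃ D : Vec n × Vec p →L[ℝ] Vec p, HasFDerivAt (fun q : Vec n × Vec p => gradT g q.1 q.2) D q ∧
      ∀ u w, ⟪D u, w⟫ =
        fderiv ℝ (fderiv ℝ fun q : Vec n × Vec p => g q.1 q.2) q u (0, w) := by
  set F := fderiv ℝ fun q : Vec n × Vec p => g q.1 q.2
  have hF : DifferentiableAt ℝ F q :=
    (hg.fderiv_right (m := 1) (by norm_num)).differentiable (by norm_num) q
  let R : (Vec n × Vec p →L[ℝ] ℝ) →L[ℝ] Vec p :=
    (rieszInv p).comp (ContinuousLinearMap.precomp ℝ (ContinuousLinearMap.inr ℝ (Vec n) (Vec p)))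
  have hR : (fun q : Vec n × Vec p => gradT g q.1 q.2) = fun q => R (F q) := by
    funext q
    refine ext_inner_right ℝ fun w => ?_
    rw [inner_gradT (hg.differentiable (by norm_num)) q.1 q.2 w]
    simp only [R, ContinuousLinearMap.comp_apply, inner_rieszInv]
    rfl
  refine ⟨R.comp (fderiv ℝ F q), ?_, fun u w => ?_⟩
  · rw [hR]
    exact R.hasFDerivAt.comp q hF.hasFDerivAt
  · simp only [R, ContinuousLinearMap.comp_apply, inner_rieszInv]
    rfl

theorem exists_hasFDerivAt_gradX {g : Vec n → Vec p → ℝ}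
    (hg : ContDiff ℝ 2 fun q : Vec n × Vec p => g q.1 q.2) (q : Vec n × Vec p) :
    ∃ D : Vec n × Vec p →L[ℝ] Vec n, HasFDerivAt (fun q : Vec n × Vec p => gradX g q.1 q.2) D q ∧
      ∀ u w, ⟪D u, w⟫ =
        fderiv ℝ (fderiv ℝ fun q : Vec n × Vec p => g q.1 q.2) q u (w, 0) := by
  set F := fderiv ℝ fun q : Vec n × Vec p => g q.1 q.2
  have hF : DifferentiableAt ℝ F q :=
    (hg.fderiv_right (m := 1) (by norm_num)).differentiable (by norm_num) q
  let R : (Vec n × Vec p →L[ℝ] ℝ) →L[ℝ] Vec n :=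
    (rieszInv n).comp (ContinuousLinearMap.precomp ℝ (ContinuousLinearMap.inl ℝ (Vec n) (Vec p)))
  have hR : (fun q : Vec n × Vec p => gradX g q.1 q.2) = fun q => R (F q) := by
    funext q
    refine ext_inner_right ℝ fun w => ?_
    rw [inner_gradX (hg.differentiable (by norm_num)) q.1 w q.2]
    simp only [R, ContinuousLinearMap.comp_apply, inner_rieszInv]
    rfl
  refine ⟨R.comp (fderiv ℝ F q), ?_, fun u w => ?_⟩
  · rw [hR]
    exact R.hasFDerivAt.comp q hF.hasFDerivAt
  · simp only [R, ContinuousLinearMap.comp_apply, inner_rieszInv]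
    rfl

/-- Symmetry of the second derivative is what turns the `x`-derivative of the `θ`-gradient into the
adjoint of `jacXT`, which is defined the other way round. -/
theorem hasFDerivAt_gradT {g : Vec n → Vec p → ℝ}
    (hg : ContDiff ℝ 2 fun q : Vec n × Vec p => g q.1 q.2) (x : Vec n) (θ : Vec p) :
    HasFDerivAt (fun q : Vec n × Vec p => gradT g q.1 q.2)
      ((ContinuousLinearMap.adjoint (jacXT g x θ)).coprod (hessTT g x θ)) (x, θ) := by
  obtain ⟨D, hD, hD'⟩ := exists_hasFDerivAt_gradT hg (x, θ)
  obtain ⟨J, hJ, hJ'⟩ := exists_hasFDerivAt_gradX hg (x, θ)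
  have hsymm : IsSymmSndFDerivAt ℝ (fun q : Vec n × Vec p => g q.1 q.2) (x, θ) :=
    hg.contDiffAt.isSymmSndFDerivAt (by simp)
  have hθ : HasFDerivAt (fun θ' : Vec p => (x, θ')) (ContinuousLinearMap.inr ℝ (Vec n) (Vec p)) θ :=
    hasFDerivAt_prodMk_right x θ
  have hH : hessTT g x θ = D.comp (ContinuousLinearMap.inr ℝ (Vec n) (Vec p)) :=
    (hD.comp θ (f := fun θ' => (x, θ')) hθ).fderiv
  have hJX : jacXT g x θ = J.comp (ContinuousLinearMap.inr ℝ (Vec n) (Vec p)) :=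
    (hJ.comp θ (f := fun θ' => (x, θ')) hθ).fderiv
  refine hD.congr_fderiv (ContinuousLinearMap.ext fun q => ext_inner_right ℝ fun w => ?_).symm
  obtain ⟨u, v⟩ := q
  rw [ContinuousLinearMap.coprod_apply, inner_add_left, ContinuousLinearMap.adjoint_inner_left,
    real_inner_comm, hJX, hH]
  have : D (u, v) = D (u, 0) + D (0, v) := by rw [← map_add]; simp
  rw [this, inner_add_left]
  congr 1
  simp only [ContinuousLinearMap.comp_apply, ContinuousLinearMap.inr_apply]
  rw [hD', hJ', hsymm.eq]

theorem hessTT_isSymmetric {g : Vec n → Vec p → ℝ}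
    (hg : ContDiff ℝ 2 fun q : Vec n × Vec p => g q.1 q.2) (x : Vec n) (θ : Vec p) :
    (hessTT g x θ : Vec p →ₗ[ℝ] Vec p).IsSymmetric := by
  obtain ⟨D, hD, hD'⟩ := exists_hasFDerivAt_gradT hg (x, θ)
  have hsymm : IsSymmSndFDerivAt ℝ (fun q : Vec n × Vec p => g q.1 q.2) (x, θ) :=
    hg.contDiffAt.isSymmSndFDerivAt (by simp)
  have hH : hessTT g x θ = D.comp (ContinuousLinearMap.inr ℝ (Vec n) (Vec p)) :=
    (hD.comp θ (f := fun θ' => (x, θ')) (hasFDerivAt_prodMk_right x θ)).fderiv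
  intro v w
  rw [hH]
  simp only [ContinuousLinearMap.coe_coe, ContinuousLinearMap.comp_apply,
    ContinuousLinearMap.inr_apply]
  rw [hD', real_inner_comm, hD', hsymm.eq]

theorem hasFDerivAt_gradT_right {g : Vec n → Vec p → ℝ}
    (hg : ContDiff ℝ 2 fun q : Vec n × Vec p => g q.1 q.2) (x : Vec n) (θ : Vec p) :
    HasFDerivAt (gradT g x) (hessTT g x θ) θ := by
  have := (hasFDerivAt_gradT hg x θ).comp θ (f := fun θ' => (x, θ')) (hasFDerivAt_prodMk_right x θ)
  exact this.congr_fderiv (ContinuousLinearMap.ext fun w => by simp)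

theorem hasFDerivAt_gradT_left {g : Vec n → Vec p → ℝ}
    (hg : ContDiff ℝ 2 fun q : Vec n × Vec p => g q.1 q.2) (x : Vec n) (θ : Vec p) :
    HasFDerivAt (fun x' => gradT g x' θ) (ContinuousLinearMap.adjoint (jacXT g x θ)) x := by
  have := (hasFDerivAt_gradT hg x θ).comp x (f := fun x' => (x', θ)) (hasFDerivAt_prodMk_left x θ)
  exact this.congr_fderiv (ContinuousLinearMap.ext fun w => by simp)

end Partial

/-! ### The inner problem -/

section Inner

open Filter Topology
open scoped RealInnerProductSpace

variable {n p : ℕ} {c : ClassConst} {μ : ℝ} {f g : Vec n → Vec p → ℝ}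

theorem JointLip.le {E : Type*} [NormedAddCommGroup E] {K : ℝ} {F : Vec n → Vec p → E}
    (hF : JointLip K F) (x x' : Vec n) (θ θ' : Vec p) :
    ‖F x θ - F x' θ'‖ ^ 2 ≤ K ^ 2 * (‖x - x'‖ ^ 2 + ‖θ - θ'‖ ^ 2) := by
  have := hF x x' θ θ'
  calc ‖F x θ - F x' θ'‖ ^ 2 ≤ (K * √(‖x - x'‖ ^ 2 + ‖θ - θ'‖ ^ 2)) ^ 2 := by gcongr
    _ = _ := by rw [mul_pow, Real.sq_sqrt (by positivity)]

namespace InnerAssumption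

variable (hg : InnerAssumption c μ g)
include hg

theorem differentiable : Differentiable ℝ fun q : Vec n × Vec p => g q.1 q.2 :=
  hg.contDiff.differentiable (by norm_num)

theorem strongMono (x : Vec n) (θ θ' : Vec p) :
    μ * ‖θ - θ'‖ ^ 2 ≤ ⟪gradT g x θ - gradT g x θ', θ - θ'⟫ :=
  inner_sub_ge_of_strongConvexOn (hg.strongConvex x) (hasGradientAt_gradT hg.differentiable x θ)
    (hasGradientAt_gradT hg.differentiable x θ')

theorem mul_norm_sub_le (x : Vec n) (θ θ' : Vec p) :
    μ * ‖θ - θ'‖ ≤ ‖gradT g x θ - gradT g x θ'‖ := by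
  rcases eq_or_ne θ θ' with rfl | h
  · simp
  · have h0 : 0 < ‖θ - θ'‖ := norm_pos_iff.2 (sub_ne_zero.2 h)
    have := (hg.strongMono x θ θ').trans (real_inner_le_norm _ _)
    exact le_of_mul_le_mul_right (by linarith) h0

/-- A unit vector is needed to compare strong monotonicity with the Lipschitz bound, hence `0 < p`.
The inequality gives `1 ≤ κ`, on which all order comparisons rest. -/
theorem le_Lgt (hp : 0 < p) : μ ≤ c.Lgt := by
  let e : Vec p := EuclideanSpace.single ⟨0, hp⟩ (1 : ℝ)
  have he : ‖e‖ = 1 := by simp [e]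
  have h1 := hg.mul_norm_sub_le 0 e 0
  have h2 := hg.lip_gradT 0 e 0
  rw [sub_zero, he, mul_one] at *
  linarith

theorem norm_hessTT_le (hL : 0 ≤ c.Lgt) (x : Vec n) (θ : Vec p) : ‖hessTT g x θ‖ ≤ c.Lgt := by
  refine (hasFDerivAt_gradT_right hg.contDiff x θ).le_of_lip'
    hL (Eventually.of_forall fun θ' => hg.lip_gradT x θ' θ)

/-- Strong monotonicity between `θ + t w` and `θ`, divided by `t²`, in the limit `t ↓ 0`. -/
theorem hessTT_inner_ge (x : Vec n) (θ w : Vec p) : μ * ‖w‖ ^ 2 ≤ ⟪hessTT g x θ w, w⟫ := by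
  have hline : HasDerivAt (fun t : ℝ => θ + t • w) w 0 := by
    simpa using ((hasDerivAt_id (0 : ℝ)).smul_const w).const_add θ
  have h0 : HasFDerivAt (gradT g x) (hessTT g x θ) (θ + (0 : ℝ) • w) := by
    simpa using hasFDerivAt_gradT_right hg.contDiff x θ
  have hder : HasDerivAt (fun t : ℝ => gradT g x (θ + t • w)) (hessTT g x θ w) 0 :=
    h0.comp_hasDerivAt 0 hline
  have hlim := Filter.Tendsto.inner (𝕜 := ℝ) hder.tendsto_slope_zero_right
    (tendsto_const_nhds (x := w))
  refine ge_of_tendsto hlim ?_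
  filter_upwards [self_mem_nhdsWithin] with t ht
  have ht : 0 < t := ht
  have := hg.strongMono x (θ + t • w) θ
  simp only [zero_add, zero_smul, add_zero, add_sub_cancel_left] at this ⊢
  rw [norm_smul, Real.norm_of_nonneg ht.le, real_inner_smul_right] at this
  rw [real_inner_smul_left, ← mul_le_mul_iff_of_pos_left (mul_pos ht ht)]
  calc t * t * (μ * ‖w‖ ^ 2) = μ * (t * ‖w‖) ^ 2 := by ring
    _ ≤ _ := this
    _ = _ := by field_simp

theorem norm_hessTT_ge (x : Vec n) (θ w : Vec p) : μ * ‖w‖ ≤ ‖hessTT g x θ w‖ := by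
  rcases eq_or_ne w 0 with rfl | h
  · simp
  · have h0 : 0 < ‖w‖ := norm_pos_iff.2 h
    have := (hg.hessTT_inner_ge x θ w).trans (real_inner_le_norm _ _)
    exact le_of_mul_le_mul_right (by linarith) h0

/-- The lower bound makes the Hessian injective, hence invertible in finite dimension, so `inverse`
does not take its default value. -/
theorem hessTT_inverse (hμ : 0 < μ) (x : Vec n) (θ w : Vec p) :
    hessTT g x θ ((hessTT g x θ).inverse w) = w := by
  have hinj : Function.Injective (hessTT g x θ : Vec p →ₗ[ℝ] Vec p) := by
    refine (injective_iff_map_eq_zero _).2 fun v hv => ?_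
    have := hg.norm_hessTT_ge x θ v
    rw [show hessTT g x θ v = 0 from hv, norm_zero] at this
    exact norm_le_zero_iff.1 (nonpos_of_mul_nonpos_right this hμ)
  let e : Vec p ≃L[ℝ] Vec p :=
    (LinearEquiv.ofInjectiveEndo (hessTT g x θ : Vec p →ₗ[ℝ] Vec p) hinj).toContinuousLinearEquiv
  have he : hessTT g x θ = (e : Vec p →L[ℝ] Vec p) := by ext v; rfl
  rw [he, ContinuousLinearMap.inverse_equiv]
  exact e.apply_symm_apply w

theorem innerSol_le (hμ : 0 < μ) (x : Vec n) (θ : Vec p) : g x (innerSol g x) ≤ g x θ := by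
  have : Differentiable ℝ (g x) := fun θ =>
    (hasGradientAt_gradT hg.differentiable x θ).differentiableAt
  have h := exists_forall_le_of_strongConvexOn hμ (hg.strongConvex x) this
  exact Classical.epsilon_spec h θ

theorem gradT_innerSol (hμ : 0 < μ) (x : Vec n) : gradT g x (innerSol g x) = 0 := by
  have h : IsLocalMin (g x) (innerSol g x) :=
    Eventually.of_forall fun θ => hg.innerSol_le hμ x θ
  have h1 := (hasGradientAt_gradT hg.differentiable x (innerSol g x)).hasFDerivAt
  have := h.hasFDerivAt_eq_zero h1
  simpa using this

theorem gradT_lip_left (x x' : Vec n) (θ : Vec p) :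
    ‖gradT g x θ - gradT g x' θ‖ ≤ c.Cgxt * ‖x - x'‖ := by
  refine convex_univ.norm_image_sub_le_of_norm_hasFDerivWithin_le
    (f := fun x' => gradT g x' θ)
    (fun y _ => (hasFDerivAt_gradT_left hg.contDiff y θ).hasFDerivWithinAt) (fun y _ => ?_)
    (Set.mem_univ x') (Set.mem_univ x)
  rw [LinearIsometryEquiv.norm_map]
  exact hg.bound_jacXT y θ

theorem innerSol_lip (hμ : 0 < μ) (x x' : Vec n) :
    ‖innerSol g x - innerSol g x'‖ ≤ LthetaStar c μ * ‖x - x'‖ := by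
  have h1 := hg.mul_norm_sub_le x' (innerSol g x) (innerSol g x')
  -- The zero gradient at `x'` is rewritten as the zero gradient at `x`, so that both gradients are
  -- taken at the same `θ` and only the outer variable differs.
  rw [hg.gradT_innerSol hμ, ← hg.gradT_innerSol hμ x] at h1
  have h2 := hg.gradT_lip_left x' x (innerSol g x)
  rw [norm_sub_rev x' x] at h2
  rw [LthetaStar, div_mul_eq_mul_div, le_div_iff₀ hμ]
  linarith

theorem gradStep_lip (hL : 0 < c.Lgt) (hμ : 0 < μ) {β : ℝ} (hβ : 0 ≤ β) (hβ' : β ≤ betMax c μ)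
    (x : Vec n) (θ θ' : Vec p) :
    ‖(θ - β • gradT g x θ) - (θ' - β • gradT g x θ')‖
      ≤ (1 - 2 * β * omegaT c μ) * ‖θ - θ'‖ := by
  have hs : 0 < μ + c.Lgt := by linarith
  have b1 : β * (μ + c.Lgt) ≤ 2 := by
    rw [← le_div_iff₀ hs]; exact hβ'.trans (min_le_left _ _)
  have b2 : β * (2 * μ * c.Lgt) ≤ μ + c.Lgt := by
    rw [← le_div_iff₀ (by positivity)]; exact hβ'.trans (min_le_right _ _)
  have hω : 2 * omegaT c μ = μ * c.Lgt / (μ + c.Lgt) := by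
    unfold omegaT; field_simp
  -- The factor `1 - 2βω` has to dominate both ends `1 - βμ` and `βL - 1` of the spectral bound; the
  -- second follows from `β (μ + L) ≤ 2` and `2ω ≤ μ`.
  have hωμ : 2 * omegaT c μ ≤ μ := by
    rw [hω, div_le_iff₀ hs]; nlinarith
  have hω1 : β * (2 * omegaT c μ) ≤ 1 := by
    rw [hω, ← mul_div_assoc, div_le_one hs]; nlinarith
  refine convex_univ.norm_image_sub_le_of_norm_hasFDerivWithin_le
    (f := fun θ => θ - β • gradT g x θ) (f' := fun θ => 1 - β • hessTT g x θ)
    (fun y _ => ((hasFDerivAt_id y).sub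
      ((hasFDerivAt_gradT_right hg.contDiff x y).const_smul β)).hasFDerivWithinAt) (fun y _ => ?_)
    (Set.mem_univ θ') (Set.mem_univ θ)
  refine norm_one_sub_smul_le (hessTT_isSymmetric hg.contDiff x y) (hg.hessTT_inner_ge x y)
    (hg.norm_hessTT_le hL.le x y) hβ (by linarith) (by nlinarith) (by nlinarith)

/-- Implicit differentiation, with the Lipschitz bound in place of an implicit function theorem. The
expansion of the `θ`-gradient at `(x, θ⋆(x))` is evaluated along `y ↦ (y, θ⋆(y))`, where the
gradient vanishes; the Lipschitz bound makes the remainder `o(‖y - x‖)`, and the inverse Hessian is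
applied. -/
theorem hasFDerivAt_innerSol (hμ : 0 < μ) (x : Vec n) :
    HasFDerivAt (innerSol g) (-((hessTT g x (innerSol g x)).inverse.comp
      (ContinuousLinearMap.adjoint (jacXT g x (innerSol g x))))) x := by
  set H := hessTT g x (innerSol g x)
  set A := ContinuousLinearMap.adjoint (jacXT g x (innerSol g x))
  have hD := (hasFDerivAt_gradT hg.contDiff x (innerSol g x)).isLittleO
  have hcont : Tendsto (fun y => (y, innerSol g y)) (𝓝 x) (𝓝 (x, innerSol g x)) := by
    refine Tendsto.prodMk_nhds tendsto_id ?_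
    rw [tendsto_iff_norm_sub_tendsto_zero]
    refine squeeze_zero (fun _ => norm_nonneg _) (fun y => hg.innerSol_lip hμ y x) ?_
    have : Continuous fun y : Vec n => LthetaStar c μ * ‖y - x‖ := by fun_prop
    simpa using this.tendsto x
  have h1 := hD.comp_tendsto hcont
  have hO : (fun y => ((y, innerSol g y) : Vec n × Vec p) - (x, innerSol g x))
      =O[𝓝 x] fun y => y - x := by
    refine (Asymptotics.isBigO_refl _ _).prod_left ?_
    exact Asymptotics.IsBigO.of_bound _ (Eventually.of_forall fun y => hg.innerSol_lip hμ y x)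
  have h2 := h1.trans_isBigO hO
  refine HasFDerivAt.of_isLittleO ?_
  have h3 := (H.inverse.isBigO_comp _ (𝓝 x)).trans_isLittleO h2
  refine h3.neg_left.congr_left fun y => ?_
  have hinv : ∀ w, H.inverse (H w) = w := fun w => by
    have := hg.hessTT_inverse hμ x (innerSol g x) (H w)
    have h4 := hg.norm_hessTT_ge x (innerSol g x) (H.inverse (H w) - w)
    rw [map_sub, this, sub_self, norm_zero] at h4
    exact sub_eq_zero.1 (norm_le_zero_iff.1 (nonpos_of_mul_nonpos_right h4 hμ))
  simp only [Function.comp_apply, hg.gradT_innerSol hμ, Prod.mk_sub_mk,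
    ContinuousLinearMap.coprod_apply, sub_self, zero_sub, map_neg, neg_neg, map_add]
  rw [hinv]
  simp only [neg_apply, ContinuousLinearMap.comp_apply]
  abel

end InnerAssumption

end Inner

/-! ### The hypergradient -/

section Hypergradient

open Filter Topology
open scoped RealInnerProductSpace

variable {n p : ℕ} {c : ClassConst} {μ : ℝ} {f g : Vec n → Vec p → ℝ}

theorem hessTT_vStar (hg : InnerAssumption c μ g) (hμ : 0 < μ) (x : Vec n) :
    hessTT g x (innerSol g x) (vStar f g x) = gradT f x (innerSol g x) :=
  hg.hessTT_inverse hμ x _ _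

theorem norm_vStar_le (hf : OuterAssumption c f g) (hg : InnerAssumption c μ g) (hμ : 0 < μ)
    (x : Vec n) : ‖vStar f g x‖ ≤ Mv c μ := by
  have := hg.norm_hessTT_ge x (innerSol g x) (vStar f g x)
  rw [hessTT_vStar hg hμ] at this
  rw [Mv, le_div_iff₀ hμ]
  linarith [hf.bound_gradT x]

/-- The residual of the linear system defining `vStar` vanishes at `(x, θ⋆(x))`, so away from that
point it is controlled by the Lipschitz constants. It serves both as the perturbation in the `v`
step and as the source of the Lipschitz bound for `vStar`. -/
theorem norm_hessTT_vStar_sub_le (hf : OuterAssumption c f g)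
    (hg : InnerAssumption c μ g) (hμ : 0 < μ) (x x' : Vec n) (θ' : Vec p) :
    ‖hessTT g x' θ' (vStar f g x) - gradT f x' θ'‖
      ≤ (c.Lft + Mv c μ * c.Lgtt) * √(‖x' - x‖ ^ 2 + ‖θ' - innerSol g x‖ ^ 2) := by
  set s := √(‖x' - x‖ ^ 2 + ‖θ' - innerSol g x‖ ^ 2)
  have hs : 0 ≤ s := Real.sqrt_nonneg _
  have e : hessTT g x' θ' (vStar f g x) - gradT f x' θ'
      = (hessTT g x' θ' - hessTT g x (innerSol g x)) (vStar f g x)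
        - (gradT f x' θ' - gradT f x (innerSol g x)) := by
    rw [sub_apply, hessTT_vStar hg hμ]; abel
  have h1 : ‖(hessTT g x' θ' - hessTT g x (innerSol g x)) (vStar f g x)‖
      ≤ (c.Lgtt * s) * Mv c μ :=
    ContinuousLinearMap.le_of_opNorm_le_of_le _ (hg.lip_hessTT x' x θ' _)
      (norm_vStar_le hf hg hμ x)
  have h2 := hf.lip_gradT x' x θ' (innerSol g x)
  rw [e]
  refine (norm_sub_le _ _).trans ?_
  linarith

theorem norm_hessTT_vStar_sub_sq_le (hf : OuterAssumption c f g)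
    (hg : InnerAssumption c μ g) (hμ : 0 < μ) (x x' : Vec n) (θ' : Vec p) :
    ‖hessTT g x' θ' (vStar f g x) - gradT f x' θ'‖ ^ 2
      ≤ Lfgt c μ * (‖x' - x‖ ^ 2 + ‖θ' - innerSol g x‖ ^ 2) := by
  have h := norm_hessTT_vStar_sub_le hf hg hμ x x' θ'
  have h2 := pow_le_pow_left₀ (norm_nonneg _) h 2
  rw [mul_pow, Real.sq_sqrt (by positivity)] at h2
  refine h2.trans ?_
  gcongr
  unfold Lfgt
  nlinarith [sq_nonneg (c.Lft - Mv c μ * c.Lgtt), sq_nonneg (Mv c μ * c.Lgtt)]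

theorem sqrt_le_mul_norm (hg : InnerAssumption c μ g) (hμ : 0 < μ) (x x' : Vec n) :
    √(‖x - x'‖ ^ 2 + ‖innerSol g x - innerSol g x'‖ ^ 2)
      ≤ (1 + LthetaStar c μ) * ‖x - x'‖ := by
  have h := hg.innerSol_lip hμ x x'
  refine (Real.sqrt_le_sqrt ?_).trans
    (Real.sqrt_sq (add_nonneg (norm_nonneg (x - x')) (norm_nonneg _))).le |>.trans
      (b := ‖x - x'‖ + ‖innerSol g x - innerSol g x'‖) ?_
  · nlinarith [norm_nonneg (x - x'), norm_nonneg (innerSol g x - innerSol g x')]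
  · linarith

theorem Lv_eq : Lv c μ = (c.Lft + Mv c μ * c.Lgtt) / μ := by
  unfold Lv Mv
  rcases eq_or_ne μ 0 with rfl | h
  · simp
  · field_simp

theorem norm_vStar_sub_le_sqrt (hf : OuterAssumption c f g)
    (hg : InnerAssumption c μ g) (hμ : 0 < μ) (x x' : Vec n) :
    ‖vStar f g x - vStar f g x'‖
      ≤ Lv c μ * √(‖x - x'‖ ^ 2 + ‖innerSol g x - innerSol g x'‖ ^ 2) := by
  -- The residual of `vStar f g x'` in the system at `x` is, up to sign, the Hessian at `x` applied
  -- to the difference of the two solutions.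
  have h1 := norm_hessTT_vStar_sub_le hf hg hμ x' x (innerSol g x)
  have h2 := hg.norm_hessTT_ge x (innerSol g x) (vStar f g x - vStar f g x')
  rw [map_sub, hessTT_vStar hg hμ, norm_sub_rev (gradT f x _)] at h2
  rw [Lv_eq, div_mul_eq_mul_div, le_div_iff₀ hμ]
  linarith

theorem Lv_pos (hc : c.Pos) (hμ : 0 < μ) : 0 < Lv c μ := by
  have := hc.Lft; have := hc.Cft; have := hc.Lgtt
  unfold Lv; positivity

theorem vStar_lip (hc : c.Pos) (hf : OuterAssumption c f g)
    (hg : InnerAssumption c μ g) (hμ : 0 < μ) (x x' : Vec n) :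
    ‖vStar f g x - vStar f g x'‖ ≤ LvStar c μ * ‖x - x'‖ := by
  refine (norm_vStar_sub_le_sqrt hf hg hμ x x').trans ?_
  rw [LvStar, mul_assoc]
  exact mul_le_mul_of_nonneg_left (sqrt_le_mul_norm hg hμ x x') (Lv_pos hc hμ).le

/-- The hypergradient of a node. -/
def hyperGrad (f g : Vec n → Vec p → ℝ) (x : Vec n) : Vec n :=
  gradX f x (innerSol g x) - jacXT g x (innerSol g x) (vStar f g x)

theorem hasGradientAt_localObj (hf : OuterAssumption c f g) (hg : InnerAssumption c μ g)
    (hμ : 0 < μ) (x : Vec n) : HasGradientAt (localObj f g) (hyperGrad f g x) x := by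
  have hfd : Differentiable ℝ fun q : Vec n × Vec p => f q.1 q.2 :=
    hf.contDiff.differentiable (by norm_num)
  have h1 := (hfd (x, innerSol g x)).hasFDerivAt.comp x (f := fun y => (y, innerSol g y))
    ((hasFDerivAt_id x).prodMk (hg.hasFDerivAt_innerSol hμ x))
  rw [hasGradientAt_iff_hasFDerivAt]
  refine h1.congr_fderiv (ContinuousLinearMap.ext fun u => ?_)
  -- Symmetry of the Hessian moves its inverse from the derivative of the inner solution onto the
  -- gradient of `f`, which produces `vStar`.
  have h2 : ∀ w, ⟪gradT f x (innerSol g x), (hessTT g x (innerSol g x)).inverse w⟫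
      = ⟪vStar f g x, w⟫ := fun w => by
    conv_rhs => rw [← hg.hessTT_inverse hμ x (innerSol g x) w]
    rw [← hessTT_vStar (f := f) hg hμ x]
    exact hessTT_isSymmetric hg.contDiff x (innerSol g x) _ _
  simp only [ContinuousLinearMap.comp_apply, ContinuousLinearMap.prod_apply,
    neg_apply, InnerProductSpace.toDual_apply_apply]
  rw [fderiv_apply_eq_inner hfd, hyperGrad, inner_neg_right, h2,
    ContinuousLinearMap.adjoint_inner_right, inner_sub_left, sub_eq_add_neg]
  rfl

theorem gradient_localObj (hf : OuterAssumption c f g) (hg : InnerAssumption c μ g)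
    (hμ : 0 < μ) (x : Vec n) : gradient (localObj f g) x = hyperGrad f g x :=
  (hasGradientAt_localObj hf hg hμ x).gradient

theorem hyperGrad_lip (hc : c.Pos) (hf : OuterAssumption c f g)
    (hg : InnerAssumption c μ g) (hμ : 0 < μ) (x x' : Vec n) :
    ‖hyperGrad f g x - hyperGrad f g x'‖ ≤ Lhyper c μ * ‖x - x'‖ := by
  have := hc.Lfx; have := hc.Cft; have := hc.Lgxt; have hC := hc.Cgxt; have := Lv_pos hc hμ
  set s := √(‖x - x'‖ ^ 2 + ‖innerSol g x - innerSol g x'‖ ^ 2)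
  have hs : s ≤ (1 + LthetaStar c μ) * ‖x - x'‖ := sqrt_le_mul_norm hg hμ x x'
  have e : hyperGrad f g x - hyperGrad f g x'
      = (gradX f x (innerSol g x) - gradX f x' (innerSol g x'))
        - (jacXT g x (innerSol g x) - jacXT g x' (innerSol g x')) (vStar f g x')
        - jacXT g x (innerSol g x) (vStar f g x - vStar f g x') := by
    simp only [hyperGrad, sub_apply, map_sub]; abel
  have h1 : ‖gradX f x (innerSol g x) - gradX f x' (innerSol g x')‖ ≤ c.Lfx * s :=
    hf.lip_gradX _ _ _ _
  have h2 : ‖(jacXT g x (innerSol g x) - jacXT g x' (innerSol g x')) (vStar f g x')‖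
      ≤ (c.Lgxt * s) * Mv c μ :=
    ContinuousLinearMap.le_of_opNorm_le_of_le _ (hg.lip_jacXT _ _ _ _)
      (norm_vStar_le hf hg hμ x')
  have h3 : ‖jacXT g x (innerSol g x) (vStar f g x - vStar f g x')‖ ≤ c.Cgxt * (Lv c μ * s) :=
    ContinuousLinearMap.le_of_opNorm_le_of_le _ (hg.bound_jacXT _ _)
      (norm_vStar_sub_le_sqrt hf hg hμ x x')
  have h4 : ‖hyperGrad f g x - hyperGrad f g x'‖
      ≤ (c.Lfx + c.Cgxt * Lv c μ + c.Cft * c.Lgxt / μ) * s := by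
    rw [e]
    refine (norm_sub_le _ _).trans ((add_le_add (norm_sub_le _ _) le_rfl).trans ?_)
    have : c.Lgxt * s * Mv c μ = c.Cft * c.Lgxt / μ * s := by unfold Mv; ring
    linarith
  refine h4.trans ?_
  rw [Lhyper, mul_assoc]
  gcongr

/-- Bias of the mean stochastic direction at `(x', θ', v)` as an estimate of the hypergradient at
`x`; it vanishes when all three arguments are exact. The coefficient `3/2 Lfgx` is `3 Lfx² + 6 M²
Lgxt²`. -/
theorem norm_hyperGrad_sub_sq_le (hf : OuterAssumption c f g)
    (hg : InnerAssumption c μ g) (hμ : 0 < μ) (x x' : Vec n) (θ' v : Vec p) :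
    ‖hyperGrad f g x - (gradX f x' θ' - jacXT g x' θ' v)‖ ^ 2
      ≤ 3 * c.Cgxt ^ 2 * ‖v - vStar f g x‖ ^ 2
        + 3 / 2 * Lfgx c μ * (‖x' - x‖ ^ 2 + ‖θ' - innerSol g x‖ ^ 2) := by
  set D := ‖x' - x‖ ^ 2 + ‖θ' - innerSol g x‖ ^ 2
  set a := ‖jacXT g x' θ' (v - vStar f g x)‖
  set b1 := ‖gradX f x' θ' - gradX f x (innerSol g x)‖
  set b2 := ‖(jacXT g x' θ' - jacXT g x (innerSol g x)) (vStar f g x)‖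
  have e : hyperGrad f g x - (gradX f x' θ' - jacXT g x' θ' v)
      = jacXT g x' θ' (v - vStar f g x) - (gradX f x' θ' - gradX f x (innerSol g x))
        + (jacXT g x' θ' - jacXT g x (innerSol g x)) (vStar f g x) := by
    simp only [hyperGrad, sub_apply, map_sub]; abel
  have h0 : ‖hyperGrad f g x - (gradX f x' θ' - jacXT g x' θ' v)‖ ≤ a + b1 + b2 := by
    rw [e]
    exact (norm_add_le _ _).trans (add_le_add (norm_sub_le _ _) le_rfl)
  have ha : a ^ 2 ≤ c.Cgxt ^ 2 * ‖v - vStar f g x‖ ^ 2 := by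
    rw [← mul_pow]
    exact pow_le_pow_left₀ (norm_nonneg _)
      (ContinuousLinearMap.le_of_opNorm_le _ (hg.bound_jacXT _ _) _) 2
  have hb1 : b1 ^ 2 ≤ c.Lfx ^ 2 * D := hf.lip_gradX.le _ _ _ _
  have hb2 : b2 ^ 2 ≤ c.Lgxt ^ 2 * D * Mv c μ ^ 2 := by
    have h1 : b2 ≤ ‖jacXT g x' θ' - jacXT g x (innerSol g x)‖ * Mv c μ :=
      ContinuousLinearMap.le_of_opNorm_le_of_le _ le_rfl (norm_vStar_le hf hg hμ x)
    calc b2 ^ 2 ≤ (‖jacXT g x' θ' - jacXT g x (innerSol g x)‖ * Mv c μ) ^ 2 :=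
          pow_le_pow_left₀ (norm_nonneg _) h1 2
      _ = ‖jacXT g x' θ' - jacXT g x (innerSol g x)‖ ^ 2 * Mv c μ ^ 2 := by ring
      _ ≤ _ := by gcongr; exact hg.lip_jacXT.le _ _ _ _
  have hD : 0 ≤ Mv c μ ^ 2 * c.Lgxt ^ 2 * D := by positivity
  have h1 := pow_le_pow_left₀ (norm_nonneg _) h0 2
  have hL : 3 / 2 * Lfgx c μ * D = 3 * (c.Lfx ^ 2 * D) + 6 * (c.Lgxt ^ 2 * D * Mv c μ ^ 2) := by
    unfold Lfgx; ring
  rw [hL]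
  nlinarith [sq_nonneg (a - (b1 + b2) * 2), sq_nonneg (a - b1), sq_nonneg (a - b2),
    sq_nonneg (b1 - b2)]

end Hypergradient

/-! ### Averages over the nodes -/

section Averages

open scoped RealInnerProductSpace

variable {m : ℕ}

/-- The average of a real quantity over the nodes. -/
def avg (a : Fin m → ℝ) : ℝ := (1 / (m : ℝ)) * ∑ i, a i

theorem avg_add (a b : Fin m → ℝ) : avg (fun i => a i + b i) = avg a + avg b := by
  simp only [avg, Finset.sum_add_distrib, mul_add]

theorem avg_mul (r : ℝ) (a : Fin m → ℝ) : avg (fun i => r * a i) = r * avg a := by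
  simp only [avg, ← Finset.mul_sum]; ring

theorem avg_const (hm : 0 < m) (r : ℝ) : avg (fun _ : Fin m => r) = r := by
  have : (m : ℝ) ≠ 0 := by positivity
  simp [avg]; field_simp

theorem avg_mono {a b : Fin m → ℝ} (h : ∀ i, a i ≤ b i) : avg a ≤ avg b :=
  mul_le_mul_of_nonneg_left (Finset.sum_le_sum fun i _ => h i) (by positivity)

theorem avg_nonneg {a : Fin m → ℝ} (h : ∀ i, 0 ≤ a i) : 0 ≤ avg a :=
  mul_nonneg (by positivity) (Finset.sum_nonneg fun i _ => h i)

variable {E : Type*} [NormedAddCommGroup E]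

/-- The average of a vector quantity over the nodes. -/
def vmean [NormedSpace ℝ E] (a : Fin m → E) : E := (1 / (m : ℝ)) • ∑ i, a i

theorem vmean_sub [NormedSpace ℝ E] (a b : Fin m → E) :
    vmean (fun i => a i - b i) = vmean a - vmean b := by
  simp only [vmean, Finset.sum_sub_distrib, smul_sub]

theorem vmean_add [NormedSpace ℝ E] (a b : Fin m → E) :
    vmean (fun i => a i + b i) = vmean a + vmean b := by
  simp only [vmean, Finset.sum_add_distrib, smul_add]

theorem vmean_smul [NormedSpace ℝ E] (r : ℝ) (a : Fin m → E) :
    vmean (fun i => r • a i) = r • vmean a := by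
  simp only [vmean, ← Finset.smul_sum, smul_comm r]

theorem vmean_const [NormedSpace ℝ E] (hm : 0 < m) (a : E) : vmean (fun _ : Fin m => a) = a := by
  have : (m : ℝ) ≠ 0 := by positivity
  simp only [vmean, Finset.sum_const, Finset.card_univ, Fintype.card_fin,
    ← Nat.cast_smul_eq_nsmul ℝ,
    smul_smul, one_div_mul_cancel this, one_smul]

variable [InnerProductSpace ℝ E]

/-- The bias-variance identity: deviations from the mean sum to zero, so the cross terms vanish. -/
theorem sum_norm_sub_sq (hm : 0 < m) (a : Fin m → E) (b : E) :
    ∑ i, ‖a i - b‖ ^ 2 = ∑ i, ‖a i - vmean a‖ ^ 2 + m * ‖vmean a - b‖ ^ 2 := by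
  have hm' : (m : ℝ) ≠ 0 := by positivity
  have h : ∀ i, ‖a i - b‖ ^ 2 = ‖a i - vmean a‖ ^ 2 + 2 * ⟪a i - vmean a, vmean a - b⟫
      + ‖vmean a - b‖ ^ 2 := fun i => by
    rw [← norm_add_sq_real]; congr 2; abel
  have h0 : ∑ i, (a i - vmean a) = 0 := by
    rw [Finset.sum_sub_distrib, Finset.sum_const, Finset.card_univ, Fintype.card_fin,
      ← Nat.cast_smul_eq_nsmul ℝ, vmean, smul_smul, mul_one_div_cancel hm', one_smul, sub_self]
  simp only [h, Finset.sum_add_distrib, ← Finset.mul_sum, ← sum_inner, h0, inner_zero_left]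
  simp

theorem sum_norm_sub_vmean_le (hm : 0 < m) (a : Fin m → E) (b : E) :
    ∑ i, ‖a i - vmean a‖ ^ 2 ≤ ∑ i, ‖a i - b‖ ^ 2 := by
  rw [sum_norm_sub_sq hm a b]
  have : 0 ≤ m * ‖vmean a - b‖ ^ 2 := by positivity
  linarith

theorem norm_vmean_sq_le (hm : 0 < m) (a : Fin m → E) : ‖vmean a‖ ^ 2 ≤ avg fun i => ‖a i‖ ^ 2 := by
  have h := sum_norm_sub_sq hm a 0
  simp only [sub_zero] at h
  have : 0 ≤ ∑ i, ‖a i - vmean a‖ ^ 2 := Finset.sum_nonneg fun _ _ => by positivity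
  have hm' : (0 : ℝ) < m := by positivity
  rw [avg, one_div, ← div_eq_inv_mul, le_div_iff₀ hm']
  linarith

/-- The sum over all pairs of nodes, divided by `m`. -/
def pairAvg (F : Fin m → Fin m → ℝ) : ℝ := (1 / (m : ℝ)) * ∑ i, ∑ j, F i j

theorem pairAvg_add (F G : Fin m → Fin m → ℝ) :
    pairAvg (fun i j => F i j + G i j) = pairAvg F + pairAvg G := by
  simp only [pairAvg, Finset.sum_add_distrib, mul_add]

theorem pairAvg_mul (r : ℝ) (F : Fin m → Fin m → ℝ) :
    pairAvg (fun i j => r * F i j) = r * pairAvg F := by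
  simp only [pairAvg, ← Finset.mul_sum]; ring

theorem pairAvg_mono {F G : Fin m → Fin m → ℝ} (h : ∀ i j, F i j ≤ G i j) :
    pairAvg F ≤ pairAvg G :=
  mul_le_mul_of_nonneg_left
    (Finset.sum_le_sum fun i _ => Finset.sum_le_sum fun j _ => h i j) (by positivity)

/-- Converts between the pairwise form, in which the heterogeneity of `g` is assumed, and the
deviation-from-mean form used for `f` and in consensus. -/
theorem pairAvg_norm_sub_sq (hm : 0 < m) (a : Fin m → E) :
    pairAvg (fun i j => ‖a i - a j‖ ^ 2) = 2 * ∑ i, ‖a i - vmean a‖ ^ 2 := by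
  have hm' : (m : ℝ) ≠ 0 := by positivity
  have h : ∀ i, ∑ j, ‖a i - a j‖ ^ 2 = ∑ j, ‖a j - vmean a‖ ^ 2 + m * ‖a i - vmean a‖ ^ 2 := by
    intro i
    rw [norm_sub_rev (a i) (vmean a), ← sum_norm_sub_sq hm]
    exact Finset.sum_congr rfl fun j _ => by rw [norm_sub_rev]
  simp only [pairAvg, h, Finset.sum_add_distrib, ← Finset.mul_sum, Finset.sum_const,
    Finset.card_univ, Fintype.card_fin, nsmul_eq_mul]
  field_simp
  ring

end Averages

/-! ### Heterogeneity of the hypergradients -/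

section HyperHeterogeneity

variable {m n p : ℕ} {c : ClassConst} {μ bf bg : ℝ} {f g : Fin m → Vec n → Vec p → ℝ}

theorem norm_vStar_sub_sq_le_of_nodes {f₁ g₁ f₂ g₂ : Vec n → Vec p → ℝ}
    (hg₁ : InnerAssumption c μ g₁) (hf₂ : OuterAssumption c f₂ g₂)
    (hg₂ : InnerAssumption c μ g₂) (hμ : 0 < μ) (x : Vec n) :
    ‖vStar f₁ g₁ x - vStar f₂ g₂ x‖ ^ 2 ≤
      2 / μ ^ 2 * (‖gradT f₁ x (innerSol g₁ x) - gradT f₂ x (innerSol g₂ x)‖ ^ 2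
        + Mv c μ ^ 2 * ‖hessTT g₁ x (innerSol g₁ x) - hessTT g₂ x (innerSol g₂ x)‖ ^ 2) := by
  have h1 := hg₁.norm_hessTT_ge x (innerSol g₁ x) (vStar f₁ g₁ x - vStar f₂ g₂ x)
  have e : hessTT g₁ x (innerSol g₁ x) (vStar f₁ g₁ x - vStar f₂ g₂ x)
      = (gradT f₁ x (innerSol g₁ x) - gradT f₂ x (innerSol g₂ x))
        - (hessTT g₁ x (innerSol g₁ x) - hessTT g₂ x (innerSol g₂ x)) (vStar f₂ g₂ x) := by
    rw [map_sub, sub_apply, hessTT_vStar hg₁ hμ, hessTT_vStar hg₂ hμ]; abel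
  have h2 : ‖(hessTT g₁ x (innerSol g₁ x) - hessTT g₂ x (innerSol g₂ x)) (vStar f₂ g₂ x)‖
      ≤ ‖hessTT g₁ x (innerSol g₁ x) - hessTT g₂ x (innerSol g₂ x)‖ * Mv c μ :=
    ContinuousLinearMap.le_of_opNorm_le_of_le _ le_rfl (norm_vStar_le hf₂ hg₂ hμ x)
  rw [e] at h1
  have h3 := h1.trans ((norm_sub_le _ _).trans (add_le_add le_rfl h2))
  have h4 := pow_le_pow_left₀ (by positivity) h3 2
  rw [div_mul_eq_mul_div, le_div_iff₀ (by positivity)]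
  nlinarith [sq_nonneg (‖gradT f₁ x (innerSol g₁ x) - gradT f₂ x (innerSol g₂ x)‖
    - ‖hessTT g₁ x (innerSol g₁ x) - hessTT g₂ x (innerSol g₂ x)‖ * Mv c μ)]

theorem norm_hyperGrad_sub_sq_le_of_nodes {f₁ g₁ f₂ g₂ : Vec n → Vec p → ℝ}
    (hg₁ : InnerAssumption c μ g₁) (hf₂ : OuterAssumption c f₂ g₂)
    (hg₂ : InnerAssumption c μ g₂) (hμ : 0 < μ) (x : Vec n) :
    ‖hyperGrad f₁ g₁ x - hyperGrad f₂ g₂ x‖ ^ 2 ≤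
      3 * ‖gradX f₁ x (innerSol g₁ x) - gradX f₂ x (innerSol g₂ x)‖ ^ 2
      + 3 * Mv c μ ^ 2 * ‖jacXT g₁ x (innerSol g₁ x) - jacXT g₂ x (innerSol g₂ x)‖ ^ 2
      + 3 * c.Cgxt ^ 2 * ‖vStar f₁ g₁ x - vStar f₂ g₂ x‖ ^ 2 := by
  have e : hyperGrad f₁ g₁ x - hyperGrad f₂ g₂ x
      = (gradX f₁ x (innerSol g₁ x) - gradX f₂ x (innerSol g₂ x))
        - (jacXT g₁ x (innerSol g₁ x) - jacXT g₂ x (innerSol g₂ x)) (vStar f₂ g₂ x)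
        - jacXT g₁ x (innerSol g₁ x) (vStar f₁ g₁ x - vStar f₂ g₂ x) := by
    simp only [hyperGrad, sub_apply, map_sub]; abel
  have h2 : ‖(jacXT g₁ x (innerSol g₁ x) - jacXT g₂ x (innerSol g₂ x)) (vStar f₂ g₂ x)‖
      ≤ ‖jacXT g₁ x (innerSol g₁ x) - jacXT g₂ x (innerSol g₂ x)‖ * Mv c μ :=
    ContinuousLinearMap.le_of_opNorm_le_of_le _ le_rfl (norm_vStar_le hf₂ hg₂ hμ x)
  have h3 : ‖jacXT g₁ x (innerSol g₁ x) (vStar f₁ g₁ x - vStar f₂ g₂ x)‖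
      ≤ c.Cgxt * ‖vStar f₁ g₁ x - vStar f₂ g₂ x‖ :=
    ContinuousLinearMap.le_of_opNorm_le _ (hg₁.bound_jacXT _ _) _
  set A := ‖gradX f₁ x (innerSol g₁ x) - gradX f₂ x (innerSol g₂ x)‖
  set B := ‖jacXT g₁ x (innerSol g₁ x) - jacXT g₂ x (innerSol g₂ x)‖ * Mv c μ
  set D := c.Cgxt * ‖vStar f₁ g₁ x - vStar f₂ g₂ x‖
  have h4 : ‖hyperGrad f₁ g₁ x - hyperGrad f₂ g₂ x‖ ≤ A + B + D := by
    rw [e]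
    exact (norm_sub_le _ _).trans (add_le_add ((norm_sub_le _ _).trans (add_le_add le_rfl h2)) h3)
  have h5 := pow_le_pow_left₀ (norm_nonneg _) h4 2
  have hB : 3 * Mv c μ ^ 2 * ‖jacXT g₁ x (innerSol g₁ x) - jacXT g₂ x (innerSol g₂ x)‖ ^ 2
      = 3 * B ^ 2 := by ring
  have hD : 3 * c.Cgxt ^ 2 * ‖vStar f₁ g₁ x - vStar f₂ g₂ x‖ ^ 2 = 3 * D ^ 2 := by ring
  rw [hB, hD]
  nlinarith [sq_nonneg (A - B), sq_nonneg (A - D), sq_nonneg (B - D)]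

theorem norm_add_sq_le_two {E : Type*} [NormedAddCommGroup E] (a b : E) :
    ‖a + b‖ ^ 2 ≤ 2 * ‖a‖ ^ 2 + 2 * ‖b‖ ^ 2 := by
  have := pow_le_pow_left₀ (norm_nonneg _) (norm_add_le a b) 2
  nlinarith [sq_nonneg (‖a‖ - ‖b‖)]

theorem JointLip.norm_sub_sq_le_right {E : Type*} [NormedAddCommGroup E] {K : ℝ}
    {F : Vec n → Vec p → E} (hF : JointLip K F) (x : Vec n) (θ θ' : Vec p) :
    ‖F x θ - F x θ'‖ ^ 2 ≤ K ^ 2 * ‖θ - θ'‖ ^ 2 := by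
  simpa using hF.le x x θ θ'

/-- Strong monotonicity of node `i` between the two inner solutions: its gradient vanishes at its
own solution, and that of node `j` vanishes at the other, so only the assumed gradient discrepancy
remains. -/
theorem pairAvg_innerSol_le (hg : ∀ i, InnerAssumption c μ (g i))
    (hh : Heterogeneity bf bg f g) (hμ : 0 < μ) (x : Vec n) :
    pairAvg (fun i j => ‖innerSol (g i) x - innerSol (g j) x‖ ^ 2) ≤ bg ^ 2 / μ ^ 2 := by
  rw [le_div_iff₀ (by positivity), mul_comm, ← pairAvg_mul]
  refine le_trans (pairAvg_mono fun i j => ?_) (hh.gradT_g x)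
  have h := (hg i).mul_norm_sub_le x (innerSol (g i) x) (innerSol (g j) x)
  rw [(hg i).gradT_innerSol hμ, zero_sub, norm_neg] at h
  rw [(hg j).gradT_innerSol hμ, sub_zero, ← mul_pow]
  gcongr

/-- Each difference passes through `F i` at the solution of node `j`, the only kind of point at
which the nodes are compared by assumption. -/
theorem pairAvg_curvature_le {E : Type*} [NormedAddCommGroup E] {K : ℝ}
    {F : Fin m → Vec n → Vec p → E} (hF : ∀ i, JointLip K (F i))
    (hg : ∀ i, InnerAssumption c μ (g i)) (hh : Heterogeneity bf bg f g) (hμ : 0 < μ) (x : Vec n)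
    (hF' : pairAvg (fun i j => ‖F i x (innerSol (g j) x) - F j x (innerSol (g j) x)‖ ^ 2)
      ≤ bg ^ 2) :
    pairAvg (fun i j => ‖F i x (innerSol (g i) x) - F j x (innerSol (g j) x)‖ ^ 2)
      ≤ 2 * K ^ 2 * (bg ^ 2 / μ ^ 2) + 2 * bg ^ 2 := by
  calc _ ≤ pairAvg (fun i j => 2 * K ^ 2 * ‖innerSol (g i) x - innerSol (g j) x‖ ^ 2
        + 2 * ‖F i x (innerSol (g j) x) - F j x (innerSol (g j) x)‖ ^ 2) := by
        refine pairAvg_mono fun i j => ?_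
        have h1 := norm_add_sq_le_two (F i x (innerSol (g i) x) - F i x (innerSol (g j) x))
          (F i x (innerSol (g j) x) - F j x (innerSol (g j) x))
        rw [sub_add_sub_cancel] at h1
        linarith [(hF i).norm_sub_sq_le_right x (innerSol (g i) x) (innerSol (g j) x)]
    _ ≤ _ := by
        rw [pairAvg_add, pairAvg_mul, pairAvg_mul]
        gcongr
        exact pairAvg_innerSol_le hg hh hμ x

theorem pairAvg_gradient_le {d : ℕ} {K : ℝ} (hm : 0 < m)
    {F : Fin m → Vec n → Vec p → Vec d} (hF : ∀ i, JointLip K (F i))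
    (hg : ∀ i, InnerAssumption c μ (g i)) (hh : Heterogeneity bf bg f g) (hμ : 0 < μ) (x : Vec n)
    (hF' : ∀ θ, ∑ i, ‖F i x θ - vmean (fun j => F j x θ)‖ ^ 2 ≤ bf ^ 2) :
    pairAvg (fun i j => ‖F i x (innerSol (g i) x) - F j x (innerSol (g j) x)‖ ^ 2)
      ≤ 2 * K ^ 2 * (bg ^ 2 / μ ^ 2) + 4 * bf ^ 2 := by
  -- For `f` the heterogeneity is assumed at a common `θ`; the mean of the inner solutions minimizes
  -- the cost of moving there.
  set θb := vmean fun i => innerSol (g i) x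
  have h1 := pairAvg_norm_sub_sq hm fun i => innerSol (g i) x
  have h2 := pairAvg_innerSol_le hg hh hμ x
  rw [h1] at h2
  rw [pairAvg_norm_sub_sq hm fun i => F i x (innerSol (g i) x)]
  have h3 := sum_norm_sub_vmean_le hm (fun i => F i x (innerSol (g i) x))
    (vmean (fun j => F j x θb))
  have h4 : ∑ i, ‖F i x (innerSol (g i) x) - vmean (fun j => F j x θb)‖ ^ 2
      ≤ ∑ i, (2 * K ^ 2 * ‖innerSol (g i) x - θb‖ ^ 2
        + 2 * ‖F i x θb - vmean (fun j => F j x θb)‖ ^ 2) := by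
    refine Finset.sum_le_sum fun i _ => ?_
    have h1 := norm_add_sq_le_two (F i x (innerSol (g i) x) - F i x θb)
      (F i x θb - vmean (fun j => F j x θb))
    rw [sub_add_sub_cancel] at h1
    linarith [(hF i).norm_sub_sq_le_right x (innerSol (g i) x) θb]
  rw [Finset.sum_add_distrib, ← Finset.mul_sum, ← Finset.mul_sum] at h4
  have h5 := hF' θb
  have h6 := mul_le_mul_of_nonneg_left h2 (sq_nonneg K)
  linarith

theorem hyperGrad_heterogeneity (hm : 0 < m) (hf : ∀ i, OuterAssumption c (f i) (g i))
    (hg : ∀ i, InnerAssumption c μ (g i)) (hh : Heterogeneity bf bg f g) (hμ : 0 < μ) (x : Vec n) :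
    ∑ i, ‖hyperGrad (f i) (g i) x - vmean (fun j => hyperGrad (f j) (g j) x)‖ ^ 2
      ≤ 3 * bSq c μ bf bg := by
  have hx := pairAvg_gradient_le hm (fun i => (hf i).lip_gradX) hg hh hμ x (hh.gradX_f x)
  have ht := pairAvg_gradient_le hm (fun i => (hf i).lip_gradT) hg hh hμ x (hh.gradT_f x)
  have hJ := pairAvg_curvature_le (fun i => (hg i).lip_jacXT) hg hh hμ x (hh.jacXT_g x)
  have hH := pairAvg_curvature_le (fun i => (hg i).lip_hessTT) hg hh hμ x (hh.hessTT_g x)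
  have h1 := pairAvg_mono fun i j =>
    norm_hyperGrad_sub_sq_le_of_nodes (f₁ := f i) (hg i) (hf j) (hg j) hμ x
  have hv := pairAvg_mono fun i j =>
    norm_vStar_sub_sq_le_of_nodes (f₁ := f i) (hg i) (hf j) (hg j) hμ x
  rw [pairAvg_norm_sub_sq hm (fun i => hyperGrad (f i) (g i) x), pairAvg_add, pairAvg_add,
    pairAvg_mul, pairAvg_mul, pairAvg_mul] at h1
  rw [pairAvg_mul, pairAvg_add, pairAvg_mul] at hv
  have hM : 0 ≤ Mv c μ ^ 2 := sq_nonneg _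
  have hv' := hv.trans (mul_le_mul_of_nonneg_left
    (add_le_add ht (mul_le_mul_of_nonneg_left hH hM)) (by positivity))
  have h2 := h1.trans (add_le_add (add_le_add (mul_le_mul_of_nonneg_left hx (by norm_num))
    (mul_le_mul_of_nonneg_left hJ (by positivity)))
    (mul_le_mul_of_nonneg_left hv' (by positivity)))
  refine le_of_mul_le_mul_left (h2.trans ?_) two_pos
  rw [← sub_nonneg]
  -- The slack is written out as an explicit sum of nonnegative terms.
  have : 2 * (3 * bSq c μ bf bg) -
      (3 * (2 * c.Lfx ^ 2 * (bg ^ 2 / μ ^ 2) + 4 * bf ^ 2) +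
        3 * Mv c μ ^ 2 * (2 * c.Lgxt ^ 2 * (bg ^ 2 / μ ^ 2) + 2 * bg ^ 2) +
      3 * c.Cgxt ^ 2 * (2 / μ ^ 2 * (2 * c.Lft ^ 2 * (bg ^ 2 / μ ^ 2) + 4 * bf ^ 2 +
            Mv c μ ^ 2 * (2 * c.Lgtt ^ 2 * (bg ^ 2 / μ ^ 2) + 2 * bg ^ 2))))
      = 12 * bf ^ 2 + 18 * (c.Lfx ^ 2 * bg ^ 2 / μ ^ 2)
        + 90 * (c.Cft ^ 2 * c.Lgxt ^ 2 * bg ^ 2 / μ ^ 4)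
        + 90 * (c.Cft ^ 2 * bg ^ 2 / μ ^ 2)
        + 12 * (c.Lft ^ 2 * c.Cgxt ^ 2 * bg ^ 2 / μ ^ 4)
        + 84 * (c.Cft ^ 2 * c.Cgxt ^ 2 * c.Lgtt ^ 2 * bg ^ 2 / μ ^ 6)
        + 84 * (c.Cft ^ 2 * c.Cgxt ^ 2 * bg ^ 2 / μ ^ 4) := by
    unfold bSq Mv
    field_simp
    ring
  rw [this]
  positivity

end HyperHeterogeneity

/-! ### Means and variances of random vectors -/

section MeanVariance

open scoped RealInnerProductSpace

/-- `Y` is square integrable with mean `y` and `𝔼‖Y - y‖² ≤ V`. -/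
structure MeanVar {Ω E : Type*} [MeasurableSpace Ω] [NormedAddCommGroup E] [NormedSpace ℝ E]
    (P : Measure Ω) (Y : Ω → E) (y : E) (V : ℝ) : Prop where
  memLp : MemLp Y 2 P
  mean : ∫ ω, Y ω ∂P = y
  var : ∫ ω, ‖Y ω - y‖ ^ 2 ∂P ≤ V

variable {Ω E F : Type*} [MeasurableSpace Ω] [NormedAddCommGroup E] [NormedAddCommGroup F]
  {P : Measure Ω}

theorem UnbiasedVar.meanVar [NormedSpace ℝ E] {Y : Ω → E} {y : E} {σ : ℝ}
    (h : UnbiasedVar P Y y σ) : MeanVar P Y y (σ ^ 2) :=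
  ⟨h.memLp, h.mean, h.var⟩

variable [IsProbabilityMeasure P]

namespace MeanVar

theorem integrable [NormedSpace ℝ E] {Y : Ω → E} {y : E} {V : ℝ} (h : MeanVar P Y y V) :
    Integrable Y P := h.memLp.integrable (by norm_num)

theorem memLp_sub [NormedSpace ℝ E] {Y : Ω → E} {y : E} {V : ℝ} (h : MeanVar P Y y V) :
    MemLp (fun ω => Y ω - y) 2 P := h.memLp.sub (memLp_const y)

theorem integrable_sq [NormedSpace ℝ E] {Y : Ω → E} {y : E} {V : ℝ} (h : MeanVar P Y y V) :
    Integrable (fun ω => ‖Y ω - y‖ ^ 2) P := h.memLp_sub.integrable_norm_pow (by norm_num)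

theorem integral_sub_eq_zero [NormedSpace ℝ E] [CompleteSpace E] {Y : Ω → E} {y : E} {V : ℝ}
    (h : MeanVar P Y y V) : ∫ ω, (Y ω - y) ∂P = 0 := by
  rw [integral_sub h.integrable (integrable_const y), h.mean]
  simp

/-- The factor 2 avoids any use of independence between the two estimators of a node. -/
theorem sub [NormedSpace ℝ E] {Y Z : Ω → E} {y z : E} {V W : ℝ} (hY : MeanVar P Y y V)
    (hZ : MeanVar P Z z W) : MeanVar P (fun ω => Y ω - Z ω) (y - z) (2 * V + 2 * W) where
  memLp := hY.memLp.sub hZ.memLp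
  mean := by rw [integral_sub hY.integrable hZ.integrable, hY.mean, hZ.mean]
  var := by
    have h1 : ∫ ω, ‖Y ω - Z ω - (y - z)‖ ^ 2 ∂P
        ≤ ∫ ω, (2 * ‖Y ω - y‖ ^ 2 + 2 * ‖Z ω - z‖ ^ 2) ∂P := by
      refine integral_mono_of_nonneg (.of_forall fun ω => by positivity)
        ((hY.integrable_sq.const_mul 2).add (hZ.integrable_sq.const_mul 2)) (.of_forall fun ω => ?_)
      have := norm_add_sq_le_two (Y ω - y) (-(Z ω - z))
      rw [norm_neg] at this
      change ‖Y ω - Z ω - (y - z)‖ ^ 2 ≤ _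
      rwa [show Y ω - Z ω - (y - z) = Y ω - y + -(Z ω - z) by abel]
    rw [integral_add (hY.integrable_sq.const_mul 2) (hZ.integrable_sq.const_mul 2),
      integral_const_mul, integral_const_mul] at h1
    linarith [hY.var, hZ.var]

theorem clm_apply [NormedSpace ℝ E] [NormedSpace ℝ F] [CompleteSpace F] {Y : Ω → E →L[ℝ] F}
    {y : E →L[ℝ] F} {V : ℝ} (hY : MeanVar P Y y V) (v : E) :
    MeanVar P (fun ω => Y ω v) (y v) (V * ‖v‖ ^ 2) where
  memLp := hY.memLp.continuousLinearMap_comp (ContinuousLinearMap.apply ℝ F v)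
  mean := by rw [← hY.mean, ContinuousLinearMap.integral_apply hY.integrable]
  var := by
    have h1 : ∫ ω, ‖Y ω v - y v‖ ^ 2 ∂P ≤ ∫ ω, ‖Y ω - y‖ ^ 2 * ‖v‖ ^ 2 ∂P := by
      refine integral_mono_of_nonneg (.of_forall fun ω => by positivity)
        (hY.integrable_sq.mul_const _) (.of_forall fun ω => ?_)
      simp only [← sub_apply, ← mul_pow]
      gcongr
      exact ContinuousLinearMap.le_opNorm _ _
    rw [integral_mul_const] at h1
    exact h1.trans (mul_le_mul_of_nonneg_right hY.var (by positivity))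

variable [InnerProductSpace ℝ E]

theorem integrable_norm_sub_smul_sq {Y : Ω → E} {y : E} {V : ℝ} (hY : MeanVar P Y y V) (a : E)
    (t : ℝ) : Integrable (fun ω => ‖a - t • Y ω‖ ^ 2) P :=
  ((memLp_const a).sub (hY.memLp.const_smul t)).integrable_norm_pow (by norm_num)

/-- Unbiasedness kills the cross term, so the noise only adds `t²` times the variance to the
deterministic step. -/
theorem integral_norm_sub_smul_sq_le [CompleteSpace E] {Y : Ω → E} {y : E} {V : ℝ}
    (hY : MeanVar P Y y V) (a : E) (t : ℝ) :
    ∫ ω, ‖a - t • Y ω‖ ^ 2 ∂P ≤ ‖a - t • y‖ ^ 2 + t ^ 2 * V := by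
  have h : ∀ ω, ‖a - t • Y ω‖ ^ 2
      = ‖a - t • y‖ ^ 2 - 2 * t * ⟪a - t • y, Y ω - y⟫ + t ^ 2 * ‖Y ω - y‖ ^ 2 := fun ω => by
    rw [show a - t • Y ω = (a - t • y) - t • (Y ω - y) by rw [smul_sub]; abel, norm_sub_sq_real,
      real_inner_smul_right, norm_smul, mul_pow, Real.norm_eq_abs, sq_abs]
    ring
  have hs : Integrable (fun ω => Y ω - y) P := hY.integrable.sub (integrable_const y)
  have hi : Integrable (fun ω => ⟪a - t • y, Y ω - y⟫) P := hs.const_inner _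
  simp only [h]
  have hc : Integrable (fun _ : Ω => ‖a - t • y‖ ^ 2) P := integrable_const _
  have hi' : Integrable (fun ω => ‖a - t • y‖ ^ 2 - 2 * t * ⟪a - t • y, Y ω - y⟫) P :=
    hc.sub (hi.const_mul _)
  rw [integral_add hi' (hY.integrable_sq.const_mul _),
    integral_sub hc (hi.const_mul _), integral_const_mul, integral_const_mul,
    integral_inner hs, hY.integral_sub_eq_zero]
  have := mul_le_mul_of_nonneg_left hY.var (sq_nonneg t)
  simpa using this

/-- Off-diagonal covariances vanish, leaving the diagonal divided by `m²`: this is the source of the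
factor `1/√m` on `σ_c`. -/
theorem vmean_of_indep [CompleteSpace E] {m : ℕ} [MeasurableSpace E] [BorelSpace E]
    {Y : Fin m → Ω → E} {y : Fin m → E} {V : Fin m → ℝ} (hY : ∀ i, MeanVar P (Y i) (y i) (V i))
    (hind : Pairwise fun i j => IndepFun (Y i) (Y j) P) :
    MeanVar P (fun ω => vmean fun i => Y i ω) (vmean y) ((1 / (m : ℝ)) * avg V) where
  memLp := (memLp_finsetSum _ fun i _ => (hY i).memLp).const_smul _
  mean := by
    simp only [vmean]
    rw [integral_smul, integral_finsetSum _ fun i _ => (hY i).integrable]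
    simp only [(hY _).mean]
  var := by
    have hd : ∀ ω, ‖(vmean fun i => Y i ω) - vmean y‖ ^ 2
        = (1 / (m : ℝ)) ^ 2 * ∑ i, ∑ j, ⟪Y i ω - y i, Y j ω - y j⟫ := fun ω => by
      rw [← vmean_sub, vmean, norm_smul, mul_pow, Real.norm_eq_abs, sq_abs,
        ← real_inner_self_eq_norm_sq, sum_inner]
      simp only [inner_sum]
    have hint : ∀ i j, Integrable (fun ω => ⟪Y i ω - y i, Y j ω - y j⟫) P ∧
        ∫ ω, ⟪Y i ω - y i, Y j ω - y j⟫ ∂P ≤ if i = j then V i else 0 := fun i j => by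
      by_cases hij : i = j
      · subst hij
        simp only [real_inner_self_eq_norm_sq, if_true]
        exact ⟨(hY i).integrable_sq, (hY i).var⟩
      · have h1 : IndepFun (fun ω => Y i ω - y i) (fun ω => Y j ω - y j) P :=
          (hind hij).comp (φ := fun e => e - y i) (ψ := fun e => e - y j)
            (by fun_prop) (by fun_prop)
        have hi : Integrable (fun ω => Y i ω - y i) P :=
          (hY i).integrable.sub (integrable_const _)
        have hj : Integrable (fun ω => Y j ω - y j) P :=
          (hY j).integrable.sub (integrable_const _)
        refine ⟨h1.integrable_bilin hi hj (innerSL ℝ), ?_⟩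
        rw [if_neg hij]
        have := h1.integral_bilin hi hj (innerSL ℝ)
        rw [(hY i).integral_sub_eq_zero, map_zero, zero_apply] at this
        exact this.le
    simp only [hd]
    rw [integral_const_mul, integral_finsetSum _ fun i _ => integrable_finsetSum _ fun j _ =>
      (hint i j).1]
    have h2 : ∑ i, ∫ ω, ∑ j, ⟪Y i ω - y i, Y j ω - y j⟫ ∂P ≤ ∑ i, V i := by
      refine Finset.sum_le_sum fun i _ => ?_
      rw [integral_finsetSum _ fun j _ => (hint i j).1]
      refine (Finset.sum_le_sum fun j _ => (hint i j).2).trans ?_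
      simp
    calc _ ≤ (1 / (m : ℝ)) ^ 2 * ∑ i, V i := by gcongr
      _ = _ := by rw [avg]; ring

end MeanVar

end MeanVariance

/-! ### The stochastic directions at a fixed state -/

section Directions

variable {m n p : ℕ} {Ω S : Type*} [MeasurableSpace Ω] [MeasurableSpace S]
  {P : Measure Ω} {f g : Fin m → Vec n → Vec p → ℝ}
  {O : Oracle m n p S} {σ : Noise} {ζ : Channel → Fin m → ℕ → Ω → S}

theorem meanVar_dirD [IsProbabilityMeasure P] (h : StochasticAssumption P f g O σ ζ)
    (s : State m n p) (i : Fin m) (k : ℕ) :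
    MeanVar P (fun ω => dirD O (fun a i => ζ a i k ω) s i) (gradT (g i) (s.x i) (s.θ i))
      (σ.gt ^ 2) :=
  (h.gt i k (s.x i) (s.θ i)).meanVar

theorem meanVar_dirH [IsProbabilityMeasure P] (h : StochasticAssumption P f g O σ ζ)
    (s : State m n p) (i : Fin m) (k : ℕ) :
    MeanVar P (fun ω => dirH O (fun a i => ζ a i k ω) s i)
      (hessTT (g i) (s.x i) (s.θ i) (s.v i) - gradT (f i) (s.x i) (s.θ i))
      (2 * (σ.gtt ^ 2 * ‖s.v i‖ ^ 2) + 2 * σ.ft ^ 2) :=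
  ((h.gtt i k (s.x i) (s.θ i)).meanVar.clm_apply (s.v i)).sub (h.ft i k (s.x i) (s.θ i)).meanVar

theorem meanVar_dirS [IsProbabilityMeasure P] (h : StochasticAssumption P f g O σ ζ)
    (s : State m n p) (i : Fin m) (k : ℕ) :
    MeanVar P (fun ω => dirS O (fun a i => ζ a i k ω) s i)
      (gradX (f i) (s.x i) (s.θ i) - jacXT (g i) (s.x i) (s.θ i) (s.v i))
      (2 * σ.fx ^ 2 + 2 * (σ.gxt ^ 2 * ‖s.v i‖ ^ 2)) :=
  (h.fx i k (s.x i) (s.θ i)).meanVar.sub ((h.gxt i k (s.x i) (s.θ i)).meanVar.clm_apply (s.v i))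

theorem indepFun_dirS (h : StochasticAssumption P f g O σ ζ) (s : State m n p) (k : ℕ) :
    Pairwise fun i j => IndepFun (fun ω => dirS O (fun a i => ζ a i k ω) s i)
      (fun ω => dirS O (fun a i => ζ a i k ω) s j) P := by
  intro i j hij
  have hm : ∀ i, Measurable fun q : S × S =>
      O.fx i (s.x i) (s.θ i) q.1 - O.gxt i (s.x i) (s.θ i) q.2 (s.v i) := fun i => by
    refine Measurable.sub ?_ (Measurable.apply_continuousLinearMap ?_ _)
    · exact (h.meas_fx i).comp (g := O.fx i |> fun F (q : Vec n × Vec p × S) => F q.1 q.2.1 q.2.2)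
        (f := fun q : S × S => (s.x i, s.θ i, q.1)) (by fun_prop)
    · exact (h.meas_gxt i).comp (g := O.gxt i |> fun F (q : Vec n × Vec p × S) => F q.1 q.2.1 q.2.2)
        (f := fun q : S × S => (s.x i, s.θ i, q.2)) (by fun_prop)
  have := h.indep.indepFun_prodMk_prodMk (fun q => h.meas_sample _ _ _)
    (.fx, i, k) (.gxt, i, k) (.fx, j, k) (.gxt, j, k) (by simp [hij]) (by simp) (by simp)
    (by simp [hij])
  exact this.comp (hm i) (hm j)

end Directions

/-! ### One-step bounds at a node -/

section NodeStep

open scoped RealInnerProductSpace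

/-- With `‖w₁ + w₂‖ = a q`, the norm is at most the convex combination `(1 - a) D + a q`, and the
square is convex. All the node-wise error recursions come from this inequality. -/
theorem norm_add_sq_le_of_contract {E : Type*} [NormedAddCommGroup E] {a D : ℝ} (ha : 0 < a)
    (ha1 : a ≤ 1) {e : E} (he : ‖e‖ ≤ (1 - a) * D) (w₁ w₂ : E) :
    ‖e + (w₁ + w₂)‖ ^ 2 ≤ (1 - a) * D ^ 2 + 2 / a * ‖w₁‖ ^ 2 + 2 / a * ‖w₂‖ ^ 2 := by
  have hw := norm_add_sq_le_two w₁ w₂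
  obtain ⟨q, hq⟩ : ∃ q, ‖w₁ + w₂‖ = a * q := ⟨‖w₁ + w₂‖ / a, by field_simp⟩
  have h1 : ‖e + (w₁ + w₂)‖ ≤ (1 - a) * D + a * q :=
    (norm_add_le _ _).trans (add_le_add he hq.le)
  have h2 := pow_le_pow_left₀ (norm_nonneg _) h1 2
  have h3 : ((1 - a) * D + a * q) ^ 2 ≤ (1 - a) * D ^ 2 + a * q ^ 2 := by
    nlinarith [mul_nonneg (mul_nonneg ha.le (sub_nonneg.2 ha1)) (sq_nonneg (D - q))]
  have h4 : a * q ^ 2 ≤ 2 / a * ‖w₁‖ ^ 2 + 2 / a * ‖w₂‖ ^ 2 := by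
    rw [hq] at hw
    have : a * q ^ 2 = 1 / a * (a * q) ^ 2 := by field_simp
    rw [this]
    calc 1 / a * (a * q) ^ 2 ≤ 1 / a * (2 * ‖w₁‖ ^ 2 + 2 * ‖w₂‖ ^ 2) := by gcongr
      _ = _ := by ring
  linarith

variable {n p : ℕ} {c : ClassConst} {μ : ℝ} {f g : Vec n → Vec p → ℝ}

theorem LthetaStar_pos (hc : c.Pos) (hμ : 0 < μ) : 0 < LthetaStar c μ := div_pos hc.Cgxt hμ

theorem LvStar_pos (hc : c.Pos) (hμ : 0 < μ) : 0 < LvStar c μ := by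
  have := Lv_pos hc hμ; have := LthetaStar_pos hc hμ
  unfold LvStar; positivity

theorem Lhyper_pos (hc : c.Pos) (hμ : 0 < μ) : 0 < Lhyper c μ := by
  have := Lv_pos hc hμ; have := LthetaStar_pos hc hμ; have := hc.Lfx; have := hc.Cgxt
  have := hc.Cft; have := hc.Lgxt
  unfold Lhyper; positivity

theorem omegaT_pos (hc : c.Pos) (hμ : 0 < μ) : 0 < omegaT c μ := by
  have := hc.Lgt
  unfold omegaT; positivity

/-- The mean step is `1 - λH` applied to the error, which contracts, plus two perturbations: the
residual of the linear system at the current `(x, θ)` and the move of the target from `vStar f g xb`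
to `vStar f g xb'`. -/
theorem node_step_v (hc : c.Pos) (hf : OuterAssumption c f g) (hg : InnerAssumption c μ g)
    (hμ : 0 < μ) (hμL : μ ≤ c.Lgt) {lam : ℝ} (hl : 0 < lam) (hl' : lam * c.Lgt ≤ 1)
    (xb xb' x : Vec n) (θ v : Vec p) :
    ‖v - vStar f g xb' - lam • (hessTT g x θ v - gradT f x θ)‖ ^ 2
      ≤ (1 - lam * μ) * ‖v - vStar f g xb‖ ^ 2
        + 2 * lam / μ * Lfgt c μ * (‖x - xb‖ ^ 2 + ‖θ - innerSol g xb‖ ^ 2)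
        + 2 / (lam * μ) * LvStar c μ ^ 2 * ‖xb' - xb‖ ^ 2 := by
  have ha1 : lam * μ ≤ 1 := (mul_le_mul_of_nonneg_left hμL hl.le).trans hl'
  have he : ‖((1 : Vec p →L[ℝ] Vec p) - lam • hessTT g x θ) (v - vStar f g xb)‖
      ≤ (1 - lam * μ) * ‖v - vStar f g xb‖ :=
    ContinuousLinearMap.le_of_opNorm_le _ (norm_one_sub_smul_le
      (hessTT_isSymmetric hg.contDiff x θ) (hg.hessTT_inner_ge x θ)
      (hg.norm_hessTT_le hc.Lgt.le x θ) hl.le (by linarith) le_rfl (by linarith)) _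
  have h := norm_add_sq_le_of_contract (mul_pos hl hμ) ha1 he
    (-(lam • (hessTT g x θ (vStar f g xb) - gradT f x θ))) (vStar f g xb - vStar f g xb')
  have e : ((1 : Vec p →L[ℝ] Vec p) - lam • hessTT g x θ) (v - vStar f g xb)
      + (-(lam • (hessTT g x θ (vStar f g xb) - gradT f x θ)) + (vStar f g xb - vStar f g xb'))
      = v - vStar f g xb' - lam • (hessTT g x θ v - gradT f x θ) := by
    simp only [sub_apply, one_apply_eq_self, smul_apply, map_sub, smul_sub]
    abel
  rw [e] at h
  refine h.trans (add_le_add (add_le_add le_rfl ?_) ?_)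
  · rw [norm_neg, norm_smul, mul_pow, Real.norm_eq_abs, sq_abs]
    calc 2 / (lam * μ) * (lam ^ 2 * ‖hessTT g x θ (vStar f g xb) - gradT f x θ‖ ^ 2)
        = 2 * lam / μ * ‖hessTT g x θ (vStar f g xb) - gradT f x θ‖ ^ 2 := by field_simp
      _ ≤ 2 * lam / μ * (Lfgt c μ * (‖x - xb‖ ^ 2 + ‖θ - innerSol g xb‖ ^ 2)) := by
          gcongr
          exact norm_hessTT_vStar_sub_sq_le hf hg hμ xb x θ
      _ = _ := by ring
  · rw [mul_assoc, ← mul_pow, norm_sub_rev xb']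
    gcongr
    exact vStar_lip hc hf hg hμ xb xb'

/-- The gradient step is compared with the one taken at `xb`, which contracts towards the inner
solution there; the perturbations are the disagreement `x - xb` and the move of the inner solution.
-/
theorem node_step_t (hc : c.Pos) (hg : InnerAssumption c μ g)
    (hμ : 0 < μ) {β : ℝ} (hβ : 0 < β) (hβ' : β ≤ betMax c μ)
    (xb xb' x : Vec n) (θ : Vec p) :
    ‖θ - innerSol g xb' - β • gradT g x θ‖ ^ 2
      ≤ (1 - 2 * β * omegaT c μ) * ‖θ - innerSol g xb‖ ^ 2
        + β / omegaT c μ * c.Cgxt ^ 2 * ‖x - xb‖ ^ 2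
        + 1 / (β * omegaT c μ) * LthetaStar c μ ^ 2 * ‖xb' - xb‖ ^ 2 := by
  have hω := omegaT_pos hc hμ
  have hL := hc.Lgt
  have ha1 : 2 * β * omegaT c μ ≤ 1 := by
    have h1 : β * (2 * μ * c.Lgt) ≤ μ + c.Lgt := by
      rw [← le_div_iff₀ (by positivity)]; exact hβ'.trans (min_le_right _ _)
    have h2 : 2 * β * omegaT c μ = β * (μ * c.Lgt) / (μ + c.Lgt) := by
      unfold omegaT; field_simp
    rw [h2, div_le_one (by positivity)]
    have : 0 < β * (μ * c.Lgt) := by positivity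
    linarith
  have he := hg.gradStep_lip hc.Lgt hμ hβ.le hβ' xb θ (innerSol g xb)
  rw [hg.gradT_innerSol hμ, smul_zero, sub_zero] at he
  have h := norm_add_sq_le_of_contract (by positivity) ha1 he
    (-(β • (gradT g x θ - gradT g xb θ))) (innerSol g xb - innerSol g xb')
  have e : θ - β • gradT g xb θ - innerSol g xb
      + (-(β • (gradT g x θ - gradT g xb θ)) + (innerSol g xb - innerSol g xb'))
      = θ - innerSol g xb' - β • gradT g x θ := by
    rw [smul_sub]; abel
  rw [e] at h
  refine h.trans (add_le_add (add_le_add le_rfl ?_) ?_)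
  · rw [norm_neg, norm_smul, mul_pow, Real.norm_eq_abs, sq_abs]
    calc 2 / (2 * β * omegaT c μ) * (β ^ 2 * ‖gradT g x θ - gradT g xb θ‖ ^ 2)
        = β / omegaT c μ * ‖gradT g x θ - gradT g xb θ‖ ^ 2 := by field_simp
      _ ≤ β / omegaT c μ * (c.Cgxt * ‖x - xb‖) ^ 2 := by
          gcongr
          exact hg.gradT_lip_left x xb θ
      _ = _ := by ring
  · have : 2 / (2 * β * omegaT c μ) = 1 / (β * omegaT c μ) := by field_simp
    rw [this, mul_assoc (1 / (β * omegaT c μ)), ← mul_pow, norm_sub_rev xb']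
    gcongr
    exact hg.innerSol_lip hμ xb xb'

/-- One step of the momentum tracking `G xb` by `z`, when the mean direction is `s`. -/
theorem momentum_step {E : Type*} [NormedAddCommGroup E] [NormedSpace ℝ E] {γ : ℝ} (hγ : 0 < γ)
    (hγ' : γ ≤ 1) (G G' z s : E) :
    ‖G' - (1 - γ) • z - γ • s‖ ^ 2
      ≤ (1 - γ) * ‖G - z‖ ^ 2 + 2 * γ * ‖G - s‖ ^ 2 + 2 / γ * ‖G' - G‖ ^ 2 := by
  have he : ‖(1 - γ) • (G - z)‖ ≤ (1 - γ) * ‖G - z‖ := by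
    rw [norm_smul, Real.norm_of_nonneg (by linarith)]
  have h := norm_add_sq_le_of_contract hγ hγ' he (γ • (G - s)) (G' - G)
  have e : (1 - γ) • (G - z) + (γ • (G - s) + (G' - G)) = G' - (1 - γ) • z - γ • s := by
    simp only [smul_sub, sub_smul, one_smul]; abel
  rw [e, norm_smul, mul_pow, Real.norm_of_nonneg hγ.le] at h
  have : 2 / γ * (γ ^ 2 * ‖G - s‖ ^ 2) = 2 * γ * ‖G - s‖ ^ 2 := by field_simp
  linarith

end NodeStep

/-! ### Consensus -/

section Consensus

variable {m n : ℕ}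

/-- The mixing matrix acts on the nodes only, so the operator norm bound applies to each coordinate
in `Vec n` separately. -/
theorem sum_norm_sq_sum_smul_le (A : Matrix (Fin m) (Fin m) ℝ) (u : Fin m → Vec n) :
    ∑ i, ‖∑ j, A i j • u j‖ ^ 2
      ≤ ‖Matrix.toEuclideanCLM (n := Fin m) (𝕜 := ℝ) A‖ ^ 2 * ∑ i, ‖u i‖ ^ 2 := by
  have h : ∀ l : Fin n, ∑ i, (∑ j, A i j * u j l) ^ 2
      ≤ ‖Matrix.toEuclideanCLM (n := Fin m) (𝕜 := ℝ) A‖ ^ 2 * ∑ i, (u i l) ^ 2 := fun l => by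
    have h1 := ContinuousLinearMap.le_opNorm (Matrix.toEuclideanCLM (n := Fin m) (𝕜 := ℝ) A)
      (WithLp.toLp 2 fun j => u j l)
    have h2 := pow_le_pow_left₀ (norm_nonneg _) h1 2
    rw [mul_pow, EuclideanSpace.real_norm_sq_eq, EuclideanSpace.real_norm_sq_eq] at h2
    simpa [Matrix.mulVec, dotProduct] using h2
  simp only [EuclideanSpace.real_norm_sq_eq]
  rw [Finset.sum_comm, Finset.sum_comm (f := fun i l => (u i l) ^ 2), Finset.mul_sum]
  refine Finset.sum_le_sum fun l _ => ?_
  simpa using h l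

variable {G : SimpleGraph (Fin m)} {W : Matrix (Fin m) (Fin m) ℝ}

theorem NetworkAssumption.vmean_mix (hW : NetworkAssumption G W) (x : Fin m → Vec n) :
    vmean (fun i => ∑ j, W i j • x j) = vmean x := by
  simp only [vmean]
  rw [Finset.sum_comm]
  simp only [← Finset.sum_smul, sum_col_of_mem_doublyStochastic hW.doublyStochastic, one_smul]

theorem NetworkAssumption.avg_mix_le (hm : 0 < m) (hW : NetworkAssumption G W)
    (x : Fin m → Vec n) :
    avg (fun i => ‖∑ j, W i j • x j - vmean x‖ ^ 2)
      ≤ netRho W * avg fun i => ‖x i - vmean x‖ ^ 2 := by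
  have h : ∀ i, ∑ j, W i j • x j - vmean x
      = ∑ j, (W - Matrix.of fun _ _ => 1 / (m : ℝ) : Matrix (Fin m) (Fin m) ℝ) i j •
        (x j - vmean x) := fun i => by
    simp only [Matrix.sub_apply, Matrix.of_apply, sub_smul, Finset.sum_sub_distrib,
      ← Finset.smul_sum, smul_sub]
    have e : (1 / (m : ℝ)) • ∑ _j : Fin m, vmean x = vmean x := vmean_const hm _
    rw [← Finset.sum_smul, sum_row_of_mem_doublyStochastic hW.doublyStochastic, one_smul, e,
      sub_self, sub_zero]
    rfl
  have := sum_norm_sq_sum_smul_le (W - Matrix.of fun _ _ => 1 / (m : ℝ)) fun j => x j - vmean x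
  simp only [h]
  rw [← avg_mul, avg, avg, ← Finset.mul_sum]
  exact mul_le_mul_of_nonneg_left this (by positivity)

theorem netRho_nonneg (W : Matrix (Fin m) (Fin m) ℝ) : 0 ≤ netRho W := sq_nonneg _

/-- Convexity of the square in the relaxation `τ`, then Young's inequality with parameter `η` for `a
- q`. -/
theorem norm_convexComb_sq_le {E : Type*} [NormedAddCommGroup E] [NormedSpace ℝ E] {τ η : ℝ}
    (h0 : 0 ≤ τ) (h1 : τ ≤ 1) (hη : 0 < η) (u a q : E) :
    ‖(1 - τ) • u + τ • (a - q)‖ ^ 2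
      ≤ (1 - τ) * ‖u‖ ^ 2 + τ * ((1 + η) * ‖a‖ ^ 2 + (1 + 1 / η) * ‖q‖ ^ 2) := by
  have hb : ‖a - q‖ ^ 2 ≤ (1 + η) * ‖a‖ ^ 2 + (1 + 1 / η) * ‖q‖ ^ 2 := by
    have h2 := pow_le_pow_left₀ (norm_nonneg _) (norm_sub_le a q) 2
    obtain ⟨r, hr⟩ : ∃ r, ‖q‖ = η * r := ⟨‖q‖ / η, by field_simp⟩
    have h3 : (1 + 1 / η) * ‖q‖ ^ 2 = ‖q‖ ^ 2 + η * r ^ 2 := by rw [hr]; field_simp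
    rw [h3]
    rw [hr] at h2 ⊢
    nlinarith [mul_nonneg hη.le (sq_nonneg (‖a‖ - r))]
  have h2 : ‖(1 - τ) • u + τ • (a - q)‖ ≤ (1 - τ) * ‖u‖ + τ * ‖a - q‖ := by
    refine (norm_add_le _ _).trans_eq ?_
    rw [norm_smul, norm_smul, Real.norm_of_nonneg h0, Real.norm_of_nonneg (by linarith)]
  have h3 := pow_le_pow_left₀ (norm_nonneg _) h2 2
  nlinarith [mul_nonneg (mul_nonneg h0 (sub_nonneg.2 h1)) (sq_nonneg (‖u‖ - ‖a - q‖)),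
    mul_le_mul_of_nonneg_left hb h0]

theorem NetworkAssumption.consensus_step (hm : 0 < m) (hW : NetworkAssumption G W) {τ α : ℝ}
    (h0 : 0 ≤ τ) (h1 : τ ≤ 1) (x y : Fin m → Vec n) :
    avg (fun i => ‖(1 - τ) • x i + τ • (∑ j, W i j • x j - α • y i)
        - (vmean x - (τ * α) • vmean y)‖ ^ 2)
      ≤ (1 - τ * (1 - netRho W) / 2) * avg (fun i => ‖x i - vmean x‖ ^ 2)
        + 3 * τ * α ^ 2 / (1 - netRho W) * avg fun i => ‖y i - vmean y‖ ^ 2 := by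
  have hρ := hW.rho_lt_one
  have hρ0 := netRho_nonneg W
  set ρ := netRho W
  -- With `η = (1-ρ)/2`, `(1+η)ρ` stays below `(1+ρ)/2`, the slack being `(1-ρ)²/2`, and `1 + 1/η ≤
  -- 3/(1-ρ)`.
  have hη : 0 < (1 - ρ) / 2 := by linarith
  have h := avg_mono fun i => norm_convexComb_sq_le h0 h1 hη (x i - vmean x)
    (∑ j, W i j • x j - vmean x) (α • (y i - vmean y))
  have e : ∀ i, (1 - τ) • (x i - vmean x)
      + τ • ((∑ j, W i j • x j - vmean x) - α • (y i - vmean y))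
      = (1 - τ) • x i + τ • (∑ j, W i j • x j - α • y i) - (vmean x - (τ * α) • vmean y) := by
    intro i
    simp only [smul_sub, sub_smul, one_smul, mul_smul]
    abel
  simp only [e] at h
  rw [avg_add, avg_mul, avg_mul, avg_add, avg_mul, avg_mul] at h
  simp only [norm_smul, mul_pow] at h
  rw [avg_mul] at h
  simp only [Real.norm_eq_abs, sq_abs] at h
  have hmix := hW.avg_mix_le hm x
  set A := avg fun i => ‖∑ j, W i j • x j - vmean x‖ ^ 2
  set X := avg fun i => ‖x i - vmean x‖ ^ 2
  set Y := avg fun i => ‖y i - vmean y‖ ^ 2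
  have hX : 0 ≤ X := avg_nonneg fun i => by positivity
  have hY : 0 ≤ Y := avg_nonneg fun i => by positivity
  have hA : (1 + (1 - ρ) / 2) * A ≤ (1 + ρ) / 2 * X := by
    calc (1 + (1 - ρ) / 2) * A ≤ (1 + (1 - ρ) / 2) * (ρ * X) := by gcongr
      _ ≤ (1 + ρ) / 2 * X := by nlinarith [mul_nonneg (sq_nonneg (1 - ρ)) hX]
  have hYc : (1 + 1 / ((1 - ρ) / 2)) * (α ^ 2 * Y) ≤ 3 / (1 - ρ) * (α ^ 2 * Y) := by
    have : 1 + 1 / ((1 - ρ) / 2) ≤ 3 / (1 - ρ) := by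
      have h1ρ : 0 < 1 - ρ := by linarith
      rw [le_div_iff₀ h1ρ]
      field_simp
      linarith
    exact mul_le_mul_of_nonneg_right this (by positivity)
  have := mul_le_mul_of_nonneg_left (add_le_add hA hYc) h0
  calc _ ≤ _ := h
    _ ≤ (1 - τ) * X + τ * ((1 + ρ) / 2 * X + 3 / (1 - ρ) * (α ^ 2 * Y)) := by linarith
    _ = _ := by ring

end Consensus

/-! ### One-step bounds for the averaged errors -/

section Errors

variable {m n p : ℕ}

/-- The average error of the Hessian-inverse-vector variables. -/
def errV (f g : Fin m → Vec n → Vec p → ℝ) (s : State m n p) : ℝ :=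
  avg fun i => ‖s.v i - vStar (f i) (g i) (xBar s)‖ ^ 2

/-- The average error of the inner variables. -/
def errT (g : Fin m → Vec n → Vec p → ℝ) (s : State m n p) : ℝ :=
  avg fun i => ‖s.θ i - innerSol (g i) (xBar s)‖ ^ 2

/-- The average hypergradient of the nodes. -/
def meanGrad (f g : Fin m → Vec n → Vec p → ℝ) (x : Vec n) : Vec n :=
  vmean fun i => hyperGrad (f i) (g i) x

/-- The average tracking error of the local hypergradients. -/
def errZ (f g : Fin m → Vec n → Vec p → ℝ) (s : State m n p) : ℝ :=
  avg fun i => ‖hyperGrad (f i) (g i) (xBar s) - s.z i‖ ^ 2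

/-- The tracking error of the overall hypergradient. -/
def errZbar (f g : Fin m → Vec n → Vec p → ℝ) (s : State m n p) : ℝ :=
  ‖meanGrad f g (xBar s) - vmean s.z‖ ^ 2

/-- The consensus error. -/
def errX (s : State m n p) : ℝ := avg fun i => ‖s.x i - xBar s‖ ^ 2

theorem errV_nonneg (f g : Fin m → Vec n → Vec p → ℝ) (s : State m n p) : 0 ≤ errV f g s :=
  avg_nonneg fun _ => by positivity

theorem errT_nonneg (g : Fin m → Vec n → Vec p → ℝ) (s : State m n p) : 0 ≤ errT g s :=
  avg_nonneg fun _ => by positivity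

theorem errZ_nonneg (f g : Fin m → Vec n → Vec p → ℝ) (s : State m n p) : 0 ≤ errZ f g s :=
  avg_nonneg fun _ => by positivity

theorem errZbar_nonneg (f g : Fin m → Vec n → Vec p → ℝ) (s : State m n p) : 0 ≤ errZbar f g s :=
  sq_nonneg _

theorem errX_nonneg (s : State m n p) : 0 ≤ errX s := avg_nonneg fun _ => by positivity

variable {S : Type*} {c : ClassConst} {μ bf bg : ℝ} {f g : Fin m → Vec n → Vec p → ℝ}
  {G : SimpleGraph (Fin m)} {W : Matrix (Fin m) (Fin m) ℝ} {O : Oracle m n p S} {t : StepSizes}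

/-- Column sums equal to one make mixing invisible to the mean. The samples `ζ` do not occur on the
right, so the next targets are deterministic given the state. -/
theorem xBar_step (hW : NetworkAssumption G W) (ζ : Channel → Fin m → S) (s : State m n p) :
    xBar (step W O t ζ s) = xBar s - (t.τ * t.α) • vmean s.y := by
  change vmean (fun i => (1 - t.τ) • s.x i + t.τ • (∑ j, W i j • s.x j - t.α • s.y i)) = _
  rw [vmean_add, vmean_smul, vmean_smul, vmean_sub, vmean_smul, hW.vmean_mix]
  change _ = vmean s.x - _
  rw [smul_sub, sub_smul, one_smul, smul_smul]
  abel

theorem hasGradientAt_objective (hf : ∀ i, OuterAssumption c (f i) (g i))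
    (hg : ∀ i, InnerAssumption c μ (g i)) (hμ : 0 < μ) (x : Vec n) :
    HasGradientAt (objective f g) (meanGrad f g x) x := by
  rw [hasGradientAt_iff_hasFDerivAt]
  have h := (HasFDerivAt.fun_sum (u := Finset.univ) fun i _ =>
    (hasGradientAt_localObj (hf i) (hg i) hμ x).hasFDerivAt).const_mul (1 / (m : ℝ))
  refine h.congr_fderiv ?_
  simp [meanGrad, vmean]

theorem meanGrad_lip (hm : 0 < m) (hc : c.Pos) (hf : ∀ i, OuterAssumption c (f i) (g i))
    (hg : ∀ i, InnerAssumption c μ (g i)) (hμ : 0 < μ) (x x' : Vec n) :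
    ‖meanGrad f g x - meanGrad f g x'‖ ≤ Lhyper c μ * ‖x - x'‖ := by
  have hL := Lhyper_pos hc hμ
  have h1 := norm_vmean_sq_le hm fun i => hyperGrad (f i) (g i) x - hyperGrad (f i) (g i) x'
  have h2 := avg_mono fun i =>
    pow_le_pow_left₀ (norm_nonneg _) (hyperGrad_lip hc (hf i) (hg i) hμ x x') 2
  rw [avg_const hm] at h2
  rw [vmean_sub] at h1
  exact le_of_sq_le_sq (h1.trans h2) (by positivity)

/-- Polarization of the inner product in the descent lemma; half of the resulting `-r/2 ‖z‖²`
absorbs the curvature term, and the other half is kept to pay for the drift of the targets. -/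
theorem objective_step_le (hm : 0 < m) (hc : c.Pos) (hf : ∀ i, OuterAssumption c (f i) (g i))
    (hg : ∀ i, InnerAssumption c μ (g i)) (hμ : 0 < μ) {r : ℝ} (hr : 0 ≤ r)
    (hrL : r * Lhyper c μ ≤ 1 / 2) (x z : Vec n) :
    objective f g (x - r • z) ≤ objective f g x - r / 2 * ‖meanGrad f g x‖ ^ 2
      - r / 4 * ‖z‖ ^ 2 + r / 2 * ‖meanGrad f g x - z‖ ^ 2 := by
  have h := le_add_inner_of_lipschitz_gradient (hasGradientAt_objective hf hg hμ)
    (meanGrad_lip hm hc hf hg hμ) x (x - r • z)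
  rw [sub_sub_cancel_left, inner_neg_right, real_inner_smul_right, norm_neg, norm_smul, mul_pow,
    Real.norm_of_nonneg hr] at h
  rw [norm_sub_sq_real]
  nlinarith [mul_le_mul_of_nonneg_right hrL (mul_nonneg hr (sq_nonneg ‖z‖))]

theorem errX_step_le (hm : 0 < m) (hW : NetworkAssumption G W) (h0 : 0 ≤ t.τ) (h1 : t.τ ≤ 1)
    (ζ : Channel → Fin m → S) (s : State m n p) (hs : s.y = s.z) :
    errX (step W O t ζ s) ≤ (1 - t.τ * (1 - netRho W) / 2) * errX s
      + 3 * t.τ * t.α ^ 2 / (1 - netRho W) * avg fun i => ‖s.z i - vmean s.z‖ ^ 2 := by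
  unfold errX
  rw [xBar_step hW, ← hs]
  exact hW.consensus_step hm h0 h1 s.x s.y

/-- The `z i` spread out for two reasons: their tracking errors and the heterogeneity of the
hypergradients they track. The constant 6 is twice the factor 3 of `hyperGrad_heterogeneity`. -/
theorem avg_tracking_spread_le (hm : 0 < m) (hf : ∀ i, OuterAssumption c (f i) (g i))
    (hg : ∀ i, InnerAssumption c μ (g i)) (hh : Heterogeneity bf bg f g) (hμ : 0 < μ)
    (s : State m n p) :
    avg (fun i => ‖s.z i - vmean s.z‖ ^ 2) ≤ 2 * errZ f g s + 6 * (bSq c μ bf bg / m) := by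
  have h1 := sum_norm_sub_vmean_le hm s.z (meanGrad f g (xBar s))
  have h2 : ∑ i, ‖s.z i - meanGrad f g (xBar s)‖ ^ 2
      ≤ ∑ i, (2 * ‖hyperGrad (f i) (g i) (xBar s) - s.z i‖ ^ 2
        + 2 * ‖hyperGrad (f i) (g i) (xBar s) - meanGrad f g (xBar s)‖ ^ 2) :=
    Finset.sum_le_sum fun i _ => by
      have := norm_add_sq_le_two (s.z i - hyperGrad (f i) (g i) (xBar s))
        (hyperGrad (f i) (g i) (xBar s) - meanGrad f g (xBar s))
      rwa [sub_add_sub_cancel, norm_sub_rev (s.z i) (hyperGrad _ _ _)] at this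
  rw [Finset.sum_add_distrib, ← Finset.mul_sum, ← Finset.mul_sum] at h2
  have h3 := hyperGrad_heterogeneity hm hf hg hh hμ (xBar s)
  have h4 : ∑ i, ‖s.z i - vmean s.z‖ ^ 2 ≤ 2 * ∑ i, ‖hyperGrad (f i) (g i) (xBar s) - s.z i‖ ^ 2
      + 6 * bSq c μ bf bg := by
    unfold meanGrad at *
    linarith
  calc _ ≤ (1 / (m : ℝ)) * (2 * ∑ i, ‖hyperGrad (f i) (g i) (xBar s) - s.z i‖ ^ 2
      + 6 * bSq c μ bf bg) := mul_le_mul_of_nonneg_left h4 (by positivity)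
    _ = _ := by unfold errZ avg; ring

/-- The variance of the directions grows with `‖v‖²`, and `v` is not projected onto a ball; it is
controlled through its error and the bound `Mv` on the target. -/
theorem avg_norm_v_sq_le (hm : 0 < m) (hf : ∀ i, OuterAssumption c (f i) (g i))
    (hg : ∀ i, InnerAssumption c μ (g i)) (hμ : 0 < μ) (s : State m n p) :
    avg (fun i => ‖s.v i‖ ^ 2) ≤ 2 * errV f g s + 2 * Mv c μ ^ 2 := by
  have h : ∀ i, ‖s.v i‖ ^ 2 ≤ 2 * ‖s.v i - vStar (f i) (g i) (xBar s)‖ ^ 2 + 2 * Mv c μ ^ 2 := by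
    intro i
    have h1 := norm_add_sq_le_two (s.v i - vStar (f i) (g i) (xBar s))
      (vStar (f i) (g i) (xBar s))
    rw [sub_add_cancel] at h1
    have h2 := pow_le_pow_left₀ (norm_nonneg _) (norm_vStar_le (hf i) (hg i) hμ (xBar s)) 2
    linarith
  refine (avg_mono h).trans_eq ?_
  rw [avg_add, avg_mul, avg_const hm]
  rfl

theorem nextZ_eq (ζ : Channel → Fin m → S) (s : State m n p) (i : Fin m) :
    nextZ O t ζ s i = (1 - t.γ) • s.z i + t.γ • dirS O ζ s i := by
  rw [nextZ, smul_sub, sub_smul 1 t.γ (dirS O ζ s i), one_smul]; abel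

variable {Ω : Type*} [MeasurableSpace Ω] [MeasurableSpace S] {P : Measure Ω}

theorem integral_avg_le {Y : Fin m → Ω → ℝ} {b : Fin m → ℝ} (hY : ∀ i, Integrable (Y i) P)
    (hb : ∀ i, ∫ ω, Y i ω ∂P ≤ b i) :
    Integrable (fun ω => avg fun i => Y i ω) P ∧ ∫ ω, (avg fun i => Y i ω) ∂P ≤ avg b := by
  refine ⟨(integrable_finsetSum _ fun i _ => hY i).const_mul _, ?_⟩
  simp only [avg]
  rw [integral_const_mul, integral_finsetSum _ fun i _ => hY i]
  exact mul_le_mul_of_nonneg_left (Finset.sum_le_sum fun i _ => hb i) (by positivity)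

variable [IsProbabilityMeasure P] {σ : Noise} {ζ : Channel → Fin m → ℕ → Ω → S}

theorem errV_step (hm : 0 < m) (hc : c.Pos) (hf : ∀ i, OuterAssumption c (f i) (g i))
    (hg : ∀ i, InnerAssumption c μ (g i)) (hμ : 0 < μ) (hμL : μ ≤ c.Lgt)
    (hW : NetworkAssumption G W) (hS : StochasticAssumption P f g O σ ζ)
    (hl : 0 < t.lam) (hl' : t.lam * c.Lgt ≤ 1) (s : State m n p) (hs : s.y = s.z) (k : ℕ) :
    Integrable (fun ω => errV f g (step W O t (fun a i => ζ a i k ω) s)) P ∧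
    ∫ ω, errV f g (step W O t (fun a i => ζ a i k ω) s) ∂P ≤
      (1 - t.lam * μ) * errV f g s + 2 * t.lam / μ * Lfgt c μ * (errX s + errT g s)
      + 2 / (t.lam * μ) * LvStar c μ ^ 2 * ((t.τ * t.α) ^ 2 * ‖vmean s.z‖ ^ 2)
      + t.lam ^ 2 * (2 * (σ.gtt ^ 2 * (2 * errV f g s + 2 * Mv c μ ^ 2)) + 2 * σ.ft ^ 2) := by
  set x' := xBar s - (t.τ * t.α) • vmean s.y with hx'
  have hx : ∀ ω, xBar (step W O t (fun a i => ζ a i k ω) s) = x' := fun ω => xBar_step hW _ s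
  have hd : ‖x' - xBar s‖ ^ 2 = (t.τ * t.α) ^ 2 * ‖vmean s.z‖ ^ 2 := by
    rw [hx', sub_sub_cancel_left, norm_neg, norm_smul, mul_pow, Real.norm_eq_abs, sq_abs, hs]
  have he : ∀ ω, errV f g (step W O t (fun a i => ζ a i k ω) s)
      = avg fun i => ‖s.v i - vStar (f i) (g i) x'
        - t.lam • dirH O (fun a i => ζ a i k ω) s i‖ ^ 2 := fun ω => by
    rw [errV, hx ω]
    congr 1; funext i
    simp only [step]
    rw [sub_right_comm]
  simp only [he]
  have h := integral_avg_le (fun i => (meanVar_dirH hS s i k).integrable_norm_sub_smul_sq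
    (s.v i - vStar (f i) (g i) x') t.lam) fun i =>
      ((meanVar_dirH hS s i k).integral_norm_sub_smul_sq_le
        (s.v i - vStar (f i) (g i) x') t.lam).trans (add_le_add
          (node_step_v hc (hf i) (hg i) hμ hμL hl hl' (xBar s) x' (s.x i) (s.θ i) (s.v i)) le_rfl)
  refine ⟨h.1, h.2.trans ?_⟩
  rw [avg_add, avg_add, avg_add, avg_mul, avg_mul, avg_add, avg_mul, avg_const hm, avg_mul,
    avg_add, avg_mul, avg_mul, avg_const hm, hd]
  have hv := avg_norm_v_sq_le hm hf hg hμ s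
  change _ * errV f g s + _ * (errX s + errT g s) + _ + _ ≤ _
  gcongr

theorem errT_step (hm : 0 < m) (hc : c.Pos)
    (hg : ∀ i, InnerAssumption c μ (g i)) (hμ : 0 < μ)
    (hW : NetworkAssumption G W) (hS : StochasticAssumption P f g O σ ζ)
    (hβ : 0 < t.β) (hβ' : t.β ≤ betMax c μ) (s : State m n p) (hs : s.y = s.z) (k : ℕ) :
    Integrable (fun ω => errT g (step W O t (fun a i => ζ a i k ω) s)) P ∧
    ∫ ω, errT g (step W O t (fun a i => ζ a i k ω) s) ∂P ≤
      (1 - 2 * t.β * omegaT c μ) * errT g s + t.β / omegaT c μ * c.Cgxt ^ 2 * errX s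
      + 1 / (t.β * omegaT c μ) * LthetaStar c μ ^ 2 * ((t.τ * t.α) ^ 2 * ‖vmean s.z‖ ^ 2)
      + t.β ^ 2 * σ.gt ^ 2 := by
  set x' := xBar s - (t.τ * t.α) • vmean s.y with hx'
  have hx : ∀ ω, xBar (step W O t (fun a i => ζ a i k ω) s) = x' := fun ω => xBar_step hW _ s
  have hd : ‖x' - xBar s‖ ^ 2 = (t.τ * t.α) ^ 2 * ‖vmean s.z‖ ^ 2 := by
    rw [hx', sub_sub_cancel_left, norm_neg, norm_smul, mul_pow, Real.norm_eq_abs, sq_abs, hs]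
  have he : ∀ ω, errT g (step W O t (fun a i => ζ a i k ω) s)
      = avg fun i => ‖s.θ i - innerSol (g i) x'
        - t.β • dirD O (fun a i => ζ a i k ω) s i‖ ^ 2 := fun ω => by
    rw [errT, hx ω]
    congr 1; funext i
    simp only [step]
    rw [sub_right_comm]
  simp only [he]
  have h := integral_avg_le (fun i => (meanVar_dirD hS s i k).integrable_norm_sub_smul_sq
    (s.θ i - innerSol (g i) x') t.β) fun i =>
      ((meanVar_dirD hS s i k).integral_norm_sub_smul_sq_le
        (s.θ i - innerSol (g i) x') t.β).trans (add_le_add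
          (node_step_t hc (hg i) hμ hβ hβ' (xBar s) x' (s.x i) (s.θ i)) le_rfl)
  refine ⟨h.1, h.2.trans ?_⟩
  rw [avg_add, avg_add, avg_add, avg_mul, avg_mul, avg_const hm, avg_const hm, hd]
  exact le_rfl

theorem avg_bias_le (hf : ∀ i, OuterAssumption c (f i) (g i))
    (hg : ∀ i, InnerAssumption c μ (g i)) (hμ : 0 < μ) (s : State m n p) :
    avg (fun i => ‖hyperGrad (f i) (g i) (xBar s) -
        (gradX (f i) (s.x i) (s.θ i) - jacXT (g i) (s.x i) (s.θ i) (s.v i))‖ ^ 2)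
      ≤ 3 * c.Cgxt ^ 2 * errV f g s + 3 / 2 * Lfgx c μ * (errX s + errT g s) := by
  refine (avg_mono fun i => norm_hyperGrad_sub_sq_le (hf i) (hg i) hμ (xBar s) (s.x i) (s.θ i)
    (s.v i)).trans_eq ?_
  rw [avg_add, avg_mul, avg_mul, avg_add]
  rfl

theorem avg_dirS_variance_le (hm : 0 < m) (hf : ∀ i, OuterAssumption c (f i) (g i))
    (hg : ∀ i, InnerAssumption c μ (g i)) (hμ : 0 < μ) (s : State m n p) :
    avg (fun i => 2 * σ.fx ^ 2 + 2 * (σ.gxt ^ 2 * ‖s.v i‖ ^ 2))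
      ≤ 2 * σ.fx ^ 2 + 2 * (σ.gxt ^ 2 * (2 * errV f g s + 2 * Mv c μ ^ 2)) := by
  rw [avg_add, avg_const hm, avg_mul, avg_mul]
  have := avg_norm_v_sq_le hm hf hg hμ s
  gcongr

theorem errZ_step (hm : 0 < m) (hc : c.Pos) (hf : ∀ i, OuterAssumption c (f i) (g i))
    (hg : ∀ i, InnerAssumption c μ (g i)) (hμ : 0 < μ)
    (hW : NetworkAssumption G W) (hS : StochasticAssumption P f g O σ ζ)
    (hγ : 0 < t.γ) (hγ' : t.γ ≤ 1) (s : State m n p) (hs : s.y = s.z) (k : ℕ) :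
    Integrable (fun ω => errZ f g (step W O t (fun a i => ζ a i k ω) s)) P ∧
    ∫ ω, errZ f g (step W O t (fun a i => ζ a i k ω) s) ∂P ≤
      (1 - t.γ) * errZ f g s
      + 2 * t.γ * (3 * c.Cgxt ^ 2 * errV f g s + 3 / 2 * Lfgx c μ * (errX s + errT g s))
      + 2 / t.γ * Lhyper c μ ^ 2 * ((t.τ * t.α) ^ 2 * ‖vmean s.z‖ ^ 2)
      + t.γ ^ 2 * (2 * σ.fx ^ 2 + 2 * (σ.gxt ^ 2 * (2 * errV f g s + 2 * Mv c μ ^ 2))) := by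
  set x' := xBar s - (t.τ * t.α) • vmean s.y with hx'
  have hx : ∀ ω, xBar (step W O t (fun a i => ζ a i k ω) s) = x' := fun ω => xBar_step hW _ s
  have hd : ‖x' - xBar s‖ ^ 2 = (t.τ * t.α) ^ 2 * ‖vmean s.z‖ ^ 2 := by
    rw [hx', sub_sub_cancel_left, norm_neg, norm_smul, mul_pow, Real.norm_eq_abs, sq_abs, hs]
  have he : ∀ ω, errZ f g (step W O t (fun a i => ζ a i k ω) s)
      = avg fun i => ‖hyperGrad (f i) (g i) x' - (1 - t.γ) • s.z i
        - t.γ • dirS O (fun a i => ζ a i k ω) s i‖ ^ 2 := fun ω => by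
    rw [errZ, hx ω]
    congr 1; funext i
    simp only [step]
    rw [nextZ_eq, sub_sub]
  simp only [he]
  have h := integral_avg_le (fun i => (meanVar_dirS hS s i k).integrable_norm_sub_smul_sq
    (hyperGrad (f i) (g i) x' - (1 - t.γ) • s.z i) t.γ) fun i =>
      ((meanVar_dirS hS s i k).integral_norm_sub_smul_sq_le
        (hyperGrad (f i) (g i) x' - (1 - t.γ) • s.z i) t.γ).trans (add_le_add
          (momentum_step hγ hγ' (hyperGrad (f i) (g i) (xBar s)) _ _ _) le_rfl)
  refine ⟨h.1, h.2.trans ?_⟩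
  rw [avg_add, avg_add, avg_add, avg_mul, avg_mul, avg_mul, avg_mul]
  have hb := avg_bias_le hf hg hμ s
  have hv := avg_dirS_variance_le (σ := σ) hm hf hg hμ s
  have hG : avg (fun i => ‖hyperGrad (f i) (g i) x' - hyperGrad (f i) (g i) (xBar s)‖ ^ 2)
      ≤ Lhyper c μ ^ 2 * ((t.τ * t.α) ^ 2 * ‖vmean s.z‖ ^ 2) := by
    rw [← hd, ← mul_pow]
    refine (avg_mono fun i => pow_le_pow_left₀ (norm_nonneg _)
      (hyperGrad_lip hc (hf i) (hg i) hμ x' (xBar s)) 2).trans_eq (avg_const hm _)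
  rw [mul_assoc (2 / t.γ)]
  change _ * errZ f g s + _ + _ + _ ≤ _
  gcongr

/-- Compared with the error of the individual `z i`, the recursion is the same except for the factor
`1/m` on the sampling noise. -/
theorem errZbar_step (hm : 0 < m) (hc : c.Pos) (hf : ∀ i, OuterAssumption c (f i) (g i))
    (hg : ∀ i, InnerAssumption c μ (g i)) (hμ : 0 < μ)
    (hW : NetworkAssumption G W) (hS : StochasticAssumption P f g O σ ζ)
    (hγ : 0 < t.γ) (hγ' : t.γ ≤ 1) (s : State m n p) (hs : s.y = s.z) (k : ℕ) :
    Integrable (fun ω => errZbar f g (step W O t (fun a i => ζ a i k ω) s)) P ∧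
    ∫ ω, errZbar f g (step W O t (fun a i => ζ a i k ω) s) ∂P ≤
      (1 - t.γ) * errZbar f g s
      + 2 * t.γ * (3 * c.Cgxt ^ 2 * errV f g s + 3 / 2 * Lfgx c μ * (errX s + errT g s))
      + 2 / t.γ * Lhyper c μ ^ 2 * ((t.τ * t.α) ^ 2 * ‖vmean s.z‖ ^ 2)
      + t.γ ^ 2 * (1 / (m : ℝ) *
        (2 * σ.fx ^ 2 + 2 * (σ.gxt ^ 2 * (2 * errV f g s + 2 * Mv c μ ^ 2)))) := by
  set x' := xBar s - (t.τ * t.α) • vmean s.y with hx'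
  have hx : ∀ ω, xBar (step W O t (fun a i => ζ a i k ω) s) = x' := fun ω => xBar_step hW _ s
  have hd : ‖x' - xBar s‖ ^ 2 = (t.τ * t.α) ^ 2 * ‖vmean s.z‖ ^ 2 := by
    rw [hx', sub_sub_cancel_left, norm_neg, norm_smul, mul_pow, Real.norm_eq_abs, sq_abs, hs]
  have he : ∀ ω, errZbar f g (step W O t (fun a i => ζ a i k ω) s)
      = ‖meanGrad f g x' - (1 - t.γ) • vmean s.z
        - t.γ • vmean fun i => dirS O (fun a i => ζ a i k ω) s i‖ ^ 2 := fun ω => by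
    rw [errZbar, hx ω, sub_sub, ← vmean_smul, ← vmean_smul, ← vmean_add]
    simp only [← nextZ_eq]
    rfl
  simp only [he]
  have hmv := MeanVar.vmean_of_indep (fun i => meanVar_dirS hS s i k) (indepFun_dirS hS s k)
  refine ⟨hmv.integrable_norm_sub_smul_sq _ _,
    (hmv.integral_norm_sub_smul_sq_le _ _).trans ?_⟩
  refine (add_le_add (momentum_step hγ hγ' (meanGrad f g (xBar s)) _ _ _) le_rfl).trans ?_
  have hb := avg_bias_le hf hg hμ s
  have hv := avg_dirS_variance_le (σ := σ) hm hf hg hμ s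
  have hB : ‖meanGrad f g (xBar s) - vmean fun i =>
      gradX (f i) (s.x i) (s.θ i) - jacXT (g i) (s.x i) (s.θ i) (s.v i)‖ ^ 2
      ≤ 3 * c.Cgxt ^ 2 * errV f g s + 3 / 2 * Lfgx c μ * (errX s + errT g s) := by
    rw [meanGrad, ← vmean_sub]
    exact (norm_vmean_sq_le hm _).trans hb
  have hG : ‖meanGrad f g x' - meanGrad f g (xBar s)‖ ^ 2
      ≤ Lhyper c μ ^ 2 * ((t.τ * t.α) ^ 2 * ‖vmean s.z‖ ^ 2) := by
    rw [← hd, ← mul_pow]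
    exact pow_le_pow_left₀ (norm_nonneg _) (meanGrad_lip hm hc hf hg hμ x' (xBar s)) 2
  rw [mul_assoc (2 / t.γ)]
  change _ * errZbar f g s + _ + _ + _ ≤ _
  gcongr

end Errors

/-! ### Weighted one-step bounds -/

section Weights

variable {c : ClassConst} {μ ρ clo chi α : ℝ} {σ : Noise} {r : Coeffs} {m : ℕ}

theorem Mv_pos (hc : c.Pos) (hμ : 0 < μ) : 0 < Mv c μ := div_pos hc.Cft hμ

theorem Lfgx_pos (hc : c.Pos) : 0 < Lfgx c μ := by
  have := hc.Lfx
  unfold Lfgx; positivity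

theorem Lfgt_pos (hc : c.Pos) : 0 < Lfgt c μ := by
  have := hc.Lft
  unfold Lfgt; positivity

theorem Lfgx_le_Qc (hc : c.Pos) : Lfgx c μ ≤ Qc c μ := by
  have := (Lfgt_pos (μ := μ) hc).le
  have : 0 ≤ 32 * c.Cgxt ^ 2 * Lfgt c μ / μ ^ 2 := by positivity
  unfold Qc; linarith

theorem Qc_pos (hc : c.Pos) : 0 < Qc c μ := (Lfgx_pos hc).trans_le (Lfgx_le_Qc hc)

theorem phi_pos (hc : c.Pos) : 0 < phi c μ := by
  have := Qc_pos (μ := μ) hc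
  unfold phi; positivity

theorem phi_ge (hc : c.Pos) :
    Qc c μ + 4 * (Qc c μ * c.Cgxt ^ 2 / omegaT c μ ^ 2) ≤ phi c μ := by
  have hQ := Qc_pos (μ := μ) hc
  have := hc.Cgxt
  have h : c.Cgxt ^ 2 ≤ max c.Lgt c.Cgxt ^ 2 := pow_le_pow_left₀ hc.Cgxt.le (le_max_right _ _) 2
  calc _ = Qc c μ * (1 + 4 * c.Cgxt ^ 2 / omegaT c μ ^ 2) := by ring
    _ ≤ _ := by unfold phi; gcongr

theorem Coeffs.Admissible.clam_pos (h : Coeffs.Admissible c μ clo chi r) (hlo : 0 < clo) :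
    0 < r.clam := hlo.trans_le h.clam_order.1

theorem Coeffs.Admissible.cbet_pos (h : Coeffs.Admissible c μ clo chi r) (hlo : 0 < clo) :
    0 < r.cbet := hlo.trans_le h.cbet_order.1

theorem Coeffs.Admissible.cgam_pos (h : Coeffs.Admissible c μ clo chi r) (hlo : 0 < clo) :
    0 < r.cgam := hlo.trans_le h.cgam_order.1

theorem d1_pos (hc : c.Pos) (hμ : 0 < μ) (hlo : 0 < clo)
    (hr : Coeffs.Admissible c μ clo chi r) : 0 < d1 c μ r := by
  have := hc.Cgxt; have := hr.tau_pos; have := hr.clam_pos hlo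
  unfold d1; positivity

theorem d2_pos (hc : c.Pos) (hμ : 0 < μ) (hlo : 0 < clo)
    (hr : Coeffs.Admissible c μ clo chi r) : 0 < d2 c μ r := by
  have := Qc_pos (μ := μ) hc; have := omegaT_pos hc hμ; have := hr.tau_pos; have := hr.cbet_pos hlo
  unfold d2; positivity

theorem d3_pos (hlo : 0 < clo) (hr : Coeffs.Admissible c μ clo chi r) : 0 < d3 r := by
  have := hr.tau_pos; have := hr.cgam_pos hlo
  unfold d3; positivity

theorem d4_nonneg (hc : c.Pos) (hlo : 0 < clo) (hr : Coeffs.Admissible c μ clo chi r) :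
    0 ≤ d4 c μ ρ r α := by
  have := (phi_pos (μ := μ) hc).le; have := hr.tau_pos; have := hr.cgam_pos hlo
  unfold d4; positivity

theorem weighted_v (hc : c.Pos) (hμ : 0 < μ) (hlo : 0 < clo)
    (hr : Coeffs.Admissible c μ clo chi r) (hα : 0 < α) (hgtt : 0 < σ.gtt) (hft : 0 ≤ σ.ft)
    (hl : r.clam * α < lamMax c μ σ) {V D N : ℝ} (hV : 0 ≤ V) (hN : 0 ≤ N) :
    d1 c μ r * ((1 - r.clam * α * μ) * V + 2 * (r.clam * α) / μ * Lfgt c μ * D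
      + 2 / (r.clam * α * μ) * LvStar c μ ^ 2 * ((r.τ * α) ^ 2 * N)
      + (r.clam * α) ^ 2 * (2 * (σ.gtt ^ 2 * (2 * V + 2 * Mv c μ ^ 2)) + 2 * σ.ft ^ 2))
    ≤ d1 c μ r * V - 7 * (c.Cgxt ^ 2 * (r.τ * α * V))
      + (Qc c μ - Lfgx c μ) / 2 * (r.τ * α * D) + r.τ * α * N / 144
      + 2 * (r.τ * α ^ 2) * (d1 c μ r / r.τ * (σ.ft + 2 * Mv c μ * σ.gtt) ^ 2 * r.clam ^ 2) := by
  have hτ := hr.tau_pos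
  have hcl := hr.clam_pos hlo
  have hM := Mv_pos hc hμ
  have hC := hc.Cgxt
  have hLv := LvStar_pos hc hμ
  have hd : d1 c μ r = 8 * c.Cgxt ^ 2 * r.τ / (μ * r.clam) := rfl
  have hd0 := d1_pos hc hμ hlo hr
  have e1 : d1 c μ r * (r.clam * α * μ * V) = 8 * (c.Cgxt ^ 2 * (r.τ * α * V)) := by
    rw [hd]; field_simp
  have e2 : d1 c μ r * (2 * (r.clam * α) / μ * Lfgt c μ * D)
      = (Qc c μ - Lfgx c μ) / 2 * (r.τ * α * D) := by
    rw [hd, Qc]; field_simp; ring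
  -- The drift is `τα N / 144` times the square of the ratio that the admissibility bound on `clam`
  -- keeps below one.
  have e3 : d1 c μ r * (2 / (r.clam * α * μ) * LvStar c μ ^ 2 * ((r.τ * α) ^ 2 * N))
      ≤ r.τ * α * N / 144 := by
    have h1 : d1 c μ r * (2 / (r.clam * α * μ) * LvStar c μ ^ 2 * ((r.τ * α) ^ 2 * N))
        = r.τ * α * N / 144 * (48 * LvStar c μ * c.Cgxt / μ * r.τ / r.clam) ^ 2 := by
      rw [hd]; field_simp; ring
    rw [h1]
    refine mul_le_of_le_one_right (by positivity) (pow_le_one₀ (by positivity) ?_)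
    rw [div_le_one hcl]
    exact hr.clam_ge
  -- The part of the noise proportional to the error itself costs one of the eight units of
  -- contraction in `e1`, by the bound `λ ≤ μ / (32 σ²)`.
  have e4 : d1 c μ r * ((r.clam * α) ^ 2 * (4 * σ.gtt ^ 2 * V))
      ≤ c.Cgxt ^ 2 * (r.τ * α * V) := by
    have h1 : r.clam * α * (32 * σ.gtt ^ 2) ≤ μ := by
      rw [← le_div_iff₀ (by positivity)]
      exact hl.le.trans (min_le_right _ _)
    have h2 : d1 c μ r * ((r.clam * α) ^ 2 * (4 * σ.gtt ^ 2 * V))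
        = c.Cgxt ^ 2 * (r.τ * α * V) * (r.clam * α * (32 * σ.gtt ^ 2) / μ) := by
      rw [hd]; field_simp; ring
    rw [h2]
    exact mul_le_of_le_one_right (by positivity) ((div_le_one hμ).2 h1)
  have e5 : d1 c μ r * ((r.clam * α) ^ 2 * (4 * σ.gtt ^ 2 * Mv c μ ^ 2 + 2 * σ.ft ^ 2))
      ≤ 2 * (r.τ * α ^ 2) * (d1 c μ r / r.τ * (σ.ft + 2 * Mv c μ * σ.gtt) ^ 2 * r.clam ^ 2) := by
    have h1 : 2 * (r.τ * α ^ 2) * (d1 c μ r / r.τ * (σ.ft + 2 * Mv c μ * σ.gtt) ^ 2 * r.clam ^ 2)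
        = d1 c μ r * ((r.clam * α) ^ 2 * (2 * (σ.ft + 2 * Mv c μ * σ.gtt) ^ 2)) := by
      field_simp
    rw [h1]
    gcongr
    have : 0 ≤ σ.ft * (Mv c μ * σ.gtt) := by positivity
    nlinarith [sq_nonneg (Mv c μ * σ.gtt)]
  linarith

theorem weighted_t (hc : c.Pos) (hμ : 0 < μ) (hlo : 0 < clo)
    (hr : Coeffs.Admissible c μ clo chi r) (hα : 0 < α) {T X N : ℝ} (hN : 0 ≤ N) :
    d2 c μ r * ((1 - 2 * (r.cbet * α) * omegaT c μ) * T
      + r.cbet * α / omegaT c μ * c.Cgxt ^ 2 * X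
      + 1 / (r.cbet * α * omegaT c μ) * LthetaStar c μ ^ 2 * ((r.τ * α) ^ 2 * N)
      + (r.cbet * α) ^ 2 * σ.gt ^ 2)
    ≤ d2 c μ r * T - 2 * Qc c μ * (r.τ * α * T)
      + Qc c μ * c.Cgxt ^ 2 / omegaT c μ ^ 2 * (r.τ * α * X) + r.τ * α * N / 36
      + r.τ * α ^ 2 * (d2 c μ r / r.τ * σ.gt ^ 2 * r.cbet ^ 2) := by
  have hτ := hr.tau_pos
  have hcb := hr.cbet_pos hlo
  have hω := omegaT_pos hc hμ
  have hQ := Qc_pos (μ := μ) hc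
  have hL := LthetaStar_pos hc hμ
  have hd : d2 c μ r = Qc c μ * r.τ / (omegaT c μ * r.cbet) := rfl
  have e1 : d2 c μ r * (2 * (r.cbet * α) * omegaT c μ * T) = 2 * Qc c μ * (r.τ * α * T) := by
    rw [hd]; field_simp
  have e2 : d2 c μ r * (r.cbet * α / omegaT c μ * c.Cgxt ^ 2 * X)
      = Qc c μ * c.Cgxt ^ 2 / omegaT c μ ^ 2 * (r.τ * α * X) := by
    rw [hd]; field_simp
  have e3 : d2 c μ r * (1 / (r.cbet * α * omegaT c μ) * LthetaStar c μ ^ 2 * ((r.τ * α) ^ 2 * N))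
      ≤ r.τ * α * N / 36 := by
    have h1 : d2 c μ r *
          (1 / (r.cbet * α * omegaT c μ) * LthetaStar c μ ^ 2 * ((r.τ * α) ^ 2 * N))
        -- Again the square of an admissible ratio, here the one bounding `cbet` from below.
        = r.τ * α * N / 36 * (6 * LthetaStar c μ / omegaT c μ * √(Qc c μ) * r.τ / r.cbet) ^ 2 := by
      have hs : √(Qc c μ) ^ 2 = Qc c μ := Real.sq_sqrt hQ.le
      rw [hd, div_pow, mul_pow _ r.τ, mul_pow _ (√(Qc c μ)), hs]; field_simp; ring
    rw [h1]
    refine mul_le_of_le_one_right (by positivity) (pow_le_one₀ (by positivity) ?_)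
    rw [div_le_one hcb]
    exact hr.cbet_ge
  have e4 : d2 c μ r * ((r.cbet * α) ^ 2 * σ.gt ^ 2)
      = r.τ * α ^ 2 * (d2 c μ r / r.τ * σ.gt ^ 2 * r.cbet ^ 2) := by
    field_simp
  linarith

theorem weighted_drift (hc : c.Pos) (hμ : 0 < μ) (hlo : 0 < clo)
    (hr : Coeffs.Admissible c μ clo chi r) (hα : 0 < α) {N : ℝ} (hN : 0 ≤ N) :
    d3 r * (2 / (r.cgam * α) * Lhyper c μ ^ 2 * ((r.τ * α) ^ 2 * N)) ≤ r.τ * α * N / 16 := by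
  have hτ := hr.tau_pos
  have hcg := hr.cgam_pos hlo
  have hL := Lhyper_pos hc hμ
  have h1 : d3 r * (2 / (r.cgam * α) * Lhyper c μ ^ 2 * ((r.τ * α) ^ 2 * N))
      = r.τ * α * N / 16 * (4 * Lhyper c μ * r.τ / r.cgam) ^ 2 := by
    rw [d3]; field_simp; ring
  rw [h1]
  refine mul_le_of_le_one_right (by positivity) (pow_le_one₀ (by positivity) ?_)
  rw [div_le_one hcg]
  exact hr.cgam_ge

theorem weighted_multiplicative_noise (hlo : 0 < clo)
    (hr : Coeffs.Admissible c μ clo chi r) (hα : 0 < α) (hgxt : 0 < σ.gxt)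
    (hγ : r.cgam * α < gamMax c σ) {V : ℝ} (hV : 0 ≤ V) :
    d3 r * ((r.cgam * α) ^ 2 * (4 * σ.gxt ^ 2 * V)) ≤ 2 * (c.Cgxt ^ 2 * (r.τ * α * V)) := by
  have hτ := hr.tau_pos
  have hcg := hr.cgam_pos hlo
  have h1 : r.cgam * α * σ.gxt ^ 2 ≤ c.Cgxt ^ 2 := by
    rw [← le_div_iff₀ (by positivity)]
    exact hγ.le.trans (min_le_right _ _)
  have h2 : d3 r * ((r.cgam * α) ^ 2 * (4 * σ.gxt ^ 2 * V))
      = 2 * (r.cgam * α * σ.gxt ^ 2 * (r.τ * α * V)) := by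
    rw [d3]; field_simp; ring
  rw [h2]
  gcongr

theorem weighted_additive_noise (hc : c.Pos) (hμ : 0 < μ) (hlo : 0 < clo)
    (hr : Coeffs.Admissible c μ clo chi r) (hgxt : 0 < σ.gxt) (hfx : 0 ≤ σ.fx) :
    d3 r * ((r.cgam * α) ^ 2 * (2 * σ.fx ^ 2 + 4 * σ.gxt ^ 2 * Mv c μ ^ 2))
      ≤ 2 * (r.τ * α ^ 2) * (d3 r / r.τ * (σ.fx + 2 * Mv c μ * σ.gxt) ^ 2 * r.cgam ^ 2) := by
  have hτ := hr.tau_pos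
  have hM := Mv_pos hc hμ
  have hd := d3_pos hlo hr
  have h1 : 2 * (r.τ * α ^ 2) * (d3 r / r.τ * (σ.fx + 2 * Mv c μ * σ.gxt) ^ 2 * r.cgam ^ 2)
      = d3 r * ((r.cgam * α) ^ 2 * (2 * (σ.fx + 2 * Mv c μ * σ.gxt) ^ 2)) := by
    field_simp
  rw [h1]
  gcongr
  have : 0 ≤ σ.fx * (Mv c μ * σ.gxt) := by positivity
  nlinarith [sq_nonneg (Mv c μ * σ.gxt)]

theorem weighted_zbar (hm : 0 < m) (hc : c.Pos) (hμ : 0 < μ) (hlo : 0 < clo)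
    (hr : Coeffs.Admissible c μ clo chi r) (hα : 0 < α) (hgxt : 0 < σ.gxt) (hfx : 0 ≤ σ.fx)
    (hγ : r.cgam * α < gamMax c σ) {Z B V N : ℝ} (hV : 0 ≤ V) (hN : 0 ≤ N) :
    d3 r * ((1 - r.cgam * α) * Z + 2 * (r.cgam * α) * B
      + 2 / (r.cgam * α) * Lhyper c μ ^ 2 * ((r.τ * α) ^ 2 * N)
      + (r.cgam * α) ^ 2 * (1 / (m : ℝ) *
        (2 * σ.fx ^ 2 + 2 * (σ.gxt ^ 2 * (2 * V + 2 * Mv c μ ^ 2)))))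
    ≤ d3 r * Z - r.τ * α / 2 * Z + r.τ * α * B + r.τ * α * N / 16
      + 2 * (c.Cgxt ^ 2 * (r.τ * α * V))
      + 2 * (r.τ * α ^ 2) * (d3 r / r.τ * (σ.fx + 2 * Mv c μ * σ.gxt) ^ 2 * r.cgam ^ 2) / m := by
  have hcg := hr.cgam_pos hlo
  have hd := d3_pos hlo hr
  have hm1 : 1 / (m : ℝ) ≤ 1 := by
    rw [div_le_one (by positivity)]; exact_mod_cast hm
  have e1 : d3 r * (r.cgam * α * Z) = r.τ * α / 2 * Z := by rw [d3]; field_simp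
  have e2 : d3 r * (2 * (r.cgam * α) * B) = r.τ * α * B := by rw [d3]; field_simp
  have e3 := weighted_drift hc hμ hlo hr hα hN
  have e4 := weighted_multiplicative_noise hlo hr hα hgxt hγ hV
  have e5 := weighted_additive_noise (α := α) hc hμ hlo hr hgxt hfx
  have e4' : 1 / (m : ℝ) * (d3 r * ((r.cgam * α) ^ 2 * (4 * σ.gxt ^ 2 * V)))
      ≤ 2 * (c.Cgxt ^ 2 * (r.τ * α * V)) :=
    (mul_le_of_le_one_left (by positivity) hm1).trans e4
  have e5' := mul_le_mul_of_nonneg_left e5 (by positivity : 0 ≤ 1 / (m : ℝ))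
  have e6 : 1 / (m : ℝ) * (2 * (r.τ * α ^ 2) *
        (d3 r / r.τ * (σ.fx + 2 * Mv c μ * σ.gxt) ^ 2 * r.cgam ^ 2))
      = 2 * (r.τ * α ^ 2) *
        (d3 r / r.τ * (σ.fx + 2 * Mv c μ * σ.gxt) ^ 2 * r.cgam ^ 2) / m := by ring
  rw [e6] at e5'
  linarith

/-- Two bounds on `d4` are used: `d3 / 3` for the coupling, drift and multiplicative noise, and `d3
/ m` for the additive noise, so that the local trackers also contribute noise divided by `m`. -/
theorem weighted_z (hm : 0 < m) (hc : c.Pos) (hμ : 0 < μ) (hlo : 0 < clo)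
    (hr : Coeffs.Admissible c μ clo chi r) (hα : 0 < α) (hgxt : 0 < σ.gxt) (hfx : 0 ≤ σ.fx)
    (hγ : r.cgam * α < gamMax c σ) (hρ : ρ < 1) (h3 : d4 c μ ρ r α ≤ d3 r / 3)
    (hdm : d4 c μ ρ r α ≤ d3 r / m) {Z B V N : ℝ} (hV : 0 ≤ V) (hN : 0 ≤ N) (hB : 0 ≤ B) :
    d4 c μ ρ r α * ((1 - r.cgam * α) * Z + 2 * (r.cgam * α) * B
      + 2 / (r.cgam * α) * Lhyper c μ ^ 2 * ((r.τ * α) ^ 2 * N)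
      + (r.cgam * α) ^ 2 * (2 * σ.fx ^ 2 + 2 * (σ.gxt ^ 2 * (2 * V + 2 * Mv c μ ^ 2))))
    ≤ d4 c μ ρ r α * Z - 24 * (phi c μ * r.τ * α ^ 3 / (1 - ρ) ^ 2 * Z) + r.τ * α * B / 3
      + r.τ * α * N / 48 + 2 / 3 * (c.Cgxt ^ 2 * (r.τ * α * V))
      + 2 * (r.τ * α ^ 2) * (d3 r / r.τ * (σ.fx + 2 * Mv c μ * σ.gxt) ^ 2 * r.cgam ^ 2) / m := by
  have hcg := hr.cgam_pos hlo
  have hτ := hr.tau_pos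
  have hL := Lhyper_pos hc hμ
  have hd := d3_pos hlo hr
  have h1ρ : (1 - ρ) ≠ 0 := by linarith
  have e1 : d4 c μ ρ r α * (r.cgam * α * Z)
      = 24 * (phi c μ * r.τ * α ^ 3 / (1 - ρ) ^ 2 * Z) := by
    rw [d4]; field_simp
  have e2 : d3 r * (2 * (r.cgam * α) * B) = r.τ * α * B := by rw [d3]; field_simp
  have e3 := weighted_drift hc hμ hlo hr hα hN
  have e4 := weighted_multiplicative_noise hlo hr hα hgxt hγ hV
  have e5 := weighted_additive_noise (α := α) hc hμ hlo hr hgxt hfx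
  have f2 := mul_le_mul_of_nonneg_right h3 (by positivity : 0 ≤ 2 * (r.cgam * α) * B)
  have f3 := mul_le_mul_of_nonneg_right h3
    (by positivity : 0 ≤ 2 / (r.cgam * α) * Lhyper c μ ^ 2 * ((r.τ * α) ^ 2 * N))
  have f4 := mul_le_mul_of_nonneg_right h3
    (by positivity : 0 ≤ (r.cgam * α) ^ 2 * (4 * σ.gxt ^ 2 * V))
  have f5 := mul_le_mul_of_nonneg_right hdm
    (by positivity : 0 ≤ (r.cgam * α) ^ 2 * (2 * σ.fx ^ 2 + 4 * σ.gxt ^ 2 * Mv c μ ^ 2))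
  have e5' := mul_le_mul_of_nonneg_left e5 (by positivity : 0 ≤ 1 / (m : ℝ))
  have e6 : 1 / (m : ℝ) * (2 * (r.τ * α ^ 2) *
        (d3 r / r.τ * (σ.fx + 2 * Mv c μ * σ.gxt) ^ 2 * r.cgam ^ 2))
      = 2 * (r.τ * α ^ 2) *
        (d3 r / r.τ * (σ.fx + 2 * Mv c μ * σ.gxt) ^ 2 * r.cgam ^ 2) / m := by ring
  rw [e6] at e5'
  have e7 : d3 r / m * ((r.cgam * α) ^ 2 * (2 * σ.fx ^ 2 + 4 * σ.gxt ^ 2 * Mv c μ ^ 2))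
      = 1 / (m : ℝ) *
        (d3 r * ((r.cgam * α) ^ 2 * (2 * σ.fx ^ 2 + 4 * σ.gxt ^ 2 * Mv c μ ^ 2))) := by ring
  rw [e7] at f5
  linarith

/-- The definition of `d4` is tuned to this estimate: the term `24 φ τ α³ / (1-ρ)² Z` is exactly
what the contraction in `weighted_z` removes. The other forcing term is the heterogeneity, of order
`α³`. -/
theorem weighted_x (hc : c.Pos) (hτ : 0 < r.τ) (hα : 0 < α) (hρ : ρ < 1)
    {X Y Z B : ℝ} (hY : Y ≤ 2 * Z + 6 * B) :
    4 * phi c μ * α / (1 - ρ) * ((1 - r.τ * (1 - ρ) / 2) * X + 3 * r.τ * α ^ 2 / (1 - ρ) * Y)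
    ≤ 4 * phi c μ * α / (1 - ρ) * X - 2 * phi c μ * (r.τ * α * X)
      + 24 * (phi c μ * r.τ * α ^ 3 / (1 - ρ) ^ 2 * Z)
      + 72 * (phi c μ * r.τ * α ^ 3 / (1 - ρ) ^ 2 * B) := by
  have h1ρ : 0 < 1 - ρ := by linarith
  have hφ := phi_pos (μ := μ) hc
  have e1 : 4 * phi c μ * α / (1 - ρ) * (r.τ * (1 - ρ) / 2 * X)
      = 2 * phi c μ * (r.τ * α * X) := by field_simp; norm_num
  have e2 : 4 * phi c μ * α / (1 - ρ) * (3 * r.τ * α ^ 2 / (1 - ρ) * Y)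
      = 12 * (phi c μ * r.τ * α ^ 3 / (1 - ρ) ^ 2 * Y) := by field_simp; ring
  have e3 : phi c μ * r.τ * α ^ 3 / (1 - ρ) ^ 2 * Y
      ≤ phi c μ * r.τ * α ^ 3 / (1 - ρ) ^ 2 * (2 * Z + 6 * B) := by gcongr
  linarith

end Weights

/-! ### The Lyapunov function -/

section Lyapunov

variable {m n p : ℕ} {S : Type*} {c : ClassConst} {μ ρ bf bg clo chi α : ℝ}
  {f g : Fin m → Vec n → Vec p → ℝ} {G : SimpleGraph (Fin m)} {W : Matrix (Fin m) (Fin m) ℝ}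
  {O : Oracle m n p S} {r : Coeffs} {σ : Noise}

/-- The Lyapunov function. -/
def lyap (c : ClassConst) (μ ρ : ℝ) (r : Coeffs) (α : ℝ) (f g : Fin m → Vec n → Vec p → ℝ)
    (s : State m n p) : ℝ :=
  objective f g (xBar s) + d1 c μ r * errV f g s + d2 c μ r * errT g s + d3 r * errZbar f g s
    + d4 c μ ρ r α * errZ f g s + 4 * phi c μ * α / (1 - ρ) * errX s

theorem sigmaP_sq_ge (hc : c.Pos) (hμ : 0 < μ) (hlo : 0 < clo)
    (hr : Coeffs.Admissible c μ clo chi r) (hgt : 0 ≤ σ.gt) (hgtt : 0 < σ.gtt) (hft : 0 ≤ σ.ft) :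
    d1 c μ r / r.τ * (σ.ft + 2 * Mv c μ * σ.gtt) ^ 2 * r.clam ^ 2
      + d2 c μ r / r.τ * σ.gt ^ 2 * r.cbet ^ 2 ≤ sigmaP c μ σ r ^ 2 := by
  have hτ := hr.tau_pos
  have h1 := (d1_pos hc hμ hlo hr).le
  have h2 := (d2_pos hc hμ hlo hr).le
  have hM := Mv_pos hc hμ
  have hcl := hr.clam_pos hlo
  have hcb := hr.cbet_pos hlo
  have e1 : √(d1 c μ r / r.τ) ^ 2 = d1 c μ r / r.τ := Real.sq_sqrt (by positivity)
  have e2 : √(d2 c μ r / r.τ) ^ 2 = d2 c μ r / r.τ := Real.sq_sqrt (by positivity)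
  have h3 : 0 ≤ √(d1 c μ r / r.τ) * (σ.ft + 2 * Mv c μ * σ.gtt) * r.clam
      * (√(d2 c μ r / r.τ) * σ.gt * r.cbet) := by positivity
  unfold sigmaP
  calc _ = (√(d1 c μ r / r.τ) * (σ.ft + 2 * Mv c μ * σ.gtt) * r.clam) ^ 2
        + (√(d2 c μ r / r.τ) * σ.gt * r.cbet) ^ 2 := by simp only [mul_pow, e1, e2]
    _ ≤ _ := by rw [add_sq]; linarith

theorem sigmaC_sq (hlo : 0 < clo) (hr : Coeffs.Admissible c μ clo chi r) :
    d3 r / r.τ * (σ.fx + 2 * Mv c μ * σ.gxt) ^ 2 * r.cgam ^ 2 = sigmaC c μ σ r ^ 2 := by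
  have hτ := hr.tau_pos
  have h1 := (d3_pos hlo hr).le
  unfold sigmaC
  rw [mul_pow, mul_pow, Real.sq_sqrt (by positivity)]

/-- The part of the requirements on the step size used in the one-step analysis. -/
structure StepBound (c : ClassConst) (μ ρ : ℝ) (σ : Noise) (r : Coeffs) (m : ℕ) (α : ℝ) :
    Prop where
  pos : 0 < α
  le_u1 : r.τ * α * Lhyper c μ ≤ 1 / 2
  d4_le : d4 c μ ρ r α ≤ d3 r / 3
  d4_le_div : d4 c μ ρ r α ≤ d3 r / (m : ℝ)
  lam_lt : r.clam * α < lamMax c μ σ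
  bet_lt : r.cbet * α < betMax c μ
  gam_lt : r.cgam * α < gamMax c σ

/-- The decrease allowance of one step of the Lyapunov function. -/
def stepError (c : ClassConst) (μ ρ : ℝ) (σ : Noise) (r : Coeffs) (m : ℕ) (bf bg α : ℝ) : ℝ :=
  2 * (r.τ * α ^ 2) * sigmaP c μ σ r ^ 2 + 4 * (r.τ * α ^ 2) * sigmaC c μ σ r ^ 2 / m
    + 72 * (phi c μ * r.τ * α ^ 3 / (1 - ρ) ^ 2 * (bSq c μ bf bg / m))

theorem integral_linear_comb {Ω : Type*} [MeasurableSpace Ω] {P : Measure Ω}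
    [IsProbabilityMeasure P] {a₀ a₁ a₂ a₃ a₄ a₅ : ℝ} {i₁ i₂ i₃ i₄ : Ω → ℝ}
    (h₁ : Integrable i₁ P) (h₂ : Integrable i₂ P) (h₃ : Integrable i₃ P) (h₄ : Integrable i₄ P) :
    Integrable (fun ω => a₀ + a₁ * i₁ ω + a₂ * i₂ ω + a₃ * i₃ ω + a₄ * i₄ ω + a₅) P ∧
    ∫ ω, (a₀ + a₁ * i₁ ω + a₂ * i₂ ω + a₃ * i₃ ω + a₄ * i₄ ω + a₅) ∂P
      = a₀ + a₁ * ∫ ω, i₁ ω ∂P + a₂ * ∫ ω, i₂ ω ∂P + a₃ * ∫ ω, i₃ ω ∂P + a₄ * ∫ ω, i₄ ω ∂P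
        + a₅ := by
  have j0 : Integrable (fun _ : Ω => a₀) P := integrable_const _
  have j1 : Integrable (fun ω => a₀ + a₁ * i₁ ω) P := j0.add (h₁.const_mul _)
  have j2 : Integrable (fun ω => a₀ + a₁ * i₁ ω + a₂ * i₂ ω) P := j1.add (h₂.const_mul _)
  have j3 : Integrable (fun ω => a₀ + a₁ * i₁ ω + a₂ * i₂ ω + a₃ * i₃ ω) P :=
    j2.add (h₃.const_mul _)
  have j4 : Integrable (fun ω => a₀ + a₁ * i₁ ω + a₂ * i₂ ω + a₃ * i₃ ω + a₄ * i₄ ω) P :=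
    j3.add (h₄.const_mul _)
  have j5 : Integrable (fun _ : Ω => a₅) P := integrable_const _
  refine ⟨j4.add j5, ?_⟩
  rw [integral_add j4 j5, integral_add j3 (h₄.const_mul _), integral_add j2 (h₃.const_mul _),
    integral_add j1 (h₂.const_mul _), integral_add j0 (h₁.const_mul _)]
  simp only [integral_const_mul, integral_const, probReal_univ, one_smul]

variable {Ω : Type*} [MeasurableSpace Ω] [MeasurableSpace S] {P : Measure Ω}
  [IsProbabilityMeasure P] {ζ : Channel → Fin m → ℕ → Ω → S}

/-- The sum of all weighted one-step bounds at a fixed state; the expectation is over the fresh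
samples only. -/
theorem lyap_step (hm : 0 < m) (hc : c.Pos) (hf : ∀ i, OuterAssumption c (f i) (g i))
    (hg : ∀ i, InnerAssumption c μ (g i)) (hμ : 0 < μ) (hμL : μ ≤ c.Lgt)
    (hh : Heterogeneity bf bg f g) (hW : NetworkAssumption G W)
    (hS : StochasticAssumption P f g O σ ζ) (hlo : 0 < clo)
    (hr : Coeffs.Admissible c μ clo chi r) (hgt : 0 ≤ σ.gt) (hgtt : 0 < σ.gtt)
    (hgxt : 0 < σ.gxt) (hft : 0 ≤ σ.ft) (hfx : 0 ≤ σ.fx)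
    (hα : StepBound c μ (netRho W) σ r m α) (s : State m n p) (hs : s.y = s.z) (k : ℕ) :
    Integrable (fun ω => lyap c μ (netRho W) r α f g
      (step W O (r.toSteps α) (fun a i => ζ a i k ω) s)) P ∧
    ∫ ω, lyap c μ (netRho W) r α f g (step W O (r.toSteps α) (fun a i => ζ a i k ω) s) ∂P
      + r.τ * α / 2 * ‖meanGrad f g (xBar s)‖ ^ 2
      ≤ lyap c μ (netRho W) r α f g s + stepError c μ (netRho W) σ r m bf bg α := by
  set ρ := netRho W with hρdef
  have hρ : ρ < 1 := hW.rho_lt_one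
  have hα0 := hα.pos
  have hτ := hr.tau_pos
  have hcl := hr.clam_pos hlo
  have hcb := hr.cbet_pos hlo
  have hcg := hr.cgam_pos hlo
  have hd1 := (d1_pos hc hμ hlo hr).le
  have hd2 := (d2_pos hc hμ hlo hr).le
  have hd3 := (d3_pos hlo hr).le
  have hd4 := d4_nonneg (ρ := ρ) (α := α) hc hlo hr
  have hφ := (phi_pos (μ := μ) hc).le
  have h1ρ : 0 < 1 - ρ := by linarith
  have hV := errV_nonneg f g s
  have hT := errT_nonneg g s
  have hX := errX_nonneg s
  have hl' : r.clam * α * c.Lgt ≤ 1 := by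
    have := hc.Lgt
    rw [← le_div_iff₀ this]
    exact hα.lam_lt.le.trans (min_le_left _ _)
  have hγ' : r.cgam * α ≤ 1 := hα.gam_lt.le.trans (min_le_left _ _)
  obtain ⟨iV, bV⟩ := errV_step (t := r.toSteps α) hm hc hf hg hμ hμL hW hS (mul_pos hcl hα0) hl'
    s hs k
  obtain ⟨iT, bT⟩ := errT_step (t := r.toSteps α) hm hc hg hμ hW hS (mul_pos hcb hα0)
    hα.bet_lt.le s hs k
  obtain ⟨iZ, bZ⟩ := errZ_step (t := r.toSteps α) hm hc hf hg hμ hW hS (mul_pos hcg hα0) hγ' s hs k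
  obtain ⟨iB, bB⟩ := errZbar_step (t := r.toSteps α) hm hc hf hg hμ hW hS (mul_pos hcg hα0) hγ'
    s hs k
  set x' := xBar s - (r.τ * α) • vmean s.z with hx'
  have hx : ∀ ω, xBar (step W O (r.toSteps α) (fun a i => ζ a i k ω) s) = x' := fun ω => by
    rw [xBar_step hW, hs]; rfl
  set X' := avg fun i => ‖((1 - r.τ) • s.x i + r.τ • (∑ j, W i j • s.x j - α • s.y i)) - x'‖ ^ 2
  have hX' : ∀ ω, errX (step W O (r.toSteps α) (fun a i => ζ a i k ω) s) = X' := fun ω => by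
    rw [errX, hx ω]; rfl
  have bX : X' ≤ (1 - r.τ * (1 - ρ) / 2) * errX s
      + 3 * r.τ * α ^ 2 / (1 - ρ) * avg fun i => ‖s.z i - vmean s.z‖ ^ 2 := by
    -- The consensus error after the step is the same for all samples, so any one of them transfers
    -- the bound.
    obtain ⟨ω⟩ : Nonempty Ω := P.nonempty_of_neZero
    rw [← hX' ω]
    exact errX_step_le (t := r.toSteps α) hm hW hτ.le hr.tau_lt_one.le _ s hs
  have bΦ := objective_step_le hm hc hf hg hμ (by positivity) hα.le_u1 (xBar s) (vmean s.z)
  rw [← hx'] at bΦ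
  have tα : (r.toSteps α).α = α := rfl
  have tβ : (r.toSteps α).β = r.cbet * α := rfl
  have tl : (r.toSteps α).lam = r.clam * α := rfl
  have tγ : (r.toSteps α).γ = r.cgam * α := rfl
  have tτ : (r.toSteps α).τ = r.τ := rfl
  rw [tα, tl, tτ] at bV
  rw [tα, tβ, tτ] at bT
  rw [tα, tγ, tτ] at bZ bB
  have wV := (mul_le_mul_of_nonneg_left bV hd1).trans
    (weighted_v hc hμ hlo hr hα0 hgtt hft hα.lam_lt hV (sq_nonneg _))
  have wT := (mul_le_mul_of_nonneg_left bT hd2).trans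
    (weighted_t hc hμ hlo hr hα0 (sq_nonneg _))
  have wB := (mul_le_mul_of_nonneg_left bB hd3).trans
    (weighted_zbar hm hc hμ hlo hr hα0 hgxt hfx hα.gam_lt hV (sq_nonneg _))
  have hL := (Lfgx_pos (μ := μ) hc).le
  have wZ := (mul_le_mul_of_nonneg_left bZ hd4).trans
    (weighted_z hm hc hμ hlo hr hα0 hgxt hfx hα.gam_lt hρ hα.d4_le hα.d4_le_div hV (sq_nonneg _)
      (by positivity))
  have wX := (mul_le_mul_of_nonneg_left bX
    (by positivity : 0 ≤ 4 * phi c μ * α / (1 - ρ))).trans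
    (weighted_x hc hτ hα0 hρ (avg_tracking_spread_le hm hf hg hh hμ s))
  simp only [lyap, hx, hX']
  obtain ⟨hI, hint⟩ := integral_linear_comb (P := P) (a₀ := objective f g x') (a₁ := d1 c μ r)
    (a₂ := d2 c μ r) (a₃ := d3 r) (a₄ := d4 c μ ρ r α) (a₅ := 4 * phi c μ * α / (1 - ρ) * X')
    iV iT iB iZ
  refine ⟨hI, ?_⟩
  rw [hint]
  generalize hI1 : ∫ ω, errV f g (step W O (r.toSteps α) (fun a i => ζ a i k ω) s) ∂P = I1 at *
  generalize hI2 : ∫ ω, errT g (step W O (r.toSteps α) (fun a i => ζ a i k ω) s) ∂P = I2 at *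
  generalize hI3 : ∫ ω, errZbar f g (step W O (r.toSteps α) (fun a i => ζ a i k ω) s) ∂P = I3 at *
  generalize hI4 : ∫ ω, errZ f g (step W O (r.toSteps α) (fun a i => ζ a i k ω) s) ∂P = I4 at *
  have hsP := mul_le_mul_of_nonneg_left (sigmaP_sq_ge hc hμ hlo hr hgt hgtt hft)
    (by positivity : 0 ≤ 2 * (r.τ * α ^ 2))
  have hsC := sigmaC_sq (σ := σ) hlo hr
  rw [hsC] at wB wZ
  have hE2 : 0 ≤ r.τ * α ^ 2 * (d2 c μ r / r.τ * σ.gt ^ 2 * r.cbet ^ 2) := by positivity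
  have hZbdef : errZbar f g s = ‖meanGrad f g (xBar s) - vmean s.z‖ ^ 2 := rfl
  rw [← hZbdef] at bΦ
  have pV : 0 ≤ c.Cgxt ^ 2 * (r.τ * α * errV f g s) := by positivity
  have pT : Lfgx c μ * (r.τ * α * errT g s) ≤ Qc c μ * (r.τ * α * errT g s) :=
    mul_le_mul_of_nonneg_right (Lfgx_le_Qc hc) (by positivity)
  have pX1 : Lfgx c μ * (r.τ * α * errX s) ≤ Qc c μ * (r.τ * α * errX s) :=
    mul_le_mul_of_nonneg_right (Lfgx_le_Qc hc) (by positivity)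
  have pX2 := mul_le_mul_of_nonneg_right (phi_ge (μ := μ) hc)
    (by positivity : 0 ≤ r.τ * α * errX s)
  have pX3 : 0 ≤ Qc c μ * c.Cgxt ^ 2 / omegaT c μ ^ 2 * (r.τ * α * errX s) := by
    have := Qc_pos (μ := μ) hc
    positivity
  have pN : 0 ≤ r.τ * α * ‖vmean s.z‖ ^ 2 := by positivity
  unfold stepError
  -- Balance of the coefficients. The terms in `errZbar` and `errZ` cancel exactly. For `errV`, `-7
  -- + 3 + 2 + 1 + 2/3 = -1/3`. For `‖z̄‖²`, the drifts `1/144 + 1/36 + 1/16 + 1/48` leave `19/144`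
  -- of the available `1/4`. The terms in `errT` and `errX` are absorbed by `Lfgx ≤ Qc` and
  -- `phi_ge`.
  linear_combination wV + wT + wB + wZ + wX + bΦ + hsP + hE2 + 1 / 3 * pV + 3 / 2 * pT
    + 3 / 2 * pX1 + 2 * pX2 + 7 * pX3 + 19 / 144 * pN

end Lyapunov

/-! ### Measurability of the iterates -/

section Measurability

variable {m n p : ℕ} {S : Type*} {c : ClassConst} {μ ρ α : ℝ}
  {f g : Fin m → Vec n → Vec p → ℝ} {W : Matrix (Fin m) (Fin m) ℝ}
  {O : Oracle m n p S} {r : Coeffs} {t : StepSizes}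

/-- The components of a state. -/
def State.toProd (s : State m n p) :
    (Fin m → Vec n) × (Fin m → Vec p) × (Fin m → Vec p) × (Fin m → Vec n) × (Fin m → Vec n) :=
  (s.x, s.θ, s.v, s.z, s.y)

instance : MeasurableSpace (State m n p) := MeasurableSpace.comap State.toProd inferInstance

theorem State.measurable_toProd : Measurable (State.toProd (m := m) (n := n) (p := p)) :=
  comap_measurable _

theorem State.measurable_x : Measurable (State.x (m := m) (n := n) (p := p)) :=
  measurable_fst.comp State.measurable_toProd

theorem State.measurable_θ : Measurable (State.θ (m := m) (n := n) (p := p)) :=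
  measurable_fst.comp (measurable_snd.comp State.measurable_toProd)

theorem State.measurable_v : Measurable (State.v (m := m) (n := n) (p := p)) :=
  measurable_fst.comp (measurable_snd.comp (measurable_snd.comp State.measurable_toProd))

theorem State.measurable_z : Measurable (State.z (m := m) (n := n) (p := p)) :=
  measurable_fst.comp (measurable_snd.comp (measurable_snd.comp
    (measurable_snd.comp State.measurable_toProd)))

theorem State.measurable_y : Measurable (State.y (m := m) (n := n) (p := p)) :=
  measurable_snd.comp (measurable_snd.comp (measurable_snd.comp
    (measurable_snd.comp State.measurable_toProd)))

theorem State.measurable_mk {Ω : Type*} [MeasurableSpace Ω] {s : Ω → State m n p}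
    (hx : ∀ i, Measurable fun ω => (s ω).x i) (hθ : ∀ i, Measurable fun ω => (s ω).θ i)
    (hv : ∀ i, Measurable fun ω => (s ω).v i) (hz : ∀ i, Measurable fun ω => (s ω).z i)
    (hy : ∀ i, Measurable fun ω => (s ω).y i) : Measurable s :=
  measurable_comap_iff.2 ((measurable_pi_lambda _ hx).prodMk ((measurable_pi_lambda _ hθ).prodMk
    ((measurable_pi_lambda _ hv).prodMk ((measurable_pi_lambda _ hz).prodMk
      (measurable_pi_lambda _ hy)))))

theorem measurable_clm_apply {a b : ℕ} {X : Type*} [MeasurableSpace X]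
    {F : X → (Vec a →L[ℝ] Vec b)} {v : X → Vec a} (hF : Measurable F) (hv : Measurable v) :
    Measurable fun q => F q (v q) :=
  (isBoundedBilinearMap_apply (𝕜 := ℝ) (E := Vec a) (F := Vec b)).continuous.measurable.comp
    (hF.prodMk hv)

variable {Ω : Type*} [MeasurableSpace Ω] [MeasurableSpace S] {P : Measure Ω} {σ : Noise}
  {ζ : Channel → Fin m → ℕ → Ω → S}

theorem measurable_step (hS : StochasticAssumption P f g O σ ζ) {X : Type*} [MeasurableSpace X]
    {s : X → State m n p} {ξ : X → Channel → Fin m → S} (hs : Measurable s)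
    (hξ : ∀ a i, Measurable fun q => ξ q a i) : Measurable fun q => step W O t (ξ q) (s q) := by
  have hx := fun i => (measurable_pi_apply i).comp (State.measurable_x.comp hs)
  have hθ := fun i => (measurable_pi_apply i).comp (State.measurable_θ.comp hs)
  have hv := fun i => (measurable_pi_apply i).comp (State.measurable_v.comp hs)
  have hz := fun i => (measurable_pi_apply i).comp (State.measurable_z.comp hs)
  have hy := fun i => (measurable_pi_apply i).comp (State.measurable_y.comp hs)
  have hq := fun a i => (hx i).prodMk ((hθ i).prodMk (hξ a i))
  have hD : ∀ i, Measurable fun q => dirD O (ξ q) (s q) i := fun i =>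
    (hS.meas_gt i).comp (hq .gt i)
  have hH : ∀ i, Measurable fun q => dirH O (ξ q) (s q) i := fun i =>
    (measurable_clm_apply ((hS.meas_gtt i).comp (hq .gtt i)) (hv i)).sub
      ((hS.meas_ft i).comp (hq .ft i))
  have hG : ∀ i, Measurable fun q => dirS O (ξ q) (s q) i := fun i =>
    ((hS.meas_fx i).comp (hq .fx i)).sub
      (measurable_clm_apply ((hS.meas_gxt i).comp (hq .gxt i)) (hv i))
  have hZ : ∀ i, Measurable fun q => nextZ O t (ξ q) (s q) i := fun i =>
    (hG i).add (((hz i).sub (hG i)).fun_const_smul _)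
  exact State.measurable_mk
    (fun i => ((hx i).fun_const_smul _).add (((Finset.measurable_fun_sum _ fun j _ =>
      (hx j).fun_const_smul _).sub ((hy i).fun_const_smul _)).fun_const_smul _))
    (fun i => (hθ i).sub ((hD i).fun_const_smul _)) (fun i => (hv i).sub ((hH i).fun_const_smul _))
    hZ hZ

/-- The σ-algebra on the domain is arbitrary and only the samples before `k` are required to be
measurable, so the lemma also applies to the σ-algebra generated by the past. -/
theorem measurable_iterate (hS : StochasticAssumption P f g O σ ζ) (s₀ : State m n p)
    {X : Type*} {mX : MeasurableSpace X} {η : Channel → Fin m → ℕ → X → S} (k : ℕ)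
    (hη : ∀ a i, ∀ j < k, Measurable (η a i j)) :
    Measurable fun q => iterate W O t η s₀ q k := by
  induction k with
  | zero => exact measurable_const
  | succ k ih =>
    exact measurable_step hS (ih fun a i j hj => hη a i j (by omega))
      fun a i => hη a i k (by omega)

omit [MeasurableSpace Ω] [MeasurableSpace S] in
theorem iterate_y_eq_z (s₀ : State m n p) (h : s₀.y = s₀.z) (ω : Ω) (k : ℕ) :
    (iterate W O t ζ s₀ ω k).y = (iterate W O t ζ s₀ ω k).z := by
  cases k with
  | zero => exact h
  | succ k => rfl

/-- The iterate is a function of the samples with index below `k`, the other side of those with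
index `k`; disjoint blocks of an independent family are independent. -/
theorem indepFun_iterate (hS : StochasticAssumption P f g O σ ζ) (s₀ : State m n p) (k : ℕ) :
    IndepFun (fun ω => iterate W O t ζ s₀ ω k) (fun ω a i => ζ a i k ω) P := by
  let M : Channel × Fin m × ℕ → MeasurableSpace Ω := fun q =>
    MeasurableSpace.comap (ζ q.1 q.2.1 q.2.2) inferInstance
  have h := indep_iSup_of_disjoint (m := M) (S := {q | q.2.2 < k}) (T := {q | q.2.2 = k})
    (fun q => (hS.meas_sample _ _ _).comap_le) hS.indep
    (Set.disjoint_left.2 fun q h1 h2 => absurd h2 (ne_of_lt h1))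
  have hle : ∀ (U : Set (Channel × Fin m × ℕ)) (q) (_ : q ∈ U),
      Measurable[⨆ q ∈ U, M q] (ζ q.1 q.2.1 q.2.2) := fun U q hq =>
    (comap_measurable _).mono (le_iSup₂_of_le q hq le_rfl) le_rfl
  refine indep_of_indep_of_le_left (indep_of_indep_of_le_right h ?_) ?_
  · exact Measurable.comap_le (@measurable_pi_lambda _ _ _ (_) _ _ fun a =>
      @measurable_pi_lambda _ _ _ (_) _ _ fun i => hle _ (a, i, k) rfl)
  · exact Measurable.comap_le (measurable_iterate (X := Ω) (mX := _) hS s₀ k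
      fun a i j hj => hle _ (a, i, j) hj)

theorem measurable_xBar : Measurable (xBar (m := m) (n := n) (p := p)) :=
  (Finset.measurable_fun_sum _ fun i _ =>
    (measurable_pi_apply i).comp State.measurable_x).fun_const_smul _

theorem continuous_of_norm_sub_le {E F : Type*} [NormedAddCommGroup E] [NormedAddCommGroup F]
    {h : E → F} {K : ℝ} (hK : ∀ x y, ‖h x - h y‖ ≤ K * ‖x - y‖) : Continuous h :=
  (LipschitzWith.of_dist_le_mul (K := K.toNNReal) fun x y => by
    rw [dist_eq_norm, dist_eq_norm]
    exact (hK x y).trans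
      (mul_le_mul_of_nonneg_right (Real.le_coe_toNNReal K) (norm_nonneg _))).continuous

theorem continuous_meanGrad (hm : 0 < m) (hc : c.Pos) (hf : ∀ i, OuterAssumption c (f i) (g i))
    (hg : ∀ i, InnerAssumption c μ (g i)) (hμ : 0 < μ) : Continuous (meanGrad f g) :=
  continuous_of_norm_sub_le (meanGrad_lip hm hc hf hg hμ)

theorem measurable_avg {a : State m n p → Fin m → ℝ} (ha : ∀ i, Measurable fun s => a s i) :
    Measurable fun s => avg (a s) :=
  (Finset.measurable_fun_sum _ fun i _ => ha i).const_mul _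

theorem measurable_lyap (hm : 0 < m) (hc : c.Pos) (hf : ∀ i, OuterAssumption c (f i) (g i))
    (hg : ∀ i, InnerAssumption c μ (g i)) (hμ : 0 < μ) : Measurable (lyap c μ ρ r α f g) := by
  have hx := fun i => (measurable_pi_apply i).comp (State.measurable_x (m := m) (n := n) (p := p))
  have hθ := fun i => (measurable_pi_apply i).comp (State.measurable_θ (m := m) (n := n) (p := p))
  have hv := fun i => (measurable_pi_apply i).comp (State.measurable_v (m := m) (n := n) (p := p))
  have hz := fun i => (measurable_pi_apply i).comp (State.measurable_z (m := m) (n := n) (p := p))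
  have hb := measurable_xBar (m := m) (n := n) (p := p)
  have h0 : Continuous (objective f g) := continuous_iff_continuousAt.2 fun x =>
    (hasGradientAt_objective hf hg hμ x).hasFDerivAt.continuousAt
  have h1 := fun i => continuous_of_norm_sub_le (vStar_lip hc (hf i) (hg i) hμ)
  have h2 := fun i => continuous_of_norm_sub_le ((hg i).innerSol_lip hμ)
  have h3 := fun i => continuous_of_norm_sub_le (hyperGrad_lip hc (hf i) (hg i) hμ)
  have h4 := continuous_meanGrad hm hc hf hg hμ
  have h5 : Measurable fun s : State m n p => vmean s.z :=
    (Finset.measurable_fun_sum _ fun i _ => hz i).fun_const_smul _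
  refine (((((h0.measurable.comp hb).add (Measurable.const_mul ?_ _)).add
    (Measurable.const_mul ?_ _)).add (Measurable.const_mul ?_ _)).add
      (Measurable.const_mul ?_ _)).add (Measurable.const_mul ?_ _)
  · exact measurable_avg fun i => ((hv i).sub ((h1 i).measurable.comp hb)).norm.pow_const 2
  · exact measurable_avg fun i => ((hθ i).sub ((h2 i).measurable.comp hb)).norm.pow_const 2
  · exact ((h4.measurable.comp hb).sub h5).norm.pow_const 2
  · exact measurable_avg fun i => (((h3 i).measurable.comp hb).sub (hz i)).norm.pow_const 2
  · exact measurable_avg fun i => ((hx i).sub hb).norm.pow_const 2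

end Measurability

/-! ### Descent along the iterates -/

section Descent

variable {Ω S T : Type*} [MeasurableSpace Ω] [MeasurableSpace S] [MeasurableSpace T]
  {P : Measure Ω} [IsProbabilityMeasure P]

/-- Freezing: with `X` the current state and `Y` the fresh samples, a bound valid at every fixed
state can be integrated over the law of the iterates. -/
theorem lintegral_eq_of_indepFun {X : Ω → S} {Y : Ω → T} (hX : Measurable X) (hY : Measurable Y)
    (h : IndepFun X Y P) {F : S × T → ENNReal} (hF : Measurable F) :
    ∫⁻ ω, F (X ω, Y ω) ∂P = ∫⁻ ω, ∫⁻ ω', F (X ω, Y ω') ∂P ∂P := by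
  rw [← lintegral_map hF (hX.prodMk hY), (indepFun_iff_map_prod_eq_prod_map_map hX.aemeasurable
    hY.aemeasurable).1 h, lintegral_prod _ hF.aemeasurable,
    lintegral_map hF.lintegral_prod_right' hX]
  refine lintegral_congr fun ω => ?_
  exact lintegral_map (hF.comp measurable_prodMk_left) hY

/-- A nonnegative supermartingale-type recursion, in extended nonnegative reals. -/
theorem add_sum_le_of_step {a d : ℕ → ENNReal} {e : ENNReal} (h : ∀ k, a (k + 1) + d k ≤ a k + e)
    (k : ℕ) : a k + ∑ j ∈ Finset.range k, d j ≤ a 0 + k * e := by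
  induction k with
  | zero => simp
  | succ k ih =>
    rw [Finset.sum_range_succ]
    calc a (k + 1) + (∑ j ∈ Finset.range k, d j + d k)
        = (a (k + 1) + d k) + ∑ j ∈ Finset.range k, d j := by ring
      _ ≤ (a k + e) + ∑ j ∈ Finset.range k, d j := add_le_add_left (h k) _
      _ = (a k + ∑ j ∈ Finset.range k, d j) + e := by ring
      _ ≤ a 0 + k * e + e := by gcongr
      _ = a 0 + (k + 1 : ℕ) * e := by push_cast; ring

variable {m n p : ℕ} {c : ClassConst} {μ bf bg clo chi α Φlow : ℝ}
  {f g : Fin m → Vec n → Vec p → ℝ} {G : SimpleGraph (Fin m)} {W : Matrix (Fin m) (Fin m) ℝ}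
  {O : Oracle m n p S} {r : Coeffs} {σ : Noise} {ζ : Channel → Fin m → ℕ → Ω → S}

theorem le_lyap (hc : c.Pos) (hμ : 0 < μ) (hlo : 0 < clo) (hr : Coeffs.Admissible c μ clo chi r)
    {ρ : ℝ} (hρ : ρ < 1) (hα : 0 ≤ α) (hlow : ∀ x, Φlow ≤ objective f g x) (s : State m n p) :
    Φlow ≤ lyap c μ ρ r α f g s := by
  have h1 := mul_nonneg (d1_pos hc hμ hlo hr).le (errV_nonneg f g s)
  have h2 := mul_nonneg (d2_pos hc hμ hlo hr).le (errT_nonneg g s)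
  have h3 := mul_nonneg (d3_pos hlo hr).le (errZbar_nonneg f g s)
  have h4 := mul_nonneg (d4_nonneg (μ := μ) (ρ := ρ) (α := α) hc hlo hr) (errZ_nonneg f g s)
  have h5 : 0 ≤ 4 * phi c μ * α / (1 - ρ) * errX s :=
    mul_nonneg (div_nonneg (mul_nonneg (by linarith [phi_pos (μ := μ) hc]) hα) (by linarith))
      (errX_nonneg s)
  have := hlow (xBar s)
  unfold lyap
  linarith

omit [IsProbabilityMeasure P] in
theorem lintegral_ofReal_add_le {F : Ω → ℝ} {b d e : ℝ} (hF : Integrable F P) (h0 : ∀ ω, 0 ≤ F ω)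
    (hd : 0 ≤ d) (hb : 0 ≤ b) (he : 0 ≤ e) (h : ∫ ω, F ω ∂P + d ≤ b + e) :
    ∫⁻ ω, ENNReal.ofReal (F ω) ∂P + ENNReal.ofReal d ≤ ENNReal.ofReal b + ENNReal.ofReal e := by
  rw [← ofReal_integral_eq_lintegral_ofReal hF (ae_of_all _ h0),
    ← ENNReal.ofReal_add (integral_nonneg h0) hd, ← ENNReal.ofReal_add hb he]
  exact ENNReal.ofReal_le_ofReal h

theorem stepError_nonneg (hc : c.Pos) (hμ : 0 < μ) {ρ : ℝ} (hτ : 0 < r.τ) (hα : 0 ≤ α) :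
    0 ≤ stepError c μ ρ σ r m bf bg α := by
  have := (phi_pos (μ := μ) hc).le
  have hb : 0 ≤ bSq c μ bf bg := by unfold bSq; positivity
  unfold stepError
  positivity

/-- The recursion runs in extended nonnegative reals, after subtraction of `Φlow`, because
integrability along the iterates is not known beforehand. The finite bound obtained then yields
integrability of the squared gradients and the return to real integrals. -/
theorem sum_integral_grad_le (hm : 0 < m) (hc : c.Pos) (hf : ∀ i, OuterAssumption c (f i) (g i))
    (hg : ∀ i, InnerAssumption c μ (g i)) (hμ : 0 < μ) (hμL : μ ≤ c.Lgt)
    (hh : Heterogeneity bf bg f g) (hW : NetworkAssumption G W)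
    (hS : StochasticAssumption P f g O σ ζ) (hlo : 0 < clo)
    (hr : Coeffs.Admissible c μ clo chi r) (hgt : 0 ≤ σ.gt) (hgtt : 0 < σ.gtt)
    (hgxt : 0 < σ.gxt) (hft : 0 ≤ σ.ft) (hfx : 0 ≤ σ.fx)
    (hα : StepBound c μ (netRho W) σ r m α) (hlow : ∀ x, Φlow ≤ objective f g x)
    (s₀ : State m n p) (hs₀ : s₀.y = s₀.z) :
    (∀ k, Integrable (fun ω =>
      ‖meanGrad f g (xBar (iterate W O (r.toSteps α) ζ s₀ ω k))‖ ^ 2) P) ∧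
    ∀ k : ℕ, r.τ * α / 2 * ∑ j ∈ Finset.range k,
      ∫ ω, ‖meanGrad f g (xBar (iterate W O (r.toSteps α) ζ s₀ ω j))‖ ^ 2 ∂P
        ≤ lyap c μ (netRho W) r α f g s₀ - Φlow
          + k * stepError c μ (netRho W) σ r m bf bg α := by
  set E := stepError c μ (netRho W) σ r m bf bg α
  have hα0 := hα.pos
  have hτ := hr.tau_pos
  have hE : 0 ≤ E := stepError_nonneg hc hμ hτ hα0.le
  have hge := le_lyap hc hμ hlo hr hW.rho_lt_one hα0.le hlow
  set N : State m n p → ℝ := fun s => r.τ * α / 2 * ‖meanGrad f g (xBar s)‖ ^ 2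
  have hN : ∀ s, 0 ≤ N s := fun s => by positivity
  have mN : Measurable N :=
    (((continuous_meanGrad hm hc hf hg hμ).measurable.comp measurable_xBar).norm.pow_const
      2).const_mul _
  have mL : Measurable fun s => ENNReal.ofReal (lyap c μ (netRho W) r α f g s - Φlow) :=
    ((measurable_lyap hm hc hf hg hμ).sub_const _).ennreal_ofReal
  set it : ℕ → Ω → State m n p := fun k ω => iterate W O (r.toSteps α) ζ s₀ ω k
  have mit : ∀ k, Measurable (it k) := fun k =>
    measurable_iterate hS s₀ k fun a i j _ => hS.meas_sample a i j
  have mζ : ∀ k, Measurable fun ω a i => ζ a i k ω := fun k =>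
    measurable_pi_lambda _ fun a => measurable_pi_lambda _ fun i => hS.meas_sample a i k
  have key := add_sum_le_of_step
    (a := fun k => ∫⁻ ω, ENNReal.ofReal (lyap c μ (netRho W) r α f g (it k ω) - Φlow) ∂P)
    (d := fun k => ∫⁻ ω, ENNReal.ofReal (N (it k ω)) ∂P) (e := ENNReal.ofReal E) fun k => by
      have h1 := lintegral_eq_of_indepFun (mit k) (mζ k) (indepFun_iterate hS s₀ k)
        (F := fun q => ENNReal.ofReal
          (lyap c μ (netRho W) r α f g (step W O (r.toSteps α) q.2 q.1) - Φlow))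
        (mL.comp (measurable_step hS measurable_fst fun a i =>
          (measurable_pi_apply i).comp ((measurable_pi_apply a).comp measurable_snd)))
      change ∫⁻ ω, ENNReal.ofReal (lyap c μ (netRho W) r α f g
        (step W O (r.toSteps α) (fun a i => ζ a i k ω) (it k ω)) - Φlow) ∂P + _ ≤ _
      have mNk : Measurable fun ω => ENNReal.ofReal (N (it k ω)) :=
        (mN.comp (mit k)).ennreal_ofReal
      rw [h1, ← lintegral_add_right _ mNk]
      calc _ ≤ ∫⁻ ω, (ENNReal.ofReal (lyap c μ (netRho W) r α f g (it k ω) - Φlow)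
            -- At the outer `ω` the iterate is a fixed state, to which the one-step bound applies
            -- pointwise.
            + ENNReal.ofReal E) ∂P := lintegral_mono fun ω => by
              obtain ⟨hi, hb⟩ := lyap_step hm hc hf hg hμ hμL hh hW hS hlo hr hgt hgtt hgxt hft
                hfx hα (it k ω) (iterate_y_eq_z s₀ hs₀ ω k) k
              refine lintegral_ofReal_add_le (hi.sub (integrable_const Φlow))
                (fun ω' => sub_nonneg.2 (hge _)) (hN _) (sub_nonneg.2 (hge _)) hE ?_
              rw [integral_sub hi (integrable_const _), integral_const, probReal_univ, one_smul]
              change _ - _ + r.τ * α / 2 * ‖meanGrad f g (xBar (it k ω))‖ ^ 2 ≤ _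
              linarith
        _ = _ := by rw [lintegral_add_right _ measurable_const]; simp
  have hfin : ∀ k, ∑ j ∈ Finset.range k, ∫⁻ ω, ENNReal.ofReal (N (it j ω)) ∂P ≤
      ENNReal.ofReal (lyap c μ (netRho W) r α f g s₀ - Φlow + k * E) := fun k => by
    refine (le_add_self.trans (key k)).trans_eq ?_
    have : ∀ ω, it 0 ω = s₀ := fun _ => rfl
    simp only [this, lintegral_const, measure_univ, mul_one]
    rw [ENNReal.ofReal_add (sub_nonneg.2 (hge _)) (by positivity),
      ENNReal.ofReal_mul (Nat.cast_nonneg k), ENNReal.ofReal_natCast]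
  have iN : ∀ k, Integrable (fun ω => N (it k ω)) P := fun k => by
    refine (lintegral_ofReal_ne_top_iff_integrable (mN.comp (mit k)).aestronglyMeasurable
      (ae_of_all _ fun ω => hN _)).1 (ne_top_of_le_ne_top ENNReal.ofReal_ne_top
        ((Finset.single_le_sum (f := fun j => ∫⁻ ω, ENNReal.ofReal (N (it j ω)) ∂P)
          (fun _ _ => zero_le) (Finset.self_mem_range_succ k)).trans (hfin (k + 1))))
  refine ⟨fun k => ?_, fun k => ?_⟩
  · refine (integrable_const_mul_iff (c := r.τ * α / 2) ?_ _).1 (iN k)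
    exact IsUnit.mk0 _ (by positivity)
  · have h := hfin k
    simp only [← fun j => ofReal_integral_eq_lintegral_ofReal (iN j) (ae_of_all _ fun ω => hN _)]
      at h
    rw [← ENNReal.ofReal_sum_of_nonneg fun j _ => integral_nonneg fun ω => hN _,
      ENNReal.ofReal_le_ofReal_iff (add_nonneg (sub_nonneg.2 (hge _)) (by positivity))] at h
    rw [Finset.mul_sum]
    simpa only [N, integral_const_mul] using h

end Descent

/-! ### Orders in the condition number -/

section Orders

variable {c : ClassConst} {μ : ℝ}

theorem kappa_eq (c : ClassConst) (μ : ℝ) : kappa c μ = kappa c 1 * (1 / μ) := by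
  unfold kappa; ring

theorem kappa_one_pos (hc : c.Pos) : 0 < kappa c 1 := by
  rw [kappa, div_one]
  exact lt_max_of_lt_left hc.Lfx

theorem one_le_kappa (hμ : 0 < μ) (hμL : μ ≤ c.Lgt) : 1 ≤ kappa c μ := by
  rw [kappa, one_le_div hμ]
  exact hμL.trans ((le_max_left _ _).trans ((le_max_right _ _).trans (le_max_right _ _)))

/-- The nonnegative function `q` of the strong convexity modulus is of order at most `κ ^ k`. -/
def OrderLE (c : ClassConst) (q : ℝ → ℝ) (k : ℕ) : Prop :=
  ∃ C : ℝ, 0 < C ∧ ∀ μ : ℝ, 0 < μ → μ ≤ c.Lgt → 0 ≤ q μ ∧ q μ ≤ C * kappa c μ ^ k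

namespace OrderLE

variable {q q' : ℝ → ℝ} {k k' : ℕ}

theorem const {a : ℝ} (ha : 0 ≤ a) : OrderLE c (fun _ => a) 0 :=
  ⟨a + 1, by positivity, fun μ _ _ => ⟨ha, by simp⟩⟩

theorem inv (hc : c.Pos) : OrderLE c (fun μ => 1 / μ) 1 := by
  refine ⟨1 / kappa c 1, one_div_pos.2 (kappa_one_pos hc), fun μ hμ _ => ⟨by positivity, ?_⟩⟩
  have := (kappa_one_pos hc).ne'
  rw [kappa_eq c μ, pow_one]
  exact le_of_eq (by field_simp)

theorem mul (h : OrderLE c q k) (h' : OrderLE c q' k') :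
    OrderLE c (fun μ => q μ * q' μ) (k + k') := by
  obtain ⟨C, hC, h⟩ := h
  obtain ⟨C', hC', h'⟩ := h'
  refine ⟨C * C', by positivity, fun μ hμ hL => ⟨mul_nonneg (h μ hμ hL).1 (h' μ hμ hL).1, ?_⟩⟩
  have := one_le_kappa hμ hL
  calc _ ≤ (C * kappa c μ ^ k) * (C' * kappa c μ ^ k') :=
        mul_le_mul (h μ hμ hL).2 (h' μ hμ hL).2 (h' μ hμ hL).1 (by positivity)
    _ = _ := by ring

theorem mono (h : OrderLE c q k) (hk : k ≤ k') : OrderLE c q k' := by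
  obtain ⟨C, hC, h⟩ := h
  refine ⟨C, hC, fun μ hμ hL => ⟨(h μ hμ hL).1, (h μ hμ hL).2.trans ?_⟩⟩
  exact mul_le_mul_of_nonneg_left (pow_le_pow_right₀ (one_le_kappa hμ hL) hk) hC.le

theorem add' (h : OrderLE c q k) (h' : OrderLE c q' k) : OrderLE c (fun μ => q μ + q' μ) k := by
  obtain ⟨C, hC, h⟩ := h
  obtain ⟨C', hC', h'⟩ := h'
  refine ⟨C + C', by positivity, fun μ hμ hL => ⟨add_nonneg (h μ hμ hL).1 (h' μ hμ hL).1, ?_⟩⟩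
  rw [add_mul]
  exact add_le_add (h μ hμ hL).2 (h' μ hμ hL).2

theorem add (h : OrderLE c q k) (h' : OrderLE c q' k') :
    OrderLE c (fun μ => q μ + q' μ) (max k k') :=
  (h.mono (le_max_left _ _)).add' (h'.mono (le_max_right _ _))

theorem congr (h : OrderLE c q k) (hq : ∀ μ, 0 < μ → q' μ = q μ) : OrderLE c q' k := by
  obtain ⟨C, hC, h⟩ := h
  exact ⟨C, hC, fun μ hμ hL => hq μ hμ ▸ h μ hμ hL⟩

theorem pow (h : OrderLE c q k) : ∀ j : ℕ, OrderLE c (fun μ => q μ ^ j) (k * j)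
  | 0 => by simpa using const zero_le_one
  | j + 1 => by simpa only [pow_succ, Nat.mul_succ] using (h.pow j).mul h

theorem sqrt (h : OrderLE c q (2 * k)) : OrderLE c (fun μ => √(q μ)) k := by
  obtain ⟨C, hC, h⟩ := h
  refine ⟨√C, Real.sqrt_pos.2 hC, fun μ hμ hL => ⟨Real.sqrt_nonneg _, ?_⟩⟩
  have := one_le_kappa hμ hL
  calc _ ≤ √(C * kappa c μ ^ (2 * k)) := Real.sqrt_le_sqrt (h μ hμ hL).2
    _ = _ := by rw [Real.sqrt_mul hC.le, mul_comm 2 k, pow_mul, Real.sqrt_sq (by positivity)]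

end OrderLE

open OrderLE

theorem orderLE_LthetaStar (hc : c.Pos) : OrderLE c (LthetaStar c) 1 :=
  ((const hc.Cgxt.le).mul (inv hc)).congr fun μ _ => by unfold LthetaStar; ring

theorem orderLE_Mv (hc : c.Pos) : OrderLE c (Mv c) 1 :=
  ((const hc.Cft.le).mul (inv hc)).congr fun μ _ => by unfold Mv; ring

theorem orderLE_Lv (hc : c.Pos) : OrderLE c (Lv c) 2 :=
  (((const hc.Lft.le).mul (inv hc)).add
    ((const (mul_pos hc.Cft hc.Lgtt).le).mul ((inv hc).pow 2))).congr fun μ _ => by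
      unfold Lv; ring

theorem orderLE_LvStar (hc : c.Pos) : OrderLE c (LvStar c) 3 :=
  (orderLE_Lv hc).mul ((const zero_le_one).add (orderLE_LthetaStar hc))

theorem orderLE_Lhyper (hc : c.Pos) : OrderLE c (Lhyper c) 3 :=
  ((((const hc.Lfx.le).add ((const hc.Cgxt.le).mul (orderLE_Lv hc))).add
    ((const (mul_pos hc.Cft hc.Lgxt).le).mul (inv hc))).mul
      ((const zero_le_one).add (orderLE_LthetaStar hc))).congr fun μ _ => by unfold Lhyper; ring

theorem orderLE_Lfgx (hc : c.Pos) : OrderLE c (Lfgx c) 2 :=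
  ((const (by positivity : 0 ≤ 2 * c.Lfx ^ 2)).add
    ((const (by positivity : 0 ≤ 4 * c.Lgxt ^ 2)).mul ((orderLE_Mv hc).pow 2))).congr
      fun μ _ => by unfold Lfgx; ring

theorem orderLE_Lfgt (hc : c.Pos) : OrderLE c (Lfgt c) 2 :=
  ((const (by positivity : 0 ≤ 2 * c.Lft ^ 2)).add
    ((const (by positivity : 0 ≤ 4 * c.Lgtt ^ 2)).mul ((orderLE_Mv hc).pow 2))).congr
      fun μ _ => by unfold Lfgt; ring

theorem orderLE_Qc (hc : c.Pos) : OrderLE c (Qc c) 4 :=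
  ((orderLE_Lfgx hc).add (((const (by positivity : 0 ≤ 32 * c.Cgxt ^ 2)).mul
    (orderLE_Lfgt hc)).mul ((inv hc).pow 2))).congr fun μ _ => by unfold Qc; ring

/-- Since `1/ω = 2/Lgt + 2/μ`. -/
theorem orderLE_inv_omegaT (hc : c.Pos) : OrderLE c (fun μ => 1 / omegaT c μ) 1 := by
  have hL := hc.Lgt
  refine ((const (by positivity : 0 ≤ 2 / c.Lgt)).add ((const zero_le_two).mul (inv hc))).congr
    fun μ hμ => ?_
  unfold omegaT
  field_simp

theorem orderLE_phi (hc : c.Pos) : OrderLE c (phi c) 6 :=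
  ((orderLE_Qc hc).mul ((const zero_le_one).add
    ((const (by positivity : 0 ≤ 4 * max c.Lgt c.Cgxt ^ 2)).mul
      ((orderLE_inv_omegaT hc).pow 2)))).congr fun μ _ => by unfold phi; ring

theorem orderLE_sqrt_Qc (hc : c.Pos) : OrderLE c (fun μ => √(Qc c μ)) 2 :=
  (orderLE_Qc hc).sqrt (k := 2)

theorem bSq_le (hc : c.Pos) : ∃ C : ℝ, 0 < C ∧ ∀ μ bf bg : ℝ, 0 < μ → μ ≤ c.Lgt →
    bSq c μ bf bg ≤ C * (kappa c μ ^ 2 * bf ^ 2 + kappa c μ ^ 6 * bg ^ 2) := by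
  obtain ⟨C, hC, h⟩ : OrderLE c (fun μ => 4 + 4 * c.Cgxt ^ 2 / μ ^ 2) 2 :=
    ((const (by norm_num : (0 : ℝ) ≤ 4)).add ((const (by positivity : 0 ≤ 4 * c.Cgxt ^ 2)).mul
      ((inv hc).pow 2))).congr fun μ _ => by ring
  obtain ⟨C', hC', h'⟩ : OrderLE c (fun μ => 4 * (4 * (c.Cft ^ 2 * c.Cgxt ^ 2 / μ ^ 4)
      + 4 * (c.Cft ^ 2 / μ ^ 2) + c.Lfx ^ 2 / μ ^ 2 + c.Lft ^ 2 * c.Cgxt ^ 2 / μ ^ 4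
      + 4 * (c.Cft ^ 2 * c.Cgxt ^ 2 * c.Lgtt ^ 2 / μ ^ 6)
      + 4 * (c.Cft ^ 2 * c.Lgxt ^ 2 / μ ^ 4))) 6 :=
    ((((const (by positivity :
        0 ≤ 16 * c.Cft ^ 2 * c.Cgxt ^ 2 + 4 * c.Lft ^ 2 * c.Cgxt ^ 2
          + 16 * c.Cft ^ 2 * c.Lgxt ^ 2)).mul ((inv hc).pow 4)).add
      ((const (by positivity : 0 ≤ 16 * c.Cft ^ 2 + 4 * c.Lfx ^ 2)).mul ((inv hc).pow 2))).add
      ((const (by positivity : 0 ≤ 16 * (c.Cft ^ 2 * c.Cgxt ^ 2 * c.Lgtt ^ 2))).mul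
        ((inv hc).pow 6))).congr fun μ _ => by ring
  refine ⟨C + C', by positivity, fun μ bf bg hμ hL => ?_⟩
  have h1 := mul_le_mul_of_nonneg_right (h μ hμ hL).2 (sq_nonneg bf)
  have h2 := mul_le_mul_of_nonneg_right (h' μ hμ hL).2 (sq_nonneg bg)
  have hκ := one_le_kappa hμ hL
  have h3 : 0 ≤ C' * (kappa c μ ^ 2 * bf ^ 2) := by positivity
  have h4 : 0 ≤ C * (kappa c μ ^ 6 * bg ^ 2) := by positivity
  unfold bSq
  linarith

/-- The coefficients of `τ` in the three lower bounds are `O(κ⁴)`, so `τ` of order `κ⁻⁴` allows all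
the ratios to be equal to 1. -/
theorem exists_admissible (hc : c.Pos) : ∃ clo chi : ℝ, 0 < clo ∧ clo ≤ chi ∧
    ∀ μ : ℝ, 0 < μ → μ ≤ c.Lgt → ∃ r : Coeffs, Coeffs.Admissible c μ clo chi r := by
  obtain ⟨C₁, hC₁, h₁⟩ : OrderLE c (fun μ => 48 * LvStar c μ * c.Cgxt / μ) 4 :=
    (((orderLE_LvStar hc).mul (const (by have := hc.Cgxt; positivity : 0 ≤ 48 * c.Cgxt))).mul
      (inv hc)).congr fun μ _ => by ring
  obtain ⟨C₂, hC₂, h₂⟩ : OrderLE c (fun μ => 6 * LthetaStar c μ / omegaT c μ * √(Qc c μ)) 4 :=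
    ((((const (by norm_num : (0 : ℝ) ≤ 6)).mul (orderLE_LthetaStar hc)).mul
      (orderLE_inv_omegaT hc)).mul (orderLE_sqrt_Qc hc)).congr fun μ _ => by ring
  obtain ⟨C₃, hC₃, h₃⟩ : OrderLE c (fun μ => 4 * Lhyper c μ) 4 :=
    ((const (by norm_num : (0 : ℝ) ≤ 4)).mul (orderLE_Lhyper hc)).mono (by norm_num)
  -- `D` exceeds each of the three order constants, and the summand 2 forces `τ = 1/(D κ⁴) < 1`.
  set D := 2 + C₁ + C₂ + C₃
  have hD : 1 < D := by simp only [D]; linarith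
  have hD0 : 0 < D := by linarith
  have hD1 : 1 / D ≤ 1 := (div_le_one hD0).2 hD.le
  refine ⟨1 / D, 1, by positivity, hD1, fun μ hμ hL => ?_⟩
  have hκ : 0 < kappa c μ ^ 4 := pow_pos (one_pos.trans_le (one_le_kappa hμ hL)) 4
  have key : ∀ C q : ℝ, C ≤ D → q ≤ C * kappa c μ ^ 4 → q * (1 / D / kappa c μ ^ 4) ≤ 1 := by
    intro C q hC hq
    rw [div_div, mul_one_div, div_le_one (by positivity)]
    exact hq.trans (mul_le_mul_of_nonneg_right hC hκ.le)
  refine ⟨⟨1 / D / kappa c μ ^ 4, 1, 1, 1⟩, by positivity, ?_, ?_, ?_, ?_, le_rfl,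
    ⟨hD1, le_rfl⟩, ⟨hD1, le_rfl⟩, ⟨hD1, le_rfl⟩⟩
  · change 1 / D / kappa c μ ^ 4 < 1
    rw [div_lt_one hκ]
    exact ((div_lt_one hD0).2 hD).trans_le (one_le_pow₀ (one_le_kappa hμ hL))
  · exact key C₁ _ (by simp only [D]; linarith) (h₁ μ hμ hL).2
  · exact key C₂ _ (by simp only [D]; linarith) (h₂ μ hμ hL).2
  · exact key C₃ _ (by simp only [D]; linarith) (h₃ μ hμ hL).2

end Orders

/-! ### Orders of the coefficients -/

section CoeffOrders

variable {c : ClassConst} {μ ρ clo chi : ℝ} {r : Coeffs} {σ : Noise}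

theorem inv_tau_le (hlo : 0 < clo) (hr : Coeffs.Admissible c μ clo chi r)
    (hμ : 0 < μ) (hμL : μ ≤ c.Lgt) : 1 / r.τ ≤ 1 / clo * kappa c μ ^ 4 := by
  have hκ : 0 < kappa c μ ^ 4 := pow_pos (one_pos.trans_le (one_le_kappa hμ hμL)) 4
  have h := one_div_le_one_div_of_le (by positivity) hr.tau_order
  rw [one_div_div] at h
  exact h.trans_eq (by ring)

theorem d1_div_tau_le (hc : c.Pos) (hlo : 0 < clo) : ∃ C : ℝ, 0 < C ∧ ∀ (μ chi : ℝ) (r : Coeffs),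
    0 < μ → μ ≤ c.Lgt → Coeffs.Admissible c μ clo chi r → d1 c μ r / r.τ ≤ C * kappa c μ := by
  obtain ⟨C, hC, h⟩ := (OrderLE.const (c := c) (by positivity : 0 ≤ 8 * c.Cgxt ^ 2)).mul
    (OrderLE.inv hc)
  refine ⟨C / clo, by positivity, fun μ chi r hμ hL hr => ?_⟩
  have h1 := h μ hμ hL
  have hτ := hr.tau_pos
  have hcl := hr.clam_pos hlo
  calc d1 c μ r / r.τ = 8 * c.Cgxt ^ 2 * (1 / μ) / r.clam := by unfold d1; field_simp
    _ ≤ C * kappa c μ ^ (0 + 1) / clo := div_le_div₀ (h1.1.trans h1.2) h1.2 hlo hr.clam_order.1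
    _ = _ := by ring

theorem d2_div_tau_le (hc : c.Pos) (hlo : 0 < clo) : ∃ C : ℝ, 0 < C ∧ ∀ (μ chi : ℝ) (r : Coeffs),
    0 < μ → μ ≤ c.Lgt → Coeffs.Admissible c μ clo chi r →
    d2 c μ r / r.τ ≤ C * kappa c μ ^ 5 := by
  obtain ⟨C, hC, h⟩ := (orderLE_Qc hc).mul (orderLE_inv_omegaT hc)
  refine ⟨C / clo, by positivity, fun μ chi r hμ hL hr => ?_⟩
  have h1 := h μ hμ hL
  have hτ := hr.tau_pos
  have hcl := hr.cbet_pos hlo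
  have hω := omegaT_pos hc hμ
  calc d2 c μ r / r.τ = Qc c μ * (1 / omegaT c μ) / r.cbet := by unfold d2; field_simp
    _ ≤ C * kappa c μ ^ (4 + 1) / clo := div_le_div₀ (h1.1.trans h1.2) h1.2 hlo hr.cbet_order.1
    _ = _ := by ring

theorem d3_div_tau_le (hlo : 0 < clo) (hr : Coeffs.Admissible c μ clo chi r) :
    d3 r / r.τ ≤ 1 / clo := by
  have hτ := hr.tau_pos
  have hcg := hr.cgam_pos hlo
  have := hr.cgam_order.1
  calc d3 r / r.τ = 1 / (2 * r.cgam) := by unfold d3; field_simp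
    _ ≤ _ := one_div_le_one_div_of_le hlo (by linarith)

theorem sigmaP_le (hc : c.Pos) (hlo : 0 < clo) (hhi : clo ≤ chi) : ∃ C : ℝ, 0 < C ∧
    ∀ (μ : ℝ) (σ : Noise) (r : Coeffs), 0 < μ → μ ≤ c.Lgt → Coeffs.Admissible c μ clo chi r →
    0 ≤ σ.gt → 0 < σ.gtt → 0 ≤ σ.ft →
    sigmaP c μ σ r ≤ C * (kappa c μ ^ (1 / 2 : ℝ) * σ.ft + kappa c μ ^ (3 / 2 : ℝ) * σ.gtt
      + kappa c μ ^ (5 / 2 : ℝ) * σ.gt) := by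
  obtain ⟨C₁, hC₁, h₁⟩ := d1_div_tau_le hc hlo
  obtain ⟨C₂, hC₂, h₂⟩ := d2_div_tau_le hc hlo
  obtain ⟨C₃, hC₃, h₃⟩ := orderLE_Mv hc
  have hchi : 0 < chi := hlo.trans_le hhi
  refine ⟨√C₁ * chi + 2 * √C₁ * C₃ * chi + √C₂ * chi, by positivity,
    fun μ σ r hμ hL hr hgt hgtt hft => ?_⟩
  have hκ := one_pos.trans_le (one_le_kappa hμ hL)
  set κ := kappa c μ
  have e1 : √κ = κ ^ (1 / 2 : ℝ) := Real.sqrt_eq_rpow κ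
  have e2 : κ ^ (1 / 2 : ℝ) * κ = κ ^ (3 / 2 : ℝ) := by
    rw [← Real.rpow_add_one hκ.ne']; norm_num
  have e3 : √(κ ^ 5) = κ ^ (5 / 2 : ℝ) := by
    rw [Real.sqrt_eq_rpow, ← Real.rpow_natCast, ← Real.rpow_mul hκ.le]; norm_num
  have s1 : √(d1 c μ r / r.τ) ≤ √C₁ * κ ^ (1 / 2 : ℝ) := by
    rw [← e1, ← Real.sqrt_mul hC₁.le]
    exact Real.sqrt_le_sqrt (h₁ μ chi r hμ hL hr)
  have s2 : √(d2 c μ r / r.τ) ≤ √C₂ * κ ^ (5 / 2 : ℝ) := by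
    rw [← e3, ← Real.sqrt_mul hC₂.le]
    exact Real.sqrt_le_sqrt (h₂ μ chi r hμ hL hr)
  have hM := Mv_pos hc hμ
  have hM' : Mv c μ ≤ C₃ * κ := by simpa using (h₃ μ hμ hL).2
  have hcl := hr.clam_pos hlo
  have hcb := hr.cbet_pos hlo
  have p1 : 0 ≤ κ ^ (1 / 2 : ℝ) := by positivity
  have p2 : 0 ≤ κ ^ (3 / 2 : ℝ) := by positivity
  have p3 : 0 ≤ κ ^ (5 / 2 : ℝ) := by positivity
  calc sigmaP c μ σ r ≤ √C₁ * κ ^ (1 / 2 : ℝ) * (σ.ft + 2 * (C₃ * κ) * σ.gtt) * chi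
        + √C₂ * κ ^ (5 / 2 : ℝ) * σ.gt * chi := by
        unfold sigmaP
        gcongr
        exacts [hr.clam_order.2, hr.cbet_order.2]
    _ = √C₁ * chi * (κ ^ (1 / 2 : ℝ) * σ.ft)
        + 2 * √C₁ * C₃ * chi * (κ ^ (1 / 2 : ℝ) * κ * σ.gtt)
        + √C₂ * chi * (κ ^ (5 / 2 : ℝ) * σ.gt) := by ring
    _ ≤ _ := by
        rw [e2]
        have a1 := mul_nonneg p1 hft
        have a2 := mul_nonneg p2 hgtt.le
        have a3 := mul_nonneg p3 hgt
        have b1 : 0 ≤ √C₁ * chi := by positivity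
        have b2 : 0 ≤ 2 * √C₁ * C₃ * chi := by positivity
        have b3 : 0 ≤ √C₂ * chi := by positivity
        have := mul_nonneg b1 a2; have := mul_nonneg b1 a3
        have := mul_nonneg b2 a1; have := mul_nonneg b2 a3
        have := mul_nonneg b3 a1; have := mul_nonneg b3 a2
        linarith

theorem sigmaC_le (hc : c.Pos) (hlo : 0 < clo) (hhi : clo ≤ chi) : ∃ C : ℝ, 0 < C ∧
    ∀ (μ : ℝ) (σ : Noise) (r : Coeffs), 0 < μ → μ ≤ c.Lgt → Coeffs.Admissible c μ clo chi r →
    0 < σ.gxt → 0 ≤ σ.fx → sigmaC c μ σ r ≤ C * (σ.fx + kappa c μ * σ.gxt) := by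
  obtain ⟨C₃, hC₃, h₃⟩ := orderLE_Mv hc
  have hchi : 0 < chi := hlo.trans_le hhi
  refine ⟨√(1 / clo) * (1 + 2 * C₃) * chi, by positivity, fun μ σ r hμ hL hr hgxt hfx => ?_⟩
  have hκ := one_pos.trans_le (one_le_kappa hμ hL)
  have hM := Mv_pos hc hμ
  have hM' : Mv c μ ≤ C₃ * kappa c μ := by simpa using (h₃ μ hμ hL).2
  have hcg := hr.cgam_pos hlo
  have s3 := Real.sqrt_le_sqrt (d3_div_tau_le hlo hr)
  calc sigmaC c μ σ r ≤ √(1 / clo) * (σ.fx + 2 * (C₃ * kappa c μ) * σ.gxt) * chi := by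
        unfold sigmaC
        gcongr
        exact hr.cgam_order.2
    _ ≤ √(1 / clo) * ((1 + 2 * C₃) * (σ.fx + kappa c μ * σ.gxt)) * chi := by
        gcongr
        have : 0 ≤ C₃ * σ.fx := by positivity
        have : 0 ≤ kappa c μ * σ.gxt := by positivity
        linarith
    _ = _ := by ring

end CoeffOrders

/-! ### The largest step size -/

section MaxStep

variable {c : ClassConst} {μ ρ clo chi : ℝ} {r : Coeffs} {σ : Noise}

/-- A single bound `D` then serves for the exponents `1/2`, `1/3` and `1/4` of `u2` alike. -/
theorem rpow_le_of_le_sq {X D e : ℝ} (hX : 0 ≤ X) (hD : 1 ≤ D) (h : X ≤ D ^ 2) (h0 : 0 ≤ e)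
    (h1 : e ≤ 1 / 2) : X ^ e ≤ D := by
  calc X ^ e ≤ (D ^ 2) ^ e := Real.rpow_le_rpow hX h h0
    _ ≤ (D ^ 2) ^ (1 / 2 : ℝ) := Real.rpow_le_rpow_of_exponent_le (one_le_pow₀ hD) h1
    _ = D := by rw [← Real.sqrt_eq_rpow, Real.sqrt_sq (by linarith)]

theorem div_mul_le_div {a D κ s X Y : ℝ} (ha : 0 < a) (hs : 0 ≤ s)
    (hX : a * s ≤ X) (hY0 : 0 < Y) (hY : Y ≤ D * κ) : a / D * (s / κ) ≤ X / Y := by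
  rw [div_mul_div_comm]
  exact div_le_div₀ ((mul_nonneg ha.le hs).trans hX) hX hY0 hY

theorem le_rpow_self {s e : ℝ} (h0 : 0 ≤ s) (h1 : s ≤ 1) (he1 : e ≤ 1) : s ≤ s ^ e := by
  rcases h0.eq_or_lt with rfl | h
  · exact Real.rpow_nonneg le_rfl e
  · simpa using Real.rpow_le_rpow_of_exponent_ge h h1 he1

/-- Admissibility bounds `4 L τ` by `cgam ≤ chi`, so `τ L` is bounded independently of `κ`. -/
theorem u1_ge (hc : c.Pos) (hμ : 0 < μ) (hlo : 0 < clo) (hr : Coeffs.Admissible c μ clo chi r) :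
    2 / chi ≤ u1 c μ r := by
  have hL := Lhyper_pos hc hμ
  have hτ := hr.tau_pos
  have h := hr.cgam_ge.trans hr.cgam_order.2
  have hchi : 0 < chi := (hr.cgam_pos hlo).trans_le hr.cgam_order.2
  rw [u1, div_le_div_iff₀ hchi (by positivity)]
  linarith

theorem u2_ge (hc : c.Pos) {Smax : ℝ} (hS : 0 < Smax) : ∃ a : ℝ, 0 < a ∧
    ∀ (μ ρ : ℝ) (σ : Noise), 0 < μ → μ ≤ c.Lgt → 0 ≤ ρ → ρ < 1 → 0 < σ.gxt → σ.gxt ≤ Smax →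
    a * ((1 - ρ) / kappa c μ ^ 3) ≤ u2 c μ ρ σ := by
  obtain ⟨C₁, hC₁, h₁⟩ := orderLE_phi hc
  obtain ⟨C₂, hC₂, h₂⟩ := (orderLE_Lfgx hc).mono (by norm_num : 2 ≤ 6)
  have hCg := hc.Cgxt
  have hQ : 0 < 2 * c.Lfx ^ 2 := by have := hc.Lfx; positivity
  set q := (2 * c.Lfx ^ 2) ^ (1 / 3 : ℝ)
  have hq : 0 < q := Real.rpow_pos_of_pos hQ _
  set w := c.Cgxt ^ (2 / 3 : ℝ)
  have hw : 0 < w := Real.rpow_pos_of_pos hCg _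
  set S := Smax ^ (2 / 3 : ℝ)
  have hS' : 0 < S := Real.rpow_pos_of_pos hS _
  refine ⟨min (1 / (12 * (1 + C₁))) (min (1 / (4 * (1 + C₁))) (min (q / (4 * (1 + C₁)))
    (min (1 / (3 * (1 + C₂))) (w / (4 * (1 + C₁) * S))))), by positivity,
    fun μ ρ σ hμ hL hρ0 hρ1 hσ hσS => ?_⟩
  have hκ1 := one_le_kappa hμ hL
  set κ := kappa c μ
  have hκ : 0 < κ ^ 3 := by positivity
  have hs : 0 ≤ 1 - ρ := by linarith
  have hs1 : 1 - ρ ≤ 1 := by linarith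
  have hφ := phi_pos (μ := μ) hc
  have hLx := Lfgx_pos (μ := μ) hc
  -- A quantity of order `κ⁶` is at most `((1 + C) κ³)²`, so its powers up to `1/2` are at most of
  -- order `κ³`; this is where `κ³` in the step size comes from.
  have bnd : ∀ {X C e : ℝ}, 0 < X → 0 < C → X ≤ C * κ ^ 6 → 0 ≤ e → e ≤ 1 / 2 →
      X ^ e ≤ (1 + C) * κ ^ 3 := fun {X C e} hX hC h h0 h1 => by
    refine rpow_le_of_le_sq hX.le (one_le_mul_of_one_le_of_one_le (by linarith)
      (one_le_pow₀ hκ1)) (h.trans ?_) h0 h1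
    rw [mul_pow, ← pow_mul]
    exact mul_le_mul_of_nonneg_right (by nlinarith) (by positivity)
  have b2 := bnd hφ hC₁ (h₁ μ hμ hL).2 (e := 1 / 2) (by norm_num) (by norm_num)
  have b3 := bnd hφ hC₁ (h₁ μ hμ hL).2 (e := 1 / 3) (by norm_num) (by norm_num)
  have b4 := bnd hLx hC₂ (h₂ μ hμ hL).2 (e := 1 / 4) (by norm_num) (by norm_num)
  have p2 := Real.rpow_pos_of_pos hφ (1 / 2)
  have p3 := Real.rpow_pos_of_pos hφ (1 / 3)
  have p4 := Real.rpow_pos_of_pos hLx (1 / 4)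
  have s2 := le_rpow_self hs hs1 (e := 1 / 2) (by norm_num)
  have s3 := le_rpow_self hs hs1 (e := 2 / 3) (by norm_num)
  -- `Qc` stands in a numerator, so a lower bound free of `μ` is needed; `2 Lfx²` is one.
  have hqQ : q ≤ Qc c μ ^ (1 / 3 : ℝ) := by
    refine Real.rpow_le_rpow hQ.le ?_ (by norm_num)
    refine le_trans ?_ (Lfgx_le_Qc hc)
    have : 0 ≤ 4 * Mv c μ ^ 2 * c.Lgxt ^ 2 := by positivity
    rw [Lfgx]; linarith
  have hσ' := Real.rpow_pos_of_pos hσ (2 / 3)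
  have hσS' : σ.gxt ^ (2 / 3 : ℝ) ≤ S := Real.rpow_le_rpow hσ.le hσS (by norm_num)
  have hsκ : 0 ≤ (1 - ρ) / κ ^ 3 := by positivity
  refine le_min ?_ (le_min ?_ (le_min ?_ (le_min ?_ ?_)))
  · refine (mul_le_mul_of_nonneg_right (min_le_left _ _) hsκ).trans
      (div_mul_le_div one_pos hs (one_mul _).le (by positivity) ?_)
    linarith
  · refine (mul_le_mul_of_nonneg_right ((min_le_right _ _).trans (min_le_left _ _)) hsκ).trans
      (div_mul_le_div one_pos hs ((one_mul _).le.trans s3) (by positivity) ?_)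
    linarith
  · refine (mul_le_mul_of_nonneg_right ((min_le_right _ _).trans ((min_le_right _ _).trans
      (min_le_left _ _))) hsκ).trans
      (div_mul_le_div hq hs (mul_le_mul hqQ s3 hs (hq.le.trans hqQ))
        (by positivity) ?_)
    linarith
  · refine (mul_le_mul_of_nonneg_right ((min_le_right _ _).trans ((min_le_right _ _).trans
      ((min_le_right _ _).trans (min_le_left _ _)))) hsκ).trans
      (div_mul_le_div one_pos hs ((one_mul _).le.trans s2) (by positivity) ?_)
    linarith
  · refine (mul_le_mul_of_nonneg_right ((min_le_right _ _).trans ((min_le_right _ _).trans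
      ((min_le_right _ _).trans (min_le_right _ _)))) hsκ).trans
      (div_mul_le_div hw hs (mul_le_mul_of_nonneg_left s3 hw.le)
        (by positivity) ?_)
    calc _ ≤ 4 * ((1 + C₁) * κ ^ 3) * S := by gcongr
      _ = _ := by ring

theorem u3_ge (hc : c.Pos) {Smax : ℝ} (hS : 0 < Smax) (hlo : 0 < clo) (hhi : clo ≤ chi) :
    ∃ a : ℝ, 0 < a ∧ ∀ (μ : ℝ) (σ : Noise) (r : Coeffs), 0 < μ → μ ≤ c.Lgt →
    0 < σ.gtt → σ.gtt ≤ Smax → 0 < σ.gxt → σ.gxt ≤ Smax → Coeffs.Admissible c μ clo chi r →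
    a / kappa c μ ≤ u3 c μ σ r := by
  have hchi : 0 < chi := hlo.trans_le hhi
  have hL' := hc.Lgt
  have hCg := hc.Cgxt
  have hk := kappa_one_pos hc
  refine ⟨min (1 / c.Lgt) (min (kappa c 1 / (32 * Smax ^ 2)) (min (1 / (2 * c.Lgt))
    (min 1 (c.Cgxt ^ 2 / Smax ^ 2)))) / (2 * chi), by positivity,
    fun μ σ r hμ hL hgtt hgttS hgxt hgxtS hr => ?_⟩
  set a := min (1 / c.Lgt) (min (kappa c 1 / (32 * Smax ^ 2)) (min (1 / (2 * c.Lgt))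
    (min 1 (c.Cgxt ^ 2 / Smax ^ 2))))
  have ha : 0 < a := by positivity
  have a1 : a ≤ 1 / c.Lgt := min_le_left _ _
  have a2 : a ≤ kappa c 1 / (32 * Smax ^ 2) := (min_le_right _ _).trans (min_le_left _ _)
  have a3 : a ≤ 1 / (2 * c.Lgt) :=
    (min_le_right _ _).trans ((min_le_right _ _).trans (min_le_left _ _))
  have a4 : a ≤ 1 := (min_le_right _ _).trans ((min_le_right _ _).trans
    ((min_le_right _ _).trans (min_le_left _ _)))
  have a5 : a ≤ c.Cgxt ^ 2 / Smax ^ 2 := (min_le_right _ _).trans ((min_le_right _ _).trans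
    ((min_le_right _ _).trans (min_le_right _ _)))
  have hκ1 := one_le_kappa hμ hL
  have hκ : 0 < kappa c μ := by linarith
  have haκ : a / kappa c μ ≤ a := div_le_self ha.le hκ1
  have hτ := hr.tau_pos
  have hLv := LvStar_pos hc hμ
  have hLh := Lhyper_pos hc hμ
  have hLt := LthetaStar_pos hc hμ
  have hω := omegaT_pos hc hμ
  have hQ := Qc_pos (μ := μ) hc
  -- Each entry of `u3` has the form `X M / Y` with `M` the cap on a step size, and admissibility
  -- gives `Y ≤ 2 chi X`, so `τ` and the large Lipschitz constants disappear.
  have main : ∀ {X M Y : ℝ}, 0 < Y → 0 < X → a / kappa c μ ≤ M → Y ≤ 2 * chi * X →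
      a / (2 * chi) / kappa c μ ≤ X * M / Y := fun {X M Y} hY hX hM hYX => by
    have h1 : 0 ≤ a / kappa c μ := by positivity
    rw [div_right_comm, div_le_div_iff₀ (by positivity) hY]
    calc a / kappa c μ * Y ≤ M * (2 * chi * X) :=
          mul_le_mul hM hYX hY.le (h1.trans hM)
      _ = _ := by ring
  refine le_min ?_ (le_min ?_ ?_)
  · refine main (by positivity) hμ (le_min (haκ.trans a1) ?_) ?_
    · have : μ = kappa c 1 / kappa c μ := by rw [kappa_eq c μ]; field_simp
      calc a / kappa c μ ≤ kappa c 1 / (32 * Smax ^ 2) / kappa c μ := by gcongr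
        _ = kappa c 1 / kappa c μ / (32 * Smax ^ 2) := by ring
        _ = μ / (32 * Smax ^ 2) := by rw [← this]
        _ ≤ _ := by gcongr
    · have h := hr.clam_ge.trans hr.clam_order.2
      rw [div_mul_eq_mul_div, div_le_iff₀ hμ] at h
      linarith
  · rw [mul_comm (betMax c μ)]
    refine main (by positivity) hω (le_min (haκ.trans (a1.trans ?_)) (haκ.trans (a3.trans ?_))) ?_
    · rw [div_le_div_iff₀ hL' (by positivity)]; linarith
    · rw [div_le_div_iff₀ (by positivity) (by positivity)]
      nlinarith
    · have h := hr.cbet_ge.trans hr.cbet_order.2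
      rw [div_mul_eq_mul_div, div_mul_eq_mul_div, div_le_iff₀ hω] at h
      linarith
  · rw [← one_mul (gamMax c σ)]
    refine main (by positivity) one_pos (haκ.trans (le_min a4 (a5.trans (by gcongr)))) ?_
    have h := hr.cgam_ge.trans hr.cgam_order.2
    linarith

theorem uMax_ge (hc : c.Pos) {Smax : ℝ} (hS : 0 < Smax) (hlo : 0 < clo) (hhi : clo ≤ chi) :
    ∃ a : ℝ, 0 < a ∧ ∀ (μ ρ : ℝ) (σ : Noise) (r : Coeffs), 0 < μ → μ ≤ c.Lgt → 0 ≤ ρ → ρ < 1 →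
    0 < σ.gtt → σ.gtt ≤ Smax → 0 < σ.gxt → σ.gxt ≤ Smax → Coeffs.Admissible c μ clo chi r →
    a * ((1 - ρ) / kappa c μ ^ 3) ≤ uMax c μ ρ σ r := by
  obtain ⟨a₂, ha₂, h₂⟩ := u2_ge hc hS
  obtain ⟨a₃, ha₃, h₃⟩ := u3_ge hc hS hlo hhi
  have hchi : 0 < chi := hlo.trans_le hhi
  refine ⟨min (2 / chi) (min a₂ a₃), by positivity,
    fun μ ρ σ r hμ hL hρ0 hρ1 hgtt hgttS hgxt hgxtS hr => ?_⟩
  have hκ1 := one_le_kappa hμ hL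
  have hκ : 0 < kappa c μ := by linarith
  have e0 : 0 ≤ (1 - ρ) / kappa c μ ^ 3 := div_nonneg (by linarith) (by positivity)
  have e1 : (1 - ρ) / kappa c μ ^ 3 ≤ 1 / kappa c μ :=
    div_le_div₀ one_pos.le (by linarith) hκ (le_self_pow₀ hκ1 (by norm_num))
  have e2 : 1 / kappa c μ ≤ 1 := (div_le_one hκ).2 hκ1
  refine le_min ?_ (le_min ?_ ?_)
  · refine le_trans ?_ (u1_ge hc hμ hlo hr)
    calc _ ≤ 2 / chi * 1 := mul_le_mul (min_le_left _ _) (e1.trans e2) e0 (by positivity)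
      _ = _ := mul_one _
  · refine le_trans ?_ (h₂ μ ρ σ hμ hL hρ0 hρ1 hgxt hgxtS)
    exact mul_le_mul_of_nonneg_right ((min_le_right _ _).trans (min_le_left _ _)) e0
  · refine le_trans ?_ (h₃ μ σ r hμ hL hgtt hgttS hgxt hgxtS hr)
    calc _ ≤ a₃ * (1 / kappa c μ) :=
          mul_le_mul ((min_le_right _ _).trans (min_le_right _ _)) e1 e0 ha₃.le
      _ = _ := mul_one_div _ _

/-- The first entry of `u2` says `144 φ α² ≤ (1-ρ)²`, which is the claim after clearing
denominators. -/
theorem d4_le_of_le (hc : c.Pos) (hlo : 0 < clo) (hr : Coeffs.Admissible c μ clo chi r)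
    (hρ : ρ < 1) {α : ℝ} (hα : 0 ≤ α) (h : α ≤ uMax c μ ρ σ r) : d4 c μ ρ r α ≤ d3 r / 3 := by
  have hφ := phi_pos (μ := μ) hc
  have h1 : α ≤ (1 - ρ) / (12 * phi c μ ^ (1 / 2 : ℝ)) :=
    h.trans ((min_le_right _ _).trans ((min_le_left _ _).trans (min_le_left _ _)))
  have hs : 0 < 1 - ρ := by linarith
  have hcg := hr.cgam_pos hlo
  have hτ := hr.tau_pos
  rw [← Real.sqrt_eq_rpow, le_div_iff₀ (by positivity)] at h1
  have h2 := pow_le_pow_left₀ (by positivity) h1 2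
  rw [mul_pow, mul_pow, Real.sq_sqrt hφ.le] at h2
  rw [d4, d3, div_div, div_le_div_iff₀ (by positivity) (by positivity)]
  calc 24 * phi c μ * r.τ * α ^ 2 * (2 * r.cgam * 3)
      = (α ^ 2 * (12 ^ 2 * phi c μ)) * (r.τ * r.cgam) := by ring
    _ ≤ (1 - ρ) ^ 2 * (r.τ * r.cgam) := by gcongr
    _ = _ := by ring

theorem d4_mono (hc : c.Pos) (hlo : 0 < clo) (hr : Coeffs.Admissible c μ clo chi r) {α α' : ℝ}
    (hα : 0 ≤ α) (h : α ≤ α') : d4 c μ ρ r α ≤ d4 c μ ρ r α' := by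
  have := phi_pos (μ := μ) hc
  have := hr.tau_pos
  have := hr.cgam_pos hlo
  unfold d4
  gcongr

end MaxStep

/-! ### The initial value of the Lyapunov function -/

section Initial

variable {m n p : ℕ} {c : ClassConst} {μ ρ clo chi α Φlow : ℝ} {r : Coeffs} {σ : Noise}
  {f g : Fin m → Vec n → Vec p → ℝ} {x₀ : Vec n} {θ₀ v₀ : Fin m → Vec p} {z₀ : Fin m → Vec n}

theorem xBar_initState (hm : 0 < m) : xBar (initState x₀ θ₀ v₀ z₀) = x₀ := vmean_const hm x₀

theorem V0_eq (hf : ∀ i, OuterAssumption c (f i) (g i)) (hg : ∀ i, InnerAssumption c μ (g i))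
    (hm : 0 < m) (hμ : 0 < μ) :
    V0 c μ ρ σ r f g Φlow x₀ θ₀ v₀ z₀ = 1 / r.τ * (objective f g x₀ - Φlow)
      + d1 c μ r / r.τ * errV f g (initState x₀ θ₀ v₀ z₀)
      + d2 c μ r / r.τ * errT g (initState x₀ θ₀ v₀ z₀)
      + d3 r / r.τ * errZbar f g (initState x₀ θ₀ v₀ z₀)
      + d4 c μ ρ r (uMax c μ ρ σ r) / r.τ * errZ f g (initState x₀ θ₀ v₀ z₀) := by
  unfold V0 errV errT errZbar errZ
  rw [xBar_initState hm, (hasGradientAt_objective hf hg hμ x₀).gradient]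
  simp only [gradient_localObj (hf _) (hg _) hμ]
  rfl

/-- The common initial point makes the consensus error vanish, and monotonicity of `d4` replaces `α`
by the largest step size, so that `V0`, which itself determines `α`, does not depend on `α`. -/
theorem lyap_initState_le (hf : ∀ i, OuterAssumption c (f i) (g i))
    (hg : ∀ i, InnerAssumption c μ (g i)) (hm : 0 < m) (hc : c.Pos) (hμ : 0 < μ) (hlo : 0 < clo)
    (hr : Coeffs.Admissible c μ clo chi r) (hα : 0 ≤ α) (hαu : α ≤ uMax c μ ρ σ r) :
    lyap c μ ρ r α f g (initState x₀ θ₀ v₀ z₀) - Φlow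
      ≤ r.τ * V0 c μ ρ σ r f g Φlow x₀ θ₀ v₀ z₀ := by
  have hτ := hr.tau_pos
  have hX : errX (initState x₀ θ₀ v₀ z₀) = 0 := by
    unfold errX
    rw [xBar_initState hm]
    simp [initState, avg]
  have h4 := mul_le_mul_of_nonneg_right (d4_mono (ρ := ρ) hc hlo hr hα hαu)
    (errZ_nonneg f g (initState x₀ θ₀ v₀ z₀))
  rw [V0_eq hf hg hm hμ, lyap, hX, xBar_initState hm, mul_zero, add_zero]
  field_simp
  linarith

theorem V0_ge (hf : ∀ i, OuterAssumption c (f i) (g i)) (hg : ∀ i, InnerAssumption c μ (g i))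
    (hm : 0 < m) (hc : c.Pos) (hμ : 0 < μ) (hlo : 0 < clo)
    (hr : Coeffs.Admissible c μ clo chi r) :
    1 / r.τ * (objective f g x₀ - Φlow) ≤ V0 c μ ρ σ r f g Φlow x₀ θ₀ v₀ z₀ := by
  have hτ := hr.tau_pos
  set s := initState x₀ θ₀ v₀ z₀
  have h1 := mul_nonneg (div_nonneg (d1_pos hc hμ hlo hr).le hτ.le) (errV_nonneg f g s)
  have h2 := mul_nonneg (div_nonneg (d2_pos hc hμ hlo hr).le hτ.le) (errT_nonneg g s)
  have h3 := mul_nonneg (div_nonneg (d3_pos hlo hr).le hτ.le) (errZbar_nonneg f g s)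
  have h4 := mul_nonneg (div_nonneg (d4_nonneg (μ := μ) (ρ := ρ) (α := uMax c μ ρ σ r) hc hlo
    hr) hτ.le) (errZ_nonneg f g s)
  rw [V0_eq hf hg hm hμ]
  linarith

/-- Every term is of order `κ⁵`: the weights are of orders `κ⁴, κ, κ⁵, 1, 1`, against initial errors
of orders `κ, κ⁴, 1, κ⁵, κ⁵`; the error of the mean tracker is at most the mean of the local errors.
-/
theorem V0_le (hc : c.Pos) (hlo : 0 < clo) {B : ℝ} (hB : 0 < B) : ∃ C : ℝ, 0 < C ∧
    ∀ (m n p : ℕ) (μ ρ chi Φlow : ℝ) (r : Coeffs) (σ : Noise)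
      (f g : Fin m → Vec n → Vec p → ℝ) (x₀ : Vec n) (θ₀ v₀ : Fin m → Vec p)
      (z₀ : Fin m → Vec n), 0 < m → 0 < μ → μ ≤ c.Lgt → ρ < 1 → 0 ≤ uMax c μ ρ σ r →
    (∀ i, OuterAssumption c (f i) (g i)) → (∀ i, InnerAssumption c μ (g i)) →
    Coeffs.Admissible c μ clo chi r →
    objective f g x₀ - Φlow ≤ B * kappa c μ →
    errT g (initState x₀ θ₀ v₀ z₀) ≤ B →
    errV f g (initState x₀ θ₀ v₀ z₀) ≤ B * kappa c μ ^ 4 →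
    errZ f g (initState x₀ θ₀ v₀ z₀) ≤ B * kappa c μ ^ 5 →
    V0 c μ ρ σ r f g Φlow x₀ θ₀ v₀ z₀ ≤ C * kappa c μ ^ 5 := by
  obtain ⟨C₁, hC₁, h₁⟩ := d1_div_tau_le hc hlo
  obtain ⟨C₂, hC₂, h₂⟩ := d2_div_tau_le hc hlo
  refine ⟨B * (1 / clo + C₁ + C₂ + 2 / clo), by positivity, ?_⟩
  intro m n p μ ρ chi Φlow r σ f g x₀ θ₀ v₀ z₀ hm hμ hL hρ hu hf hg hr b0 bT bV bZ
  have hτ := hr.tau_pos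
  have hκ := one_pos.trans_le (one_le_kappa hμ hL)
  set s := initState x₀ θ₀ v₀ z₀
  set κ := kappa c μ
  have bB : errZbar f g s ≤ errZ f g s := by
    unfold errZbar errZ meanGrad
    rw [← vmean_sub]
    exact norm_vmean_sq_le hm _
  have e3 := d3_div_tau_le hlo hr
  have e4 : d4 c μ ρ r (uMax c μ ρ σ r) / r.τ ≤ 1 / clo := by
    refine le_trans ?_ e3
    have := d3_pos hlo hr
    gcongr
    linarith [d4_le_of_le hc hlo hr hρ hu le_rfl]
  rw [V0_eq hf hg hm hμ]
  have t0 : 1 / r.τ * (objective f g x₀ - Φlow) ≤ (1 / clo * κ ^ 4) * (B * κ) :=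
    (mul_le_mul_of_nonneg_left b0 (by positivity)).trans
      (mul_le_mul_of_nonneg_right (inv_tau_le hlo hr hμ hL) (by positivity))
  have t1 := mul_le_mul (h₁ μ chi r hμ hL hr) bV (errV_nonneg f g s) (by positivity)
  have t2 := mul_le_mul (h₂ μ chi r hμ hL hr) bT (errT_nonneg g s) (by positivity)
  have t3 := mul_le_mul e3 (bB.trans bZ) (errZbar_nonneg f g s) (by positivity)
  have t4 := mul_le_mul e4 bZ (errZ_nonneg f g s) (by positivity)
  calc _ ≤ 1 / clo * κ ^ 4 * (B * κ) + C₁ * κ * (B * κ ^ 4) + C₂ * κ ^ 5 * B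
        + 1 / clo * (B * κ ^ 5) + 1 / clo * (B * κ ^ 5) := by gcongr
    _ = _ := by ring

end Initial

/-! ### The choice of the step size -/

section StepSize

variable {c : ClassConst} {μ ρ bf bg clo chi V : ℝ} {r : Coeffs} {σ : Noise} {m : ℕ}

/-- A step size `min u (min A D)` balances the three error terms, up to constants. -/
theorem balance_le {u A D N V a₁ a₂ q : ℝ} (hu : 0 < u) (hA : 0 < A) (hD : 0 < D) (hN : 0 < N)
    (hV : 0 < V) (ha₁ : 0 < a₁) (ha₂ : 0 < a₂) (hq : 0 ≤ q) (hA2 : A ^ 2 = 4 * V / (a₁ * N))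
    (hD3 : D ^ 3 = 4 * V / (a₂ * N)) :
    2 * V / (min u (min A D) * N) + q * a₂ * min u (min A D) ^ 2 + a₁ * min u (min A D)
      ≤ 2 * V / (u * N) + 3 / 2 * (a₁ * A) + (1 / 2 + q) * (a₂ * D ^ 2) := by
  set α := min u (min A D)
  have hα : 0 < α := lt_min hu (lt_min hA hD)
  have h1 : α ≤ A := (min_le_right _ _).trans (min_le_left _ _)
  have h2 : α ≤ D := (min_le_right _ _).trans (min_le_right _ _)
  -- `α` equals one of the three candidates, so its inverse is one of the summands.
  have h3 : 1 / α ≤ 1 / u + (1 / A + 1 / D) := by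
    have : 0 < 1 / u := by positivity
    have : 0 < 1 / A := by positivity
    have : 0 < 1 / D := by positivity
    rcases min_choice u (min A D) with h | h
    · change 1 / min u (min A D) ≤ _
      rw [h]; linarith
    · rcases min_choice A D with h' | h'
      · change 1 / min u (min A D) ≤ _
        rw [h, h']; linarith
      · change 1 / min u (min A D) ≤ _
        rw [h, h']; linarith
  -- `A` is where `2V/(AN)` and the noise term `a₁ A` agree up to a factor 2; `D` plays the same
  -- role for `a₂ D²`.
  have e1 : 2 * V / N * (1 / A) = 1 / 2 * (a₁ * A) := by
    have : a₁ * A ^ 2 = 4 * V / N := by rw [hA2]; field_simp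
    have h : 2 * V / N = 1 / 2 * (a₁ * A ^ 2) := by rw [this]; ring
    rw [h]; field_simp
  have e2 : 2 * V / N * (1 / D) = 1 / 2 * (a₂ * D ^ 2) := by
    have : a₂ * D ^ 3 = 4 * V / N := by rw [hD3]; field_simp
    have h : 2 * V / N = 1 / 2 * (a₂ * D ^ 3) := by rw [this]; ring
    rw [h]; field_simp
  have h4 := mul_le_mul_of_nonneg_left h3 (by positivity : 0 ≤ 2 * V / N)
  have h5 : q * a₂ * α ^ 2 ≤ q * a₂ * D ^ 2 := by gcongr
  have h6 : a₁ * α ≤ a₁ * A := by gcongr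
  have e3 : 2 * V / (α * N) = 2 * V / N * (1 / α) := by field_simp
  have e4 : 2 * V / (u * N) = 2 * V / N * (1 / u) := by field_simp
  rw [e3, e4]
  rw [mul_add, mul_add, e1, e2] at h4
  linarith

theorem sigmaP_pos (hc : c.Pos) (hμ : 0 < μ) (hlo : 0 < clo)
    (hr : Coeffs.Admissible c μ clo chi r) (hgt : 0 ≤ σ.gt) (hgtt : 0 < σ.gtt) (hft : 0 ≤ σ.ft) :
    0 < sigmaP c μ σ r := by
  have := hr.tau_pos
  have := d1_pos hc hμ hlo hr
  have := Mv_pos hc hμ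
  have := hr.clam_pos hlo
  have := hr.cbet_pos hlo
  unfold sigmaP
  positivity

theorem sigmaC_nonneg (hc : c.Pos) (hμ : 0 < μ) (hlo : 0 < clo)
    (hr : Coeffs.Admissible c μ clo chi r) (hgxt : 0 < σ.gxt) (hfx : 0 ≤ σ.fx) :
    0 ≤ sigmaC c μ σ r := by
  have := Mv_pos hc hμ
  have := hr.cgam_pos hlo
  unfold sigmaC
  positivity

theorem a1_eq : a1 c μ σ r m = 8 * (sigmaP c μ σ r + sigmaC c μ σ r / √(m : ℝ)) ^ 2 := by
  have h : √2 ^ 2 = (2 : ℝ) := Real.sq_sqrt zero_le_two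
  unfold a1
  linear_combination 4 * (sigmaP c μ σ r + sigmaC c μ σ r / √(m : ℝ)) ^ 2 * h

theorem bSq_pos (hbf : 0 < bf) (hμ : 0 < μ) : 0 < bSq c μ bf bg := by
  have h1 : 0 < (4 + 4 * c.Cgxt ^ 2 / μ ^ 2) * bf ^ 2 := by positivity
  unfold bSq
  exact add_pos_of_pos_of_nonneg h1 (by positivity)

theorem a2_pos (hc : c.Pos) (hm : 0 < m) (hbf : 0 < bf) (hμ : 0 < μ) (hρ : ρ < 1) (hlo : 0 < clo)
    (hr : Coeffs.Admissible c μ clo chi r) : 0 < a2 c μ ρ r m bf bg := by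
  have := bSq_pos (c := c) (bg := bg) hbf hμ
  have := phi_pos (μ := μ) hc
  have := hr.cgam_pos hlo
  have h1 : 0 < 1 - ρ := by linarith
  have h2 : 0 < (m : ℝ) := Nat.cast_pos.2 hm
  unfold a2 vartheta
  positivity

/-- The definition of `a2` contains `1 / cgam`, which the `α³` term lacks; the bound `cgam ≤ chi`
restores it and explains the constant `3/2 chi`. -/
theorem two_div_mul_stepError_le (hc : c.Pos) (hm : 0 < m) (hμ : 0 < μ) (hlo : 0 < clo)
    (hr : Coeffs.Admissible c μ clo chi r) (hbf : 0 < bf) (hρ : ρ < 1) (hgt : 0 ≤ σ.gt)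
    (hgtt : 0 < σ.gtt) (hgxt : 0 < σ.gxt) (hft : 0 ≤ σ.ft) (hfx : 0 ≤ σ.fx) {α : ℝ} (hα : 0 < α) :
    2 / (r.τ * α) * stepError c μ ρ σ r m bf bg α
      ≤ 3 / 2 * chi * a2 c μ ρ r m bf bg * α ^ 2 + a1 c μ σ r m * α := by
  have hτ := hr.tau_pos
  have hp := sigmaP_pos hc hμ hlo hr hgt hgtt hft
  have hcn := sigmaC_nonneg hc hμ hlo hr hgxt hfx
  have hm' : 0 < (m : ℝ) := Nat.cast_pos.2 hm
  have hcg := hr.cgam_pos hlo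
  have hs : 0 < 1 - ρ := by linarith
  have h1 : 8 * sigmaP c μ σ r ^ 2 + 8 * (sigmaC c μ σ r ^ 2 / m) ≤ a1 c μ σ r m := by
    have h : (sigmaC c μ σ r / √(m : ℝ)) ^ 2 = sigmaC c μ σ r ^ 2 / m := by
      rw [div_pow, Real.sq_sqrt hm'.le]
    have : 0 ≤ sigmaP c μ σ r * (sigmaC c μ σ r / √(m : ℝ)) := by positivity
    rw [a1_eq, ← h]
    linarith
  have h2 : 144 * (phi c μ / (1 - ρ) ^ 2 * (bSq c μ bf bg / m))
      = 3 / 2 * r.cgam * a2 c μ ρ r m bf bg := by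
    unfold a2 vartheta
    field_simp
    ring
  have h3 : 3 / 2 * r.cgam * a2 c μ ρ r m bf bg ≤ 3 / 2 * chi * a2 c μ ρ r m bf bg := by
    have := a2_pos (bg := bg) hc hm hbf hμ hρ hlo hr
    gcongr
    exact hr.cgam_order.2
  calc 2 / (r.τ * α) * stepError c μ ρ σ r m bf bg α
      = 144 * (phi c μ / (1 - ρ) ^ 2 * (bSq c μ bf bg / m)) * α ^ 2
        + (4 * sigmaP c μ σ r ^ 2 + 8 * (sigmaC c μ σ r ^ 2 / m)) * α := by
        unfold stepError; field_simp; ring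
    _ ≤ _ := by
        rw [h2]
        gcongr
        linarith [sq_nonneg (sigmaP c μ σ r)]

end StepSize

/-! ### The rate -/

section Rate

variable {m n p : ℕ} {c : ClassConst} {μ ρ bf bg clo chi V : ℝ} {r : Coeffs} {σ : Noise}

theorem alphaK_nonneg (hu : 0 ≤ uMax c μ ρ σ r) (hV : 0 ≤ V) (ha₁ : 0 < a1 c μ σ r m)
    (ha₂ : 0 < a2 c μ ρ r m bf bg) (K : ℕ) : 0 ≤ alphaK c μ ρ σ r m bf bg V K :=
  le_min hu (le_min (by positivity) (by positivity))

theorem tendsto_alphaK (hu : 0 ≤ uMax c μ ρ σ r) (hV : 0 ≤ V) (ha₁ : 0 < a1 c μ σ r m)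
    (ha₂ : 0 < a2 c μ ρ r m bf bg) :
    Filter.Tendsto (alphaK c μ ρ σ r m bf bg V) Filter.atTop (nhds 0) := by
  have h1 : Filter.Tendsto (fun K : ℕ => 4 * V / (a1 c μ σ r m * ((K : ℝ) + 1))) Filter.atTop
      (nhds 0) :=
    Filter.Tendsto.div_atTop tendsto_const_nhds ((Filter.tendsto_atTop_add_const_right _ _
      tendsto_natCast_atTop_atTop).const_mul_atTop ha₁)
  have h2 := h1.rpow_const (p := 1 / 2) (Or.inr (by norm_num))
  rw [Real.zero_rpow (by norm_num)] at h2
  exact squeeze_zero (alphaK_nonneg hu hV ha₁ ha₂)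
    (fun K => (min_le_right _ _).trans (min_le_left _ _)) h2

theorem eventually_smallStep (hc : c.Pos) (hm : 0 < m) (hμ : 0 < μ) (hlo : 0 < clo)
    (hr : Coeffs.Admissible c μ clo chi r) (hgtt : 0 < σ.gtt) (hgxt : 0 < σ.gxt)
    {a : ℕ → ℝ} (ha : Filter.Tendsto a Filter.atTop (nhds 0)) :
    ∃ K₀ : ℕ, ∀ K ≥ K₀, SmallStep c μ ρ σ r m (a K) := by
  have hL := hc.Lgt
  have hC := hc.Cgxt
  have hm' : 0 < (m : ℝ) := Nat.cast_pos.2 hm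
  have h3 := d3_pos hlo hr
  have hlm : 0 < lamMax c μ σ := by unfold lamMax; positivity
  have hbm : 0 < betMax c μ := by unfold betMax; positivity
  have hgm : 0 < gamMax c σ := by unfold gamMax; positivity
  have e1 := ha.eventually_lt_const (u := 1 / (m : ℝ)) (by positivity)
  have e2 : Filter.Tendsto (fun K => d4 c μ ρ r (a K)) Filter.atTop (nhds 0) := by
    have := ((ha.pow 2).const_mul (24 * phi c μ * r.τ)).div_const ((1 - ρ) ^ 2 * r.cgam)
    simpa [d4] using this
  have e2 := e2.eventually_lt_const (u := d3 r / (m : ℝ)) (by positivity)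
  have mul0 : ∀ q : ℝ, Filter.Tendsto (fun K => q * a K) Filter.atTop (nhds 0) := fun q => by
    simpa using ha.const_mul q
  obtain ⟨K₀, h⟩ := Filter.eventually_atTop.1 (e1.and (e2.and
    (((mul0 r.clam).eventually_lt_const hlm).and (((mul0 r.cbet).eventually_lt_const hbm).and
      ((mul0 r.cgam).eventually_lt_const hgm)))))
  exact ⟨K₀, fun K hK => by
    obtain ⟨h1, h2, h3, h4, h5⟩ := h K hK
    exact ⟨h1.le, h2.le, h3, h4, h5⟩⟩

theorem stepBound_of_smallStep (hc : c.Pos) (hμ : 0 < μ) (hlo : 0 < clo)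
    (hr : Coeffs.Admissible c μ clo chi r) (hρ : ρ < 1) {α : ℝ} (hα : 0 < α)
    (hαu : α ≤ uMax c μ ρ σ r) (h : SmallStep c μ ρ σ r m α) : StepBound c μ ρ σ r m α where
  pos := hα
  le_u1 := by
    have hL := Lhyper_pos hc hμ
    have hτ := hr.tau_pos
    have h1 : α ≤ 1 / (2 * r.τ * Lhyper c μ) := hαu.trans (min_le_left _ _)
    rw [le_div_iff₀ (by positivity)] at h1
    linarith
  d4_le := d4_le_of_le hc hlo hr hρ hα.le hαu
  d4_le_div := h.d4_le
  lam_lt := h.lam_lt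
  bet_lt := h.bet_lt
  gam_lt := h.gam_lt

theorem transient_term_le {u N K a Cv κ s : ℝ} (ha : 0 < a) (hκ : 0 < κ) (hs : 0 < s) (hK : 0 < K)
    (hKN : K ≤ N) (hu : a * (s / κ ^ 3) ≤ u) (hV : V ≤ Cv * κ ^ 5) (hV0 : 0 ≤ V) :
    2 * V / (u * N) ≤ 2 * Cv / a * (κ ^ 8 / (s * K)) := by
  have hu0 : 0 ≤ u := le_trans (by positivity) hu
  have hV1 := hV0.trans hV
  calc 2 * V / (u * N) ≤ 2 * (Cv * κ ^ 5) / (a * (s / κ ^ 3) * K) := by gcongr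
    _ = _ := by field_simp

/-- Compared after squaring: `(a₁ A)² = 4 a₁ V / N`, which is of order `κ⁵ s² / K`. -/
theorem sampling_term_le {A N K Cv κ a₁ s : ℝ} (hκ : 0 < κ) (hK : 0 < K) (hKN : K ≤ N)
    (hs : 0 ≤ s) (ha₁ : 0 < a₁) (hCv : 0 ≤ Cv) (ha : a₁ = 8 * s ^ 2) (hV : V ≤ Cv * κ ^ 5)
    (hA2 : A ^ 2 = 4 * V / (a₁ * N)) :
    a₁ * A ≤ √(32 * Cv) * (κ ^ (5 / 2 : ℝ) * s / √K) := by
  have hN := hK.trans_le hKN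
  have h5 : (κ ^ (5 / 2 : ℝ)) ^ 2 = κ ^ 5 := by
    rw [← Real.rpow_natCast, ← Real.rpow_mul hκ.le, ← Real.rpow_natCast]; norm_num
  refine le_of_pow_le_pow_left₀ two_ne_zero (by positivity) ?_
  calc (a₁ * A) ^ 2 = 32 * s ^ 2 * V / N := by
        rw [mul_pow, hA2, show a₁ ^ 2 = 8 * s ^ 2 * a₁ by rw [← ha]; ring]
        field_simp
        ring
    _ ≤ 32 * s ^ 2 * (Cv * κ ^ 5) / K := by gcongr
    _ = _ := by
        rw [mul_pow, div_pow, mul_pow, Real.sq_sqrt (by positivity), Real.sq_sqrt hK.le, h5]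
        ring

/-- Compared after cubing: `(a₂ D²)³ = 16 a₂ V² / N²`, and `κ⁶ · (κ⁵)² = κ¹⁶`. -/
theorem heterogeneity_term_le {D N K Cv Cφ κ s b M a₂ : ℝ} (hκ : 0 < κ) (hs : 0 < s) (hK : 0 < K)
    (hKN : K ≤ N) (hb : 0 ≤ b) (hM : 0 < M) (ha₂ : 0 < a₂) (hCφ : 0 ≤ Cφ)
    (hV0 : 0 ≤ V) (ha : a₂ ≤ Cφ * κ ^ 6 / s ^ 2 * (b ^ 2 / M)) (hV : V ≤ Cv * κ ^ 5)
    (hD3 : D ^ 3 = 4 * V / (a₂ * N)) :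
    a₂ * D ^ 2 ≤ (16 * Cφ * Cv ^ 2) ^ (1 / 3 : ℝ) *
      (κ ^ (16 / 3 : ℝ) * (b / √M) ^ (2 / 3 : ℝ) / (s ^ (2 / 3 : ℝ) * K ^ (2 / 3 : ℝ))) := by
  have hN := hK.trans_le hKN
  have c1 : ((16 * Cφ * Cv ^ 2) ^ (1 / 3 : ℝ)) ^ 3 = 16 * Cφ * Cv ^ 2 := by
    rw [← Real.rpow_natCast, ← Real.rpow_mul (by positivity)]; norm_num
  have c2 : (κ ^ (16 / 3 : ℝ)) ^ 3 = κ ^ 16 := by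
    rw [← Real.rpow_natCast, ← Real.rpow_mul hκ.le, ← Real.rpow_natCast]; norm_num
  have c3 : ∀ x : ℝ, 0 ≤ x → (x ^ (2 / 3 : ℝ)) ^ 3 = x ^ 2 := fun x hx => by
    rw [← Real.rpow_natCast, ← Real.rpow_mul hx, ← Real.rpow_natCast]; norm_num
  refine le_of_pow_le_pow_left₀ three_ne_zero (by positivity) ?_
  calc (a₂ * D ^ 2) ^ 3 = a₂ ^ 3 * (D ^ 3) ^ 2 := by ring
    _ = 16 * a₂ * V ^ 2 / N ^ 2 := by rw [hD3]; field_simp; ring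
    _ ≤ 16 * (Cφ * κ ^ 6 / s ^ 2 * (b ^ 2 / M)) * (Cv * κ ^ 5) ^ 2 / K ^ 2 := by gcongr
    _ = 16 * Cφ * Cv ^ 2 * (κ ^ 16 * (b ^ 2 / M) / (s ^ 2 * K ^ 2)) := by field_simp
    _ = _ := by
        rw [mul_pow, div_pow, mul_pow, mul_pow, c1, c2, c3 _ (by positivity), c3 _ hs.le,
          c3 _ hK.le, div_pow, Real.sq_sqrt hM.le]

variable {f g : Fin m → Vec n → Vec p → ℝ} {G : SimpleGraph (Fin m)}
  {W : Matrix (Fin m) (Fin m) ℝ} {Ω S : Type*} [MeasurableSpace Ω] [MeasurableSpace S]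
  {P : Measure Ω} [IsProbabilityMeasure P] {O : Oracle m n p S}
  {ζ : Channel → Fin m → ℕ → Ω → S} {Φlow : ℝ} {x₀ : Vec n} {θ₀ v₀ : Fin m → Vec p}
  {z₀ : Fin m → Vec n}

-- Serves the degenerate case in which the initial Lyapunov bound is zero and the prescribed step
-- size vanishes.
omit [MeasurableSpace Ω] [MeasurableSpace S] in
theorem xBar_iterate_of_zero {t : StepSizes} (hW : NetworkAssumption G W) (ht : t.α = 0)
    (s₀ : State m n p) (ω : Ω) (k : ℕ) : xBar (iterate W O t ζ s₀ ω k) = xBar s₀ := by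
  induction k with
  | zero => rfl
  | succ k ih => rw [iterate, xBar_step hW, ih, ht, mul_zero, zero_smul, sub_zero]

theorem average_grad_le (hm : 0 < m) (hc : c.Pos) (hf : ∀ i, OuterAssumption c (f i) (g i))
    (hg : ∀ i, InnerAssumption c μ (g i)) (hμ : 0 < μ) (hμL : μ ≤ c.Lgt) (hbf : 0 < bf)
    (hh : Heterogeneity bf bg f g) (hW : NetworkAssumption G W)
    (hS : StochasticAssumption P f g O σ ζ) (hlo : 0 < clo)
    (hr : Coeffs.Admissible c μ clo chi r) (hgt : 0 ≤ σ.gt) (hgtt : 0 < σ.gtt)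
    (hgxt : 0 < σ.gxt) (hft : 0 ≤ σ.ft) (hfx : 0 ≤ σ.fx)
    {α : ℝ} (hα : StepBound c μ (netRho W) σ r m α) (hαu : α ≤ uMax c μ (netRho W) σ r)
    (hlow : ∀ x, Φlow ≤ objective f g x) :
    (∀ k, Integrable (fun ω => ‖gradient (objective f g)
      (xBar (iterate W O (r.toSteps α) ζ (initState x₀ θ₀ v₀ z₀) ω k))‖ ^ 2) P) ∧
    ∀ K : ℕ, 1 / ((K : ℝ) + 1) * ∑ k ∈ Finset.range (K + 1), ∫ ω, ‖gradient (objective f g)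
      (xBar (iterate W O (r.toSteps α) ζ (initState x₀ θ₀ v₀ z₀) ω k))‖ ^ 2 ∂P
      ≤ 2 * V0 c μ (netRho W) σ r f g Φlow x₀ θ₀ v₀ z₀ / (α * ((K : ℝ) + 1))
        + 3 / 2 * chi * a2 c μ (netRho W) r m bf bg * α ^ 2 + a1 c μ σ r m * α := by
  have hgr : ∀ x, gradient (objective f g) x = meanGrad f g x := fun x =>
    (hasGradientAt_objective hf hg hμ x).gradient
  simp only [hgr]
  obtain ⟨h1, h2⟩ := sum_integral_grad_le hm hc hf hg hμ hμL hh hW hS hlo hr hgt hgtt hgxt hft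
    hfx hα hlow (initState x₀ θ₀ v₀ z₀) rfl
  refine ⟨h1, fun K => ?_⟩
  have hα0 := hα.pos
  have hτ := hr.tau_pos
  have hK : 0 < (K : ℝ) + 1 := by positivity
  have h3 := h2 (K + 1)
  have h4 := lyap_initState_le (Φlow := Φlow) (x₀ := x₀) (θ₀ := θ₀) (v₀ := v₀) (z₀ := z₀) hf hg
    hm hc hμ hlo hr hα0.le hαu
  have h5 := two_div_mul_stepError_le (bg := bg) hc hm hμ hlo hr hbf hW.rho_lt_one hgt hgtt hgxt
    hft hfx hα0
  set I := ∑ k ∈ Finset.range (K + 1), ∫ ω, ‖meanGrad f g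
      (xBar (iterate W O (r.toSteps α) ζ (initState x₀ θ₀ v₀ z₀) ω k))‖ ^ 2 ∂P
  set V := V0 c μ (netRho W) σ r f g Φlow x₀ θ₀ v₀ z₀
  set E := stepError c μ (netRho W) σ r m bf bg α
  push_cast at h3
  have h6 : r.τ * α / 2 * I ≤ r.τ * V + (K + 1) * E := h3.trans (by linarith)
  calc 1 / ((K : ℝ) + 1) * I = 2 / (r.τ * α * (K + 1)) * (r.τ * α / 2 * I) := by field_simp
    _ ≤ 2 / (r.τ * α * (K + 1)) * (r.τ * V + (K + 1) * E) := by gcongr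
    _ = 2 * V / (α * (K + 1)) + 2 / (r.τ * α) * E := by field_simp
    _ ≤ _ := by linarith

theorem gradient_eq_zero_of_le {h : Vec n → ℝ} {x : Vec n} (hx : ∀ y, h x ≤ h y) :
    gradient h x = 0 := by
  rw [gradient, IsLocalMin.fderiv_eq_zero (Filter.Eventually.of_forall hx), map_zero]

end Rate

end LoPA

end

/-! ### The main theorem: existence of admissible ratios and the rate. -/

theorem mainTheorem3 (c : LoPA.ClassConst) (hc : c.Pos) :
    -- admissible ratios exist, with orders independent of the strong convexity modulus
    (∃ clo chi : ℝ, 0 < clo ∧ clo ≤ chi ∧ ∀ μ : ℝ, 0 < μ → μ ≤ c.Lgt →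
      ∃ r : LoPA.Coeffs, LoPA.Coeffs.Admissible c μ clo chi r) ∧
    -- and for all admissible ratios the rate holds
    ∀ clo chi Smax B : ℝ, 0 < clo → clo ≤ chi → 0 < Smax → 0 < B →
    ∃ C : ℝ, 0 < C ∧
    ∀ (m n p : ℕ), 0 < m → 0 < p →
    ∀ (Ω S : Type*) [MeasurableSpace Ω] [MeasurableSpace S]
      (P : MeasureTheory.Measure Ω) [MeasureTheory.IsProbabilityMeasure P]
      (μ bf bg : ℝ) (σ : LoPA.Noise)
      (f g : Fin m → LoPA.Vec n → LoPA.Vec p → ℝ)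
      (G : SimpleGraph (Fin m)) (W : Matrix (Fin m) (Fin m) ℝ)
      (O : LoPA.Oracle m n p S) (ζ : LoPA.Channel → Fin m → ℕ → Ω → S)
      (r : LoPA.Coeffs) (Φlow : ℝ) (x₀ : LoPA.Vec n) (θ₀ v₀ : Fin m → LoPA.Vec p)
      (z₀ : Fin m → LoPA.Vec n),
    0 < μ → 0 < bf → 0 < bg →
    0 ≤ σ.gt → 0 < σ.gtt → 0 < σ.gxt → 0 ≤ σ.ft → 0 ≤ σ.fx →
    σ.gtt ≤ Smax → σ.gxt ≤ Smax →
    -- the standing assumptions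
    LoPA.NetworkAssumption G W →
    (∀ i, LoPA.OuterAssumption c (f i) (g i)) →
    (∀ i, LoPA.InnerAssumption c μ (g i)) →
    LoPA.Heterogeneity bf bg f g →
    LoPA.StochasticAssumption P f g O σ ζ →
    LoPA.Coeffs.Admissible c μ clo chi r →
    -- the objective is bounded below, and the initial errors are bounded
    (∀ x, Φlow ≤ LoPA.objective f g x) →
    LoPA.objective f g x₀ - Φlow ≤ B * LoPA.kappa c μ →
    (1 / (m : ℝ)) * ∑ i, ‖θ₀ i - LoPA.innerSol (g i) x₀‖ ^ 2 ≤ B →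
    (1 / (m : ℝ)) * ∑ i, ‖v₀ i - LoPA.vStar (f i) (g i) x₀‖ ^ 2 ≤ B * LoPA.kappa c μ ^ 4 →
    (1 / (m : ℝ)) * ∑ i, ‖gradient (LoPA.localObj (f i) (g i)) x₀ - z₀ i‖ ^ 2
      ≤ B * LoPA.kappa c μ ^ 5 →
    let κ : ℝ := LoPA.kappa c μ
    let ρ : ℝ := LoPA.netRho W
    let b : ℝ := √(LoPA.bSq c μ bf bg)
    let σp : ℝ := LoPA.sigmaP c μ σ r
    let σc : ℝ := LoPA.sigmaC c μ σ r
    let V : ℝ := LoPA.V0 c μ ρ σ r f g Φlow x₀ θ₀ v₀ z₀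
    let α : ℕ → ℝ := LoPA.alphaK c μ ρ σ r m bf bg V
    -- `xb K k ω` is the average outer variable at iteration `k` of the run with step size `α K`
    let xb : ℕ → ℕ → Ω → LoPA.Vec n := fun K k ω =>
      LoPA.xBar (LoPA.iterate W O (r.toSteps (α K)) ζ (LoPA.initState x₀ θ₀ v₀ z₀) ω k)
    b ^ 2 ≤ C * (κ ^ 2 * bf ^ 2 + κ ^ 6 * bg ^ 2) ∧
    σp ≤ C * (κ ^ (1 / 2 : ℝ) * σ.ft + κ ^ (3 / 2 : ℝ) * σ.gtt + κ ^ (5 / 2 : ℝ) * σ.gt) ∧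
    σc ≤ C * (σ.fx + κ * σ.gxt) ∧
    (∃ K₀ : ℕ, ∀ K ≥ K₀, LoPA.SmallStep c μ ρ σ r m (α K)) ∧
    ∀ K : ℕ, 1 ≤ K → LoPA.SmallStep c μ ρ σ r m (α K) →
      (∀ k, MeasureTheory.Integrable
        (fun ω => ‖gradient (LoPA.objective f g) (xb K k ω)‖ ^ 2) P) ∧
      (1 / ((K : ℝ) + 1)) * ∑ k ∈ Finset.range (K + 1),
          ∫ ω, ‖gradient (LoPA.objective f g) (xb K k ω)‖ ^ 2 ∂P
        ≤ C * (κ ^ 8 / ((1 - ρ) * K)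
          + κ ^ (16 / 3 : ℝ) * (b / √(m : ℝ)) ^ (2 / 3 : ℝ)
              / ((1 - ρ) ^ (2 / 3 : ℝ) * (K : ℝ) ^ (2 / 3 : ℝ))
          + κ ^ (5 / 2 : ℝ) * (σp + σc / √(m : ℝ)) / √(K : ℝ)) := by
  refine ⟨LoPA.exists_admissible hc, fun clo chi Smax B hlo hhi hS hB => ?_⟩
  obtain ⟨Cb, hCb, hb⟩ := LoPA.bSq_le hc
  obtain ⟨Cp, hCp, hp⟩ := LoPA.sigmaP_le hc hlo hhi
  obtain ⟨Cc, hCc, hcc⟩ := LoPA.sigmaC_le hc hlo hhi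
  obtain ⟨a, ha, hu⟩ := LoPA.uMax_ge hc hS hlo hhi
  obtain ⟨Cv, hCv, hv⟩ := LoPA.V0_le hc hlo hB
  obtain ⟨Cφ, hCφ, hφ⟩ := LoPA.orderLE_phi hc
  have hchi : 0 < chi := hlo.trans_le hhi
  -- The constants of the transient, heterogeneity and sampling terms; the factors `1/2 + 3/2 chi`
  -- and `3/2` come from `balance_le` with `q = 3/2 chi`.
  set k₁ := 2 * Cv / a
  set k₂ := (1 / 2 + 3 / 2 * chi) * (16 * (96 * Cφ / clo) * Cv ^ 2) ^ (1 / 3 : ℝ)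
  set k₃ := 3 / 2 * √(32 * Cv)
  have hk₁ : 0 < k₁ := by positivity
  have hk₂ : 0 < k₂ := by positivity
  have hk₃ : 0 < k₃ := by positivity
  refine ⟨Cb + Cp + Cc + k₁ + k₂ + k₃, by positivity, ?_⟩
  intro m n p hm hpp Ω S _ _ P _ μ bf bg σ f g G W O ζ r Φlow x₀ θ₀ v₀ z₀ hμ hbf hbg hgt hgtt
    hgxt hft hfx hgttS hgxtS hW hf hg hh hSt hr hlow b0 bT bV bZ κ ρ b σp σc V α xb
  have hμL : μ ≤ c.Lgt := (hg ⟨0, hm⟩).le_Lgt hpp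
  have hκ : 0 < κ := one_pos.trans_le (LoPA.one_le_kappa hμ hμL)
  have hρ0 : 0 ≤ ρ := LoPA.netRho_nonneg W
  have hρ1 : ρ < 1 := hW.rho_lt_one
  have hs : 0 < 1 - ρ := by linarith
  have hbsq : b ^ 2 = LoPA.bSq c μ bf bg := Real.sq_sqrt (LoPA.bSq_pos hbf hμ).le
  have hτ := hr.tau_pos
  have hm' : 0 < (m : ℝ) := Nat.cast_pos.2 hm
  have hu' := hu μ ρ σ r hμ hμL hρ0 hρ1 hgtt hgttS hgxt hgxtS hr
  have hu0 : 0 < LoPA.uMax c μ ρ σ r := lt_of_lt_of_le (by positivity) hu'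
  have hσp : 0 < σp := LoPA.sigmaP_pos hc hμ hlo hr hgt hgtt hft
  have hσc : 0 ≤ σc := LoPA.sigmaC_nonneg hc hμ hlo hr hgxt hfx
  have ha₁ : LoPA.a1 c μ σ r m = 8 * (σp + σc / √(m : ℝ)) ^ 2 := LoPA.a1_eq
  have ha₁0 : 0 < LoPA.a1 c μ σ r m := by rw [ha₁]; positivity
  have ha₂0 : 0 < LoPA.a2 c μ ρ r m bf bg := LoPA.a2_pos hc hm hbf hμ hρ1 hlo hr
  have hVge : 1 / r.τ * (LoPA.objective f g x₀ - Φlow) ≤ V := LoPA.V0_ge hf hg hm hc hμ hlo hr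
  have hV0 : 0 ≤ V := le_trans (mul_nonneg (by positivity) (sub_nonneg.2 (hlow x₀))) hVge
  have hVle : V ≤ Cv * κ ^ 5 := by
    have e1 := LoPA.xBar_initState (x₀ := x₀) (θ₀ := θ₀) (v₀ := v₀) (z₀ := z₀) hm
    refine hv m n p μ ρ chi Φlow r σ f g x₀ θ₀ v₀ z₀ hm hμ hμL hρ1 hu0.le hf hg hr b0 ?_ ?_ ?_
    · rw [LoPA.errT, e1]; exact bT
    · rw [LoPA.errV, e1]; exact bV
    · rw [LoPA.errZ, e1]
      simp only [LoPA.gradient_localObj (hf _) (hg _) hμ] at bZ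
      exact bZ
  have le_C : ∀ {C X Y : ℝ}, C ≤ Cb + Cp + Cc + k₁ + k₂ + k₃ → 0 ≤ Y → X ≤ C * Y →
      X ≤ (Cb + Cp + Cc + k₁ + k₂ + k₃) * Y := fun hC hY h =>
    h.trans (mul_le_mul_of_nonneg_right hC hY)
  refine ⟨?_, ?_, ?_, ?_, ?_⟩
  · rw [hbsq]
    exact le_C (by linarith) (by positivity) (hb μ bf bg hμ hμL)
  · exact le_C (by linarith) (by positivity) (hp μ σ r hμ hμL hr hgt hgtt hft)
  · exact le_C (by linarith) (by positivity) (hcc μ σ r hμ hμL hr hgxt hfx)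
  · exact LoPA.eventually_smallStep hc hm hμ hlo hr hgtt hgxt
      (LoPA.tendsto_alphaK hu0.le hV0 ha₁0 ha₂0)
  intro K hK hsmall
  have hK' : 0 < (K : ℝ) := Nat.cast_pos.2 hK
  have hN : 0 < (K : ℝ) + 1 := by positivity
  have hT₁ : 0 ≤ κ ^ 8 / ((1 - ρ) * K) := by positivity
  have hT₂ : 0 ≤ κ ^ (16 / 3 : ℝ) * (b / √(m : ℝ)) ^ (2 / 3 : ℝ)
      / ((1 - ρ) ^ (2 / 3 : ℝ) * (K : ℝ) ^ (2 / 3 : ℝ)) := by positivity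
  have hT₃ : 0 ≤ κ ^ (5 / 2 : ℝ) * (σp + σc / √(m : ℝ)) / √(K : ℝ) := by positivity
  -- If `V = 0`, then `x₀` attains the lower bound `Φlow`, hence is a minimizer, and `α K = 0` keeps
  -- the mean there, so all the gradients vanish. Otherwise `A` and `D` are positive and the
  -- Lyapunov bound applies.
  rcases hV0.eq_or_lt with hV | hV
  · have hα0 : α K = 0 := by
      simp only [α, LoPA.alphaK, ← hV, mul_zero, zero_div]
      rw [Real.zero_rpow (by norm_num), Real.zero_rpow (by norm_num), min_self]
      exact min_eq_right hu0.le
    have hmin : ∀ x, LoPA.objective f g x₀ ≤ LoPA.objective f g x := fun x => by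
      rw [← hV] at hVge
      have h1 : LoPA.objective f g x₀ - Φlow ≤ 0 :=
        nonpos_of_mul_nonpos_right hVge (by positivity)
      linarith [hlow x]
    have hzero : ∀ k ω, ‖gradient (LoPA.objective f g) (xb K k ω)‖ ^ 2 = 0 := fun k ω => by
      have h1 : xb K k ω = x₀ :=
        (LoPA.xBar_iterate_of_zero hW hα0 _ ω k).trans (LoPA.xBar_initState hm)
      rw [h1, LoPA.gradient_eq_zero_of_le hmin, norm_zero, zero_pow two_ne_zero]
    simp only [hzero]
    refine ⟨fun k => MeasureTheory.integrable_zero _ _ _, ?_⟩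
    simp only [MeasureTheory.integral_zero, Finset.sum_const_zero, mul_zero]
    positivity
  set A := (4 * V / (LoPA.a1 c μ σ r m * ((K : ℝ) + 1))) ^ (1 / 2 : ℝ) with hAdef
  set D := (4 * V / (LoPA.a2 c μ ρ r m bf bg * ((K : ℝ) + 1))) ^ (1 / 3 : ℝ) with hDdef
  have hA : 0 < A := by positivity
  have hD : 0 < D := by positivity
  have hA2 : A ^ 2 = 4 * V / (LoPA.a1 c μ σ r m * ((K : ℝ) + 1)) := by
    rw [hAdef, ← Real.rpow_natCast, ← Real.rpow_mul (by positivity)]; norm_num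
  have hD3 : D ^ 3 = 4 * V / (LoPA.a2 c μ ρ r m bf bg * ((K : ℝ) + 1)) := by
    rw [hDdef, ← Real.rpow_natCast, ← Real.rpow_mul (by positivity)]; norm_num
  have hα : α K = min (LoPA.uMax c μ ρ σ r) (min A D) := rfl
  have hα0 : 0 < α K := hα ▸ lt_min hu0 (lt_min hA hD)
  have hαu : α K ≤ LoPA.uMax c μ ρ σ r := min_le_left _ _
  obtain ⟨h1, h2⟩ := LoPA.average_grad_le (x₀ := x₀) (θ₀ := θ₀) (v₀ := v₀) (z₀ := z₀) hm hc hf hg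
    hμ hμL hbf hh hW hSt hlo hr hgt hgtt hgxt hft hfx
    (LoPA.stepBound_of_smallStep hc hμ hlo hr hρ1 hα0 hαu hsmall) hαu hlow
  refine ⟨h1, (h2 K).trans ?_⟩
  have h3 := LoPA.balance_le hu0 hA hD hN hV ha₁0 ha₂0 (by positivity : 0 ≤ 3 / 2 * chi) hA2 hD3
  rw [← hα] at h3
  refine h3.trans ?_
  have hKN : (K : ℝ) ≤ (K : ℝ) + 1 := by linarith
  have t1 := LoPA.transient_term_le ha hκ hs hK' hKN hu' hVle hV0
  have t2 := LoPA.sampling_term_le hκ hK' hKN (by positivity) ha₁0 hCv.le ha₁ hVle hA2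
  have hcg := hr.cgam_pos hlo
  -- Here `96 = 4 · 24`, from `a₂ = 4 ϑ b² / m` and the 24 in `ϑ`; `φ = O(κ⁶)` and `cgam ≥ clo` do
  -- the rest.
  have ha₂ : LoPA.a2 c μ ρ r m bf bg ≤ 96 * Cφ / clo * κ ^ 6 / (1 - ρ) ^ 2 * (b ^ 2 / m) := by
    rw [hbsq]
    have hbp := LoPA.bSq_pos (c := c) (bg := bg) hbf hμ
    have e1 := (hφ μ hμ hμL).2
    have e2 := hr.cgam_order.1
    calc LoPA.a2 c μ ρ r m bf bg
        = 96 * (LoPA.phi c μ / r.cgam) / (1 - ρ) ^ 2 * (LoPA.bSq c μ bf bg / m) := by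
          unfold LoPA.a2 LoPA.vartheta; field_simp; ring
      _ ≤ 96 * (Cφ * κ ^ 6 / clo) / (1 - ρ) ^ 2 * (LoPA.bSq c μ bf bg / m) := by gcongr
      _ = _ := by ring
  have t3 := LoPA.heterogeneity_term_le hκ hs hK' hKN (Real.sqrt_nonneg _) hm' ha₂0
    (by positivity) hV0 ha₂ hVle hD3
  have t2' := (mul_le_mul_of_nonneg_left t2 (by norm_num : (0 : ℝ) ≤ 3 / 2)).trans_eq
    (mul_assoc _ _ _).symm
  have t3' := (mul_le_mul_of_nonneg_left t3 (by positivity : 0 ≤ 1 / 2 + 3 / 2 * chi)).trans_eq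
    (mul_assoc _ _ _).symm
  have r1 := le_C (by linarith : k₁ ≤ _) hT₁ t1
  have r2 := le_C (by linarith : k₂ ≤ _) hT₂ t3'
  have r3 := le_C (by linarith : k₃ ≤ _) hT₃ t2'
  exact (add_le_add (add_le_add r1 r3) r2).trans_eq (by ring)
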